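/- Let $\Omega=\{(x_1,x_2,y_1,y_2)\in\mathbb{R}^4 : y_1>0,\ y_2>0\}$ be the product of two half-planes, with $z_j=x_j+iy_j$, and let $g\in\mathcal{S}(\overline\Omega)$ be the restriction to $\overline\Omega$ of a complex-valued Schwartz function on $\mathbb{R}^4$. For a function $f$ on $\Omega$ let $f^{o1}$ denote its extension to $\mathbb{R}^4$ which is odd in $y_1$ and equal to $0$ for $y_2<0$. Write $\hat f(\xi_1,\xi_2,\eta_1,\eta_2)=\int_{\mathbb{R}^4} f\,e^{-i(x_1\xi_1+x_2\xi_2+y_1\eta_1+y_2\eta_2)}\,dx_1\,dx_2\,dy_1\,dy_2$; the integral $\hat g^{o1}$ also makes sense for complex $\eta_2$ with $\operatorname{Im}\eta_2\le 0$. Then there is a function $u$ on $\Omega$ such that $u^{o1}$ defines a tempered distribution by integration, with Fourier transform $$\hat u^{o1}=-\frac{\hat g^{o1}(\xi_1,\xi_2,\eta_1,\eta_2)}{\xi_1^2+\xi_2^2+\eta_1^2+\eta_2^2}+\frac{i\eta_2-\xi_2}{\zeta-\xi_2}\,\frac{\hat g^{o1}(\xi_1,\xi_2,\eta_1,-i\zeta)}{\xi_1^2+\xi_2^2+\eta_1^2+\eta_2^2},\qquad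 \zeta=\sqrt{\xi_1^2+\xi_2^2+\eta_1^2},$$ the right-hand side also defining a tempered distribution by integration. (For context, not part of the claim: this $u$ is determined up to null sets, and is the solution of $\Delta u=g$ in $\Omega$ with $u=0$ on $y_1=0$ and $\partial u/\partial\bar z_2=0$ on $y_2=0$ that is under consideration.) Moreover, for every such $u$ and for every relatively open set $V\subset\overline\Omega$ that does not meet the corner $\{y_1=0\}\cap\{y_2=0\}$, the function $u$ is smooth on $V$, up to the boundary: after modification on a null set, $u$ is (the restriction of) a $C^\infty$ function on $V$, including at the points of $V\cap\partial\Omega$. -/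

import Mathlib

open scoped SchwartzMap FourierTransform ContDiff

noncomputable section

/-- `ℝ⁴` with coordinates `(x₁, x₂, y₁, y₂)`, indexed `0, 1, 2, 3`; here `z₁ = x₁ + i y₁` and
`z₂ = x₂ + i y₂`.  On the Fourier side the coordinates are `(ξ₁, ξ₂, η₁, η₂)`. -/
abbrev R4 : Type := EuclideanSpace ℝ (Fin 4)

/-- The product of two upper half-planes, `Ω = {y₁ > 0, y₂ > 0}`. -/
def halfPlanes : Set R4 := {z | 0 < z 2 ∧ 0 < z 3}

/-- The closure of the product of the two half-planes, `{y₁ ≥ 0, y₂ ≥ 0}`. -/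
def closedHalfPlanes : Set R4 := {z | 0 ≤ z 2 ∧ 0 ≤ z 3}

/-- The corner `{y₁ = 0} ∩ {y₂ = 0}`. -/
def corner : Set R4 := {z | z 2 = 0 ∧ z 3 = 0}

/-- Schwartz functions on the closed product of half-planes: the restrictions of Schwartz functions
on `ℝ⁴`.  (The values of `g` elsewhere are irrelevant.) -/
def IsSchwartzUpToBoundary (g : R4 → ℂ) : Prop :=
  ∃ G : 𝓢(R4, ℂ), ∀ z ∈ closedHalfPlanes, g z = G z

/-- The reflection `y₁ ↦ -y₁`. -/
def reflectY1 (z : R4) : R4 := !₂[z 0, z 1, -z 2, z 3]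

open Classical in
/-- The extension of a function on `Ω` to `ℝ⁴` that is odd in `y₁` and vanishes for `y₂ < 0`.
(It is set to `0` on the null set `{y₁ = 0} ∪ {y₂ = 0}`.) -/
def oddExt (f : R4 → ℂ) (z : R4) : ℂ :=
  if z ∈ halfPlanes then f z
  else if reflectY1 z ∈ halfPlanes then -f (reflectY1 z)
  else 0

/-- The Fourier transform (with kernel `exp (-i ⟨z, ·⟩)`) of the extension of `g`, at real
`ξ₁, ξ₂, η₁` and complex fourth variable `τ`.  As the extension is supported in `y₂ ≥ 0`, this makes
sense for `Im τ ≤ 0`. -/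
def extHat (g : R4 → ℂ) (ξ₁ ξ₂ η₁ : ℝ) (τ : ℂ) : ℂ :=
  ∫ z : R4, oddExt g z *
    Complex.exp (-Complex.I * (z 0 * ξ₁ + z 1 * ξ₂ + z 2 * η₁ + z 3 * τ))

/-- `ζ = √(ξ₁² + ξ₂² + η₁²)`. -/
def zetaFreq (p : R4) : ℝ := √((p 0) ^ 2 + (p 1) ^ 2 + (p 2) ^ 2)

/-- The right-hand side of the formula for the Fourier transform of the extended solution,
`-ĝ(ξ₁,ξ₂,η₁,η₂) / |(ξ,η)|² + (iη₂ - ξ₂)/(ζ - ξ₂) · ĝ(ξ₁,ξ₂,η₁,-iζ) / |(ξ,η)|²`.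
The denominators vanish only on a null set. -/
def solnHat (g : R4 → ℂ) (p : R4) : ℂ :=
  -(extHat g (p 0) (p 1) (p 2) (p 3) /
      ((p 0) ^ 2 + (p 1) ^ 2 + (p 2) ^ 2 + (p 3) ^ 2 : ℝ))
  + ((Complex.I * (p 3) - (p 1)) / ((zetaFreq p : ℂ) - (p 1))) *
    (extHat g (p 0) (p 1) (p 2) (-Complex.I * zetaFreq p) /
      ((p 0) ^ 2 + (p 1) ^ 2 + (p 2) ^ 2 + (p 3) ^ 2 : ℝ))

/-- `u` is the function on `Ω` given by the Fourier formula: the extension of `u` (odd in `y₁`, zero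
for `y₂ < 0`) and `solnHat g` both define tempered distributions by integration, and the second is
the Fourier transform of the first.  Mathlib's transform `𝓕` has the kernel `exp (-2πi ⟨x, k⟩)`, so a
transform with kernel `exp (-i ⟨x, ξ⟩)` is taken at `ξ = 2π k`. -/
structure IsGivenByFormula (g u : R4 → ℂ) : Prop where
  integrable_ext : ∀ φ : 𝓢(R4, ℂ), MeasureTheory.Integrable (fun x : R4 => oddExt u x * φ x)
  integrable_hat : ∀ φ : 𝓢(R4, ℂ),
    MeasureTheory.Integrable (fun k : R4 => solnHat g ((2 * Real.pi) • k) * φ k)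
  fourier_eq : ∀ φ : 𝓢(R4, ℂ),
    ∫ x : R4, oddExt u x * (𝓕 φ) x = ∫ k : R4, solnHat g ((2 * Real.pi) • k) * φ k

end

/-! After a Fourier transform in (x₁, x₂, y₁) of the extension odd in y₁, the equation Δu = g
becomes for each frequency the equation U'' = ζ²U + γ in t = y₂ > 0, and the condition ∂u/∂z̄₂ = 0
becomes U'(0) = -ξ₂U(0). The decaying solution is given by an explicit Green kernel, and its
one-sided transform in t is the prescribed formula (`fourier_odeSol`).

The inverse transform has to converge. The boundary coefficient blows up where ζ = ξ₂, that is on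
the half-line ξ₁ = η₁ = 0, ξ₂ ≥ 0; oddness in y₁ supplies a factor η₁ that makes the singularity
integrable. On the other hand the odd extension jumps across y₁ = 0, so only decay of order 1/|η₁|
is available. The outcome is an integrable majorant for U, |k|U and U' (`uHat_bound`,
`integrable_majorant`): the solution is C¹ up to the boundary, the corner included, but these bounds
give no second derivatives.

Higher regularity comes from symmetry. The problem commutes with ∂/∂x₁ and ∂/∂x₂ and is covariant
under dilations, so applying these fields to u gives solutions with other Schwartz data, which are
C¹ again. With y₁ + iy₂ = exp(ρ + iθ), the dilation field controls ∂/∂ρ (`sol_euler`), and the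
equation expresses ∂²/∂θ² through the other derivatives (`hasDerivAt_polTheta_theta`). An induction
over all Schwartz data simultaneously (`contDiffOn_polSol_polTheta`) gives smoothness for θ in the
closed interval [0, π/2]. In these coordinates both faces are ordinary boundary and the corner lies
at ρ = -∞, which is why it has to be excluded.

Since second derivatives are not known beforehand, the equation is first obtained in integrated
form: the divergence theorem on a polar box for each frequency, integration over the frequencies,
and Fourier inversion for averages over the box (`integral_polar_flux`). The pointwise statement
follows by shrinking boxes (`hasDerivAt_of_box_integrals`).

Finally two Parseval identities show that this solution satisfies the formula, and any other
function that does so agrees with it almost everywhere (`IsGivenByFormula.ae_eq`), because the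
Fourier transform maps Schwartz space onto itself. -/

open MeasureTheory Set Filter Topology
open scoped SchwartzMap FourierTransform ContDiff

/-! ### Green kernel on the half-line: size estimates -/

noncomputable section

/-- The Green kernel on the half-line `s > 0` for `d²/dt² - ζ²`, with a boundary term `m`. -/
def greenKernel (ζ m t s : ℝ) : ℝ :=
  -(Real.exp (-(ζ * |t - s|)) / (2 * ζ)) - m * Real.exp (-(ζ * (t + s)))

/-- The derivative of `greenKernel` in `t`. -/
def greenKernelDeriv (ζ m t s : ℝ) : ℝ :=
  (if s ≤ t then 1 else -1) * (Real.exp (-(ζ * |t - s|)) / 2) +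
    ζ * m * Real.exp (-(ζ * (t + s)))

/-- The solution of `U'' = ζ² U + γ` on `t > 0` given by `greenKernel`. -/
def odeSol (γ : ℝ → ℂ) (ζ m t : ℝ) : ℂ := ∫ s in Ioi (0 : ℝ), (greenKernel ζ m t s : ℂ) * γ s

/-- The derivative of `odeSol`. -/
def odeSolDeriv (γ : ℝ → ℂ) (ζ m t : ℝ) : ℂ :=
  ∫ s in Ioi (0 : ℝ), (greenKernelDeriv ζ m t s : ℂ) * γ s

lemma integrable_comp_abs_of_integrableOn_Ioi {g : ℝ → ℝ} (hg : IntegrableOn g (Ioi 0)) :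
    Integrable (fun x : ℝ => g |x|) := by
  rw [← integrableOn_univ, ← Iic_union_Ioi (a := (0 : ℝ))]
  refine IntegrableOn.union ?_ ?_
  · rw [← neg_zero, ← integrable_indicator_iff measurableSet_Iic] at *
    rw [← integrable_indicator_iff measurableSet_Ioi] at hg
    have h2 := hg.comp_neg
    refine h2.congr ?_
    have : ∀ᵐ x : ℝ, x ≠ 0 := by simp [ae_iff, measure_singleton]
    filter_upwards [this] with x hx
    simp only [indicator, mem_Ioi, mem_Iic, neg_zero]
    rcases lt_or_gt_of_ne hx with h | h
    · simp [h, h.le, abs_of_neg h]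
    · simp [not_lt.2 h.le, not_le.2 h]
  · refine hg.congr_fun (fun x hx => ?_) measurableSet_Ioi
    simp only [abs_of_pos (mem_Ioi.1 hx)]

lemma integrable_exp_neg_mul_abs {ζ : ℝ} (hζ : 0 < ζ) :
    Integrable (fun r : ℝ => Real.exp (-(ζ * |r|))) := by
  refine integrable_comp_abs_of_integrableOn_Ioi (g := fun r => Real.exp (-(ζ * r))) ?_
  simpa [neg_mul] using integrableOn_exp_mul_Ioi (neg_lt_zero.2 hζ) 0

lemma integral_exp_neg_mul_abs {ζ : ℝ} (hζ : 0 < ζ) :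
    ∫ r : ℝ, Real.exp (-(ζ * |r|)) = 2 / ζ := by
  rw [integral_comp_abs (f := fun r => Real.exp (-(ζ * r)))]
  have := integral_exp_mul_Ioi (neg_lt_zero.2 hζ) 0
  simp only [neg_mul] at this
  rw [this]; simp; field_simp

/-- Half of the exponential pays for the quadratic weight: x²/2 ≤ eˣ at x = ζ|r|/2 gives r² ≤
(8/ζ²)eˣ. -/
lemma one_add_sq_mul_exp_le {ζ : ℝ} (hζ : 0 < ζ) (r : ℝ) :
    (1 + r ^ 2) * Real.exp (-(ζ * |r|)) ≤ (1 + 8 / ζ ^ 2) * Real.exp (-(ζ / 2 * |r|)) := by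
  have h1 := Real.quadratic_le_exp_of_nonneg (x := ζ / 2 * |r|) (by positivity)
  have h2 : r ^ 2 ≤ 8 / ζ ^ 2 * Real.exp (ζ / 2 * |r|) := by
    have : (ζ / 2 * |r|) ^ 2 / 2 ≤ Real.exp (ζ / 2 * |r|) := by
      have : 0 ≤ ζ / 2 * |r| := by positivity
      linarith
    rw [mul_pow, sq_abs] at this
    rw [div_mul_eq_mul_div, le_div_iff₀ (by positivity)]
    nlinarith
  have h3 : 1 ≤ Real.exp (ζ / 2 * |r|) := Real.one_le_exp (by positivity)
  have h4 : Real.exp (-(ζ / 2 * |r|)) = Real.exp (ζ / 2 * |r|) * Real.exp (-(ζ * |r|)) := by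
    rw [← Real.exp_add]; congr 1; ring
  rw [h4, ← mul_assoc]
  gcongr
  nlinarith [show 0 ≤ 8 / ζ ^ 2 by positivity]

lemma integrable_one_add_sq_mul_exp {ζ : ℝ} (hζ : 0 < ζ) :
    Integrable (fun r : ℝ => (1 + r ^ 2) * Real.exp (-(ζ * |r|))) := by
  refine ((integrable_exp_neg_mul_abs (half_pos hζ)).const_mul (1 + 8 / ζ ^ 2)).mono'
    (by fun_prop) (ae_of_all _ fun r => ?_)
  rw [Real.norm_of_nonneg (by positivity)]
  exact one_add_sq_mul_exp_le hζ r

/-- Peetre's inequality; it carries the weight 1/(1 + s²) through integration against a kernel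
concentrated near s = t. -/
lemma one_add_sq_le_mul (t s : ℝ) : 1 + t ^ 2 ≤ 2 * ((1 + s ^ 2) * (1 + (t - s) ^ 2)) := by
  nlinarith [sq_nonneg (t - 2 * s), mul_nonneg (sq_nonneg s) (sq_nonneg (t - s))]

section Bounds

variable {γ : ℝ → ℂ} {c ζ m t : ℝ}

/-- Since |t - s| ≤ t + s on the half-line, the boundary term of the kernel is never larger than the
direct one, up to constants. -/
lemma exp_neg_add_le {s : ℝ} (hζ : 0 < ζ) (ht : 0 ≤ t) (hs : 0 ≤ s) :
    Real.exp (-(ζ * (t + s))) ≤ Real.exp (-(ζ * |t - s|)) := by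
  gcongr
  rw [abs_le]; constructor <;> linarith

lemma abs_greenKernel_le {s : ℝ} (hζ : 0 < ζ) :
    |greenKernel ζ m t s| ≤
      Real.exp (-(ζ * |t - s|)) / (2 * ζ) + |m| * Real.exp (-(ζ * (t + s))) := by
  unfold greenKernel
  refine (abs_sub _ _).trans ?_
  rw [abs_neg, abs_mul, Real.abs_exp, abs_of_nonneg (a := _ / _) (by positivity)]

lemma abs_greenKernelDeriv_le {s : ℝ} (hζ : 0 < ζ) :
    |greenKernelDeriv ζ m t s| ≤
      Real.exp (-(ζ * |t - s|)) / 2 + ζ * |m| * Real.exp (-(ζ * (t + s))) := by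
  unfold greenKernelDeriv
  refine (abs_add_le _ _).trans ?_
  rw [abs_mul, abs_mul _ (Real.exp _), abs_mul, Real.abs_exp, abs_of_pos hζ,
    abs_of_nonneg (a := _ / _) (by positivity)]
  gcongr
  split_ifs <;> simp

lemma abs_greenKernel_le' {s : ℝ} (hζ : 0 < ζ) (ht : 0 ≤ t) (hs : 0 ≤ s) :
    |greenKernel ζ m t s| ≤ (1 / (2 * ζ) + |m|) * Real.exp (-(ζ * |t - s|)) := by
  refine (abs_greenKernel_le hζ).trans ?_
  have := mul_le_mul_of_nonneg_left (exp_neg_add_le hζ ht hs) (abs_nonneg m)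
  rw [add_mul]
  refine add_le_add (le_of_eq (by ring)) this

lemma abs_greenKernelDeriv_le' {s : ℝ} (hζ : 0 < ζ) (ht : 0 ≤ t) (hs : 0 ≤ s) :
    |greenKernelDeriv ζ m t s| ≤ (1 / 2 + ζ * |m|) * Real.exp (-(ζ * |t - s|)) := by
  refine (abs_greenKernelDeriv_le hζ).trans ?_
  have := mul_le_mul_of_nonneg_left (exp_neg_add_le hζ ht hs)
    (mul_nonneg hζ.le (abs_nonneg m))
  rw [add_mul]
  refine add_le_add (le_of_eq (by ring)) this

lemma measurable_greenKernel : Measurable fun p : ℝ × ℝ × ℝ × ℝ =>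
    greenKernel p.1 p.2.1 p.2.2.1 p.2.2.2 := by
  unfold greenKernel
  fun_prop

lemma measurable_greenKernelDeriv : Measurable fun p : ℝ × ℝ × ℝ × ℝ =>
    greenKernelDeriv p.1 p.2.1 p.2.2.1 p.2.2.2 := by
  unfold greenKernelDeriv
  refine Measurable.add (Measurable.mul (Measurable.ite ?_ ?_ ?_) ?_) ?_
  · exact measurableSet_le (by fun_prop) (by fun_prop)
  all_goals fun_prop

/-- A bound for the integral of a decaying function against a kernel of exponential type. -/
lemma norm_setIntegral_kernel_le {K : ℝ → ℝ} {A B : ℝ} (hζ : 0 < ζ) (ht : 0 ≤ t)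
    (hA : 0 ≤ A) (hB : 0 ≤ B) (hc : 0 ≤ c)
    (hK : ∀ s, 0 < s → |K s| ≤ A * Real.exp (-(ζ * |t - s|)) + B * Real.exp (-(ζ * (t + s))))
    (hγ : ∀ s, 0 < s → ‖γ s‖ ≤ c) :
    ‖∫ s in Ioi (0 : ℝ), (K s : ℂ) * γ s‖ ≤ c * (2 * A + B) / ζ := by
  have i1 : Integrable fun s : ℝ => Real.exp (-(ζ * |t - s|)) :=
    (integrable_exp_neg_mul_abs hζ).comp_sub_left t
  have e2 : ∀ s : ℝ, Real.exp (-(ζ * (t + s))) = Real.exp (-(ζ * t)) * Real.exp (-ζ * s) := by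
    intro s; rw [← Real.exp_add]; congr 1; ring
  have i2 : IntegrableOn (fun s : ℝ => Real.exp (-(ζ * (t + s)))) (Ioi 0) := by
    simp only [e2]
    exact (integrableOn_exp_mul_Ioi (neg_lt_zero.2 hζ) 0).const_mul _
  have v1 : ∫ s in Ioi (0 : ℝ), Real.exp (-(ζ * |t - s|)) ≤ 2 / ζ := by
    refine (setIntegral_le_integral i1 (ae_of_all _ fun s => (Real.exp_pos _).le)).trans ?_
    rw [integral_sub_left_eq_self (fun r => Real.exp (-(ζ * |r|))) volume t,
      integral_exp_neg_mul_abs hζ]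
  have v2 : ∫ s in Ioi (0 : ℝ), Real.exp (-(ζ * (t + s))) ≤ 1 / ζ := by
    simp only [e2]
    rw [integral_const_mul, integral_exp_mul_Ioi (neg_lt_zero.2 hζ) 0]
    have : Real.exp (-(ζ * t)) ≤ 1 := Real.exp_le_one_iff.2 (by nlinarith)
    rw [mul_zero, Real.exp_zero, neg_div_neg_eq]
    exact mul_le_of_le_one_left (by positivity) this
  calc ‖∫ s in Ioi (0 : ℝ), (K s : ℂ) * γ s‖
      ≤ ∫ s in Ioi (0 : ℝ), c * (A * Real.exp (-(ζ * |t - s|)) +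
          B * Real.exp (-(ζ * (t + s)))) := by
        refine norm_integral_le_of_norm_le
          (((i1.integrableOn.const_mul A).add (i2.const_mul B)).const_mul c) ?_
        refine (ae_restrict_iff' measurableSet_Ioi).2 (ae_of_all _ fun s hs => ?_)
        rw [norm_mul, Complex.norm_real, Real.norm_eq_abs, mul_comm]
        exact mul_le_mul (hγ s hs) (hK s hs) (abs_nonneg _) hc
    _ = c * (A * (∫ s in Ioi (0 : ℝ), Real.exp (-(ζ * |t - s|))) +
          B * ∫ s in Ioi (0 : ℝ), Real.exp (-(ζ * (t + s)))) := by
        rw [integral_const_mul, integral_add (i1.integrableOn.const_mul A) (i2.const_mul B),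
          integral_const_mul, integral_const_mul]
    _ ≤ c * (A * (2 / ζ) + B * (1 / ζ)) := by gcongr
    _ = c * (2 * A + B) / ζ := by ring

/-- The direct and the boundary exponentials have mass at most 2/ζ and 1/ζ. The same quantity 1/ζ +
|m| governs the derivative, with one factor 1/ζ less, so a single estimate of it
(`GoodFreq.coef_le`) serves both. -/
lemma norm_odeSol_le (hζ : 0 < ζ) (ht : 0 ≤ t) (hc : 0 ≤ c) (hγ : ∀ s, 0 < s → ‖γ s‖ ≤ c) :
    ‖odeSol γ ζ m t‖ ≤ c * (1 / ζ + |m|) / ζ := by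
  refine (norm_setIntegral_kernel_le (A := 1 / (2 * ζ)) (B := |m|) hζ ht (by positivity)
    (by positivity) hc (fun s _ => ?_) hγ).trans (le_of_eq ?_)
  · refine (abs_greenKernel_le hζ).trans (le_of_eq (by ring))
  · field_simp

lemma norm_odeSolDeriv_le (hζ : 0 < ζ) (ht : 0 ≤ t) (hc : 0 ≤ c)
    (hγ : ∀ s, 0 < s → ‖γ s‖ ≤ c) :
    ‖odeSolDeriv γ ζ m t‖ ≤ c * (1 / ζ + |m|) := by
  refine (norm_setIntegral_kernel_le (A := 1 / 2) (B := ζ * |m|) hζ ht (by positivity)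
    (by positivity) hc (fun s _ => ?_) hγ).trans (le_of_eq ?_)
  · refine (abs_greenKernelDeriv_le hζ).trans (le_of_eq (by ring))
  · field_simp

/-- Decay of the integral of a decaying function against a kernel of exponential type. -/
lemma norm_setIntegral_kernel_le_decay {K : ℝ → ℝ} {A : ℝ} (hζ : 0 < ζ)
    (hA : 0 ≤ A) (hc : 0 ≤ c) (hK : ∀ s, 0 < s → |K s| ≤ A * Real.exp (-(ζ * |t - s|)))
    (hγ : ∀ s, 0 < s → ‖γ s‖ ≤ c / (1 + s ^ 2)) :
    ‖∫ s in Ioi (0 : ℝ), (K s : ℂ) * γ s‖ ≤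
      2 * c * A * (∫ r : ℝ, (1 + r ^ 2) * Real.exp (-(ζ * |r|))) / (1 + t ^ 2) := by
  have i1 : Integrable fun s : ℝ => (1 + (t - s) ^ 2) * Real.exp (-(ζ * |t - s|)) :=
    (integrable_one_add_sq_mul_exp hζ).comp_sub_left t
  calc ‖∫ s in Ioi (0 : ℝ), (K s : ℂ) * γ s‖
      ≤ ∫ s in Ioi (0 : ℝ), 2 * c * A / (1 + t ^ 2) *
          ((1 + (t - s) ^ 2) * Real.exp (-(ζ * |t - s|))) := by
        refine norm_integral_le_of_norm_le (i1.integrableOn.const_mul _) ?_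
        refine (ae_restrict_iff' measurableSet_Ioi).2 (ae_of_all _ fun s hs => ?_)
        rw [norm_mul, Complex.norm_real, Real.norm_eq_abs]
        refine (mul_le_mul (hK s hs) (hγ s hs) (norm_nonneg _) (by positivity)).trans ?_
        have h1 : 1 / (1 + s ^ 2) ≤ 2 * (1 + (t - s) ^ 2) / (1 + t ^ 2) := by
          rw [div_le_div_iff₀ (by positivity) (by positivity)]
          nlinarith [one_add_sq_le_mul t s]
        calc A * Real.exp (-(ζ * |t - s|)) * (c / (1 + s ^ 2))
            = c * A * Real.exp (-(ζ * |t - s|)) * (1 / (1 + s ^ 2)) := by ring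
          _ ≤ c * A * Real.exp (-(ζ * |t - s|)) * (2 * (1 + (t - s) ^ 2) / (1 + t ^ 2)) := by
              gcongr
          _ = _ := by ring
    _ ≤ ∫ s : ℝ, 2 * c * A / (1 + t ^ 2) *
          ((1 + (t - s) ^ 2) * Real.exp (-(ζ * |t - s|))) :=
        setIntegral_le_integral (i1.const_mul _) (ae_of_all _ fun s => by
          simp only [Pi.zero_apply]; positivity)
    _ = _ := by
        rw [integral_const_mul,
          integral_sub_left_eq_self (fun r => (1 + r ^ 2) * Real.exp (-(ζ * |r|))) volume t]
        ring

/-- The constant depends on ζ and m without control. This is enough for integrability in t at a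
fixed frequency; bounds uniform in the frequency come from `norm_odeSol_le`. -/
lemma exists_norm_odeSol_le_decay (hζ : 0 < ζ) (m : ℝ)
    (hγ : ∀ s, 0 < s → ‖γ s‖ ≤ c / (1 + s ^ 2)) :
    ∃ C : ℝ, ∀ t, 0 ≤ t → ‖odeSol γ ζ m t‖ ≤ C / (1 + t ^ 2) := by
  have hc : 0 ≤ c := by
    have := (norm_nonneg _).trans (hγ 1 one_pos)
    norm_num at this; linarith
  exact ⟨_, fun t ht => norm_setIntegral_kernel_le_decay hζ
    (A := 1 / (2 * ζ) + |m|) (by positivity) hc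
    (fun s hs => abs_greenKernel_le' hζ ht (le_of_lt hs)) hγ⟩

lemma exists_norm_odeSolDeriv_le_decay (hζ : 0 < ζ) (m : ℝ)
    (hγ : ∀ s, 0 < s → ‖γ s‖ ≤ c / (1 + s ^ 2)) :
    ∃ C : ℝ, ∀ t, 0 ≤ t → ‖odeSolDeriv γ ζ m t‖ ≤ C / (1 + t ^ 2) := by
  have hc : 0 ≤ c := by
    have := (norm_nonneg _).trans (hγ 1 one_pos)
    norm_num at this; linarith
  exact ⟨_, fun t ht => norm_setIntegral_kernel_le_decay hζ
    (A := 1 / 2 + ζ * |m|) (by positivity) hc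
    (fun s hs => abs_greenKernelDeriv_le' hζ ht (le_of_lt hs)) hγ⟩

end Bounds

end

/-! ### The differential equation and its one-sided Fourier transform -/

noncomputable section

section Deriv

variable {γ : ℝ → ℂ} {c ζ m t : ℝ}

lemma integrableOn_exp_neg_mul_of_bound (hζ : 0 < ζ) (hcont : Continuous γ)
    (hγ : ∀ s, 0 < s → ‖γ s‖ ≤ c) :
    IntegrableOn (fun s : ℝ => (Real.exp (-(ζ * s)) : ℂ) * γ s) (Ioi 0) := by
  have i := (integrableOn_exp_mul_Ioi (neg_lt_zero.2 hζ) 0).const_mul c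
  refine Integrable.mono' i (by fun_prop) ?_
  refine (ae_restrict_iff' measurableSet_Ioi).2 (ae_of_all _ fun s hs => ?_)
  rw [norm_mul, Complex.norm_real, Real.norm_eq_abs, Real.abs_exp, mul_comm, neg_mul]
  exact mul_le_mul_of_nonneg_right (hγ s hs) (Real.exp_pos _).le

/-- On either side of the diagonal s = t the kernels are combinations of exp(ζs) and exp(-ζs) with
coefficients depending on t only. Splitting there leaves integrals of continuous functions with a
moving endpoint, which can be differentiated in t although the kernel has a kink. -/
lemma setIntegral_split_exp {K : ℝ → ℝ} {a b a' : ℂ} (hζ : 0 < ζ) (ht : 0 ≤ t)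
    (hcont : Continuous γ) (hγ : ∀ s, 0 < s → ‖γ s‖ ≤ c)
    (h1 : ∀ s ∈ Ioc 0 t, (K s : ℂ) = a * Real.exp (ζ * s) + b * Real.exp (-(ζ * s)))
    (h2 : ∀ s ∈ Ioi t, (K s : ℂ) = a' * Real.exp (-(ζ * s))) :
    ∫ s in Ioi (0 : ℝ), (K s : ℂ) * γ s =
      a * (∫ s in (0 : ℝ)..t, (Real.exp (ζ * s) : ℂ) * γ s) +
      b * (∫ s in (0 : ℝ)..t, (Real.exp (-(ζ * s)) : ℂ) * γ s) +
      a' * ((∫ s in Ioi (0 : ℝ), (Real.exp (-(ζ * s)) : ℂ) * γ s) -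
        ∫ s in (0 : ℝ)..t, (Real.exp (-(ζ * s)) : ℂ) * γ s) := by
  have i0 := integrableOn_exp_neg_mul_of_bound hζ hcont hγ
  have i1 : IntegrableOn (fun s : ℝ => (Real.exp (-(ζ * s)) : ℂ) * γ s) (Ioc 0 t) :=
    i0.mono_set Ioc_subset_Ioi_self
  have i2 : IntegrableOn (fun s : ℝ => (Real.exp (-(ζ * s)) : ℂ) * γ s) (Ioi t) :=
    i0.mono_set (Ioi_subset_Ioi ht)
  have i3 : IntegrableOn (fun s : ℝ => (Real.exp (ζ * s) : ℂ) * γ s) (Ioc 0 t) :=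
    ((by fun_prop : Continuous fun s : ℝ => (Real.exp (ζ * s) : ℂ) * γ s).integrableOn_Icc
      ).mono_set Ioc_subset_Icc_self
  have s0 : (∫ s in Ioi (0 : ℝ), (Real.exp (-(ζ * s)) : ℂ) * γ s) =
      (∫ s in (0 : ℝ)..t, (Real.exp (-(ζ * s)) : ℂ) * γ s) +
      ∫ s in Ioi t, (Real.exp (-(ζ * s)) : ℂ) * γ s := by
    rw [intervalIntegral.integral_of_le ht, ← setIntegral_union (Ioc_disjoint_Ioi le_rfl)
      measurableSet_Ioi i1 i2, Ioc_union_Ioi_eq_Ioi ht]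
  have e1 : EqOn (fun s : ℝ => (K s : ℂ) * γ s) (fun s => a * ((Real.exp (ζ * s) : ℂ) * γ s) +
      b * ((Real.exp (-(ζ * s)) : ℂ) * γ s)) (Ioc 0 t) := fun s hs => by
    simp only [h1 s hs]; ring
  have e2 : EqOn (fun s : ℝ => (K s : ℂ) * γ s)
      (fun s => a' * ((Real.exp (-(ζ * s)) : ℂ) * γ s)) (Ioi t) := fun s hs => by
    simp only [h2 s hs]; ring
  have j1 : IntegrableOn (fun s : ℝ => (K s : ℂ) * γ s) (Ioc 0 t) :=
    IntegrableOn.congr_fun ((i3.const_mul a).add (i1.const_mul b)) e1.symm measurableSet_Ioc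
  have j2 : IntegrableOn (fun s : ℝ => (K s : ℂ) * γ s) (Ioi t) :=
    IntegrableOn.congr_fun (i2.const_mul a') e2.symm measurableSet_Ioi
  rw [← Ioc_union_Ioi_eq_Ioi ht, setIntegral_union (Ioc_disjoint_Ioi le_rfl)
    measurableSet_Ioi j1 j2, setIntegral_congr_fun measurableSet_Ioc e1,
    setIntegral_congr_fun measurableSet_Ioi e2, Ioc_union_Ioi_eq_Ioi ht, s0,
    integral_add (i3.const_mul a) (i1.const_mul b), integral_const_mul, integral_const_mul,
    integral_const_mul, intervalIntegral.integral_of_le ht, intervalIntegral.integral_of_le ht]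
  ring

/-- The closed form of `odeSol`, as a function on all of `ℝ`. -/
def odeSolAux (γ : ℝ → ℂ) (ζ m t : ℝ) : ℂ :=
  -((Real.exp (-(ζ * t)) : ℂ) * (∫ s in (0 : ℝ)..t, (Real.exp (ζ * s) : ℂ) * γ s) +
    (Real.exp (ζ * t) : ℂ) * ((∫ s in Ioi (0 : ℝ), (Real.exp (-(ζ * s)) : ℂ) * γ s) -
        ∫ s in (0 : ℝ)..t, (Real.exp (-(ζ * s)) : ℂ) * γ s)) / (2 * ζ) -
  m * Real.exp (-(ζ * t)) * ∫ s in Ioi (0 : ℝ), (Real.exp (-(ζ * s)) : ℂ) * γ s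

/-- The closed form of `odeSolDeriv`, as a function on all of `ℝ`. -/
def odeSolDerivAux (γ : ℝ → ℂ) (ζ m t : ℝ) : ℂ :=
  ((Real.exp (-(ζ * t)) : ℂ) * (∫ s in (0 : ℝ)..t, (Real.exp (ζ * s) : ℂ) * γ s) -
    (Real.exp (ζ * t) : ℂ) * ((∫ s in Ioi (0 : ℝ), (Real.exp (-(ζ * s)) : ℂ) * γ s) -
        ∫ s in (0 : ℝ)..t, (Real.exp (-(ζ * s)) : ℂ) * γ s)) / 2 +
  ζ * m * Real.exp (-(ζ * t)) * ∫ s in Ioi (0 : ℝ), (Real.exp (-(ζ * s)) : ℂ) * γ s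

lemma odeSol_eq_aux (hζ : 0 < ζ) (ht : 0 ≤ t) (hcont : Continuous γ)
    (hγ : ∀ s, 0 < s → ‖γ s‖ ≤ c) : odeSol γ ζ m t = odeSolAux γ ζ m t := by
  have hζ' : (ζ : ℂ) ≠ 0 := by exact_mod_cast hζ.ne'
  unfold odeSol odeSolAux
  rw [setIntegral_split_exp (K := greenKernel ζ m t) (a := -(Real.exp (-(ζ * t)) : ℂ) / (2 * ζ))
    (b := -(m * Real.exp (-(ζ * t)) : ℂ))
    (a' := -(Real.exp (ζ * t) : ℂ) / (2 * ζ) - m * Real.exp (-(ζ * t))) hζ ht hcont hγ]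
  · field_simp
    ring
  · intro s hs
    have e1 : Real.exp (-(ζ * |t - s|)) = Real.exp (-(ζ * t)) * Real.exp (ζ * s) := by
      rw [abs_of_nonneg (by linarith [hs.2]), ← Real.exp_add]; congr 1; ring
    have e2 : Real.exp (-(ζ * (t + s))) = Real.exp (-(ζ * t)) * Real.exp (-(ζ * s)) := by
      rw [← Real.exp_add]; congr 1; ring
    rw [greenKernel, e1, e2]; push_cast; ring
  · intro s hs
    have e1 : Real.exp (-(ζ * |t - s|)) = Real.exp (ζ * t) * Real.exp (-(ζ * s)) := by
      rw [abs_of_nonpos (by linarith [mem_Ioi.1 hs]), ← Real.exp_add]; congr 1; ring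
    have e2 : Real.exp (-(ζ * (t + s))) = Real.exp (-(ζ * t)) * Real.exp (-(ζ * s)) := by
      rw [← Real.exp_add]; congr 1; ring
    rw [greenKernel, e1, e2]; push_cast; ring

lemma odeSolDeriv_eq_aux (hζ : 0 < ζ) (ht : 0 ≤ t) (hcont : Continuous γ)
    (hγ : ∀ s, 0 < s → ‖γ s‖ ≤ c) : odeSolDeriv γ ζ m t = odeSolDerivAux γ ζ m t := by
  unfold odeSolDeriv odeSolDerivAux
  rw [setIntegral_split_exp (K := greenKernelDeriv ζ m t) (a := (Real.exp (-(ζ * t)) : ℂ) / 2)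
    (b := (ζ * m * Real.exp (-(ζ * t)) : ℂ))
    (a' := -(Real.exp (ζ * t) : ℂ) / 2 + ζ * m * Real.exp (-(ζ * t))) hζ ht hcont hγ]
  · ring
  · intro s hs
    have e1 : Real.exp (-(ζ * |t - s|)) = Real.exp (-(ζ * t)) * Real.exp (ζ * s) := by
      rw [abs_of_nonneg (by linarith [hs.2]), ← Real.exp_add]; congr 1; ring
    have e2 : Real.exp (-(ζ * (t + s))) = Real.exp (-(ζ * t)) * Real.exp (-(ζ * s)) := by
      rw [← Real.exp_add]; congr 1; ring
    rw [greenKernelDeriv, e1, e2, if_pos hs.2]; push_cast; ring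
  · intro s hs
    have e1 : Real.exp (-(ζ * |t - s|)) = Real.exp (ζ * t) * Real.exp (-(ζ * s)) := by
      rw [abs_of_nonpos (by linarith [mem_Ioi.1 hs]), ← Real.exp_add]; congr 1; ring
    have e2 : Real.exp (-(ζ * (t + s))) = Real.exp (-(ζ * t)) * Real.exp (-(ζ * s)) := by
      rw [← Real.exp_add]; congr 1; ring
    rw [greenKernelDeriv, e1, e2, if_neg (not_le.2 hs)]; push_cast; ring

lemma hasDerivAt_ofReal_exp_mul (a t : ℝ) :
    HasDerivAt (fun t : ℝ => (Real.exp (a * t) : ℂ)) (a * Real.exp (a * t) : ℂ) t := by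
  have h : HasDerivAt (fun t : ℝ => Real.exp (a * t)) (a * Real.exp (a * t)) t := by
    have := ((hasDerivAt_id t).const_mul a).exp
    simpa [mul_comm] using this
  exact_mod_cast h.ofReal_comp

/-- The two terms produced by the moving endpoint cancel, as they do for a kernel continuous across
the diagonal. -/
lemma hasDerivAt_odeSolAux (hζ : 0 < ζ) (hcont : Continuous γ) (m t : ℝ) :
    HasDerivAt (odeSolAux γ ζ m) (odeSolDerivAux γ ζ m t) t := by
  have hζ' : (ζ : ℂ) ≠ 0 := by exact_mod_cast hζ.ne'
  have d1 : HasDerivAt (fun t : ℝ => (Real.exp (-(ζ * t)) : ℂ)) (-ζ * Real.exp (-(ζ * t))) t := by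
    simpa [neg_mul] using hasDerivAt_ofReal_exp_mul (-ζ) t
  have d2 := hasDerivAt_ofReal_exp_mul ζ t
  have d3 := (Continuous.integral_hasStrictDerivAt
    (by fun_prop : Continuous fun s : ℝ => (Real.exp (ζ * s) : ℂ) * γ s) 0 t).hasDerivAt
  have d4 := (Continuous.integral_hasStrictDerivAt
    (by fun_prop : Continuous fun s : ℝ => (Real.exp (-(ζ * s)) : ℂ) * γ s) 0 t).hasDerivAt
  have h := ((((d1.mul d3).add (d2.mul (d4.const_sub
    (∫ s in Ioi (0 : ℝ), (Real.exp (-(ζ * s)) : ℂ) * γ s)))).neg).div_const (2 * ζ : ℂ)).sub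
    ((d1.const_mul (m : ℂ)).mul_const (∫ s in Ioi (0 : ℝ), (Real.exp (-(ζ * s)) : ℂ) * γ s))
  have e : (Real.exp (-(ζ * t)) : ℂ) * Real.exp (ζ * t) = 1 := by
    rw [← Complex.ofReal_mul, ← Real.exp_add]; simp
  refine HasDerivAt.congr_deriv (f := odeSolAux γ ζ m) h ?_
  unfold odeSolDerivAux
  field_simp
  ring_nf

/-- Here the endpoint terms add up instead of cancelling: the unit jump of the differentiated kernel
produces the inhomogeneity γ. -/
lemma hasDerivAt_odeSolDerivAux (hζ : 0 < ζ) (hcont : Continuous γ) (m t : ℝ) :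
    HasDerivAt (odeSolDerivAux γ ζ m) (ζ ^ 2 * odeSolAux γ ζ m t + γ t) t := by
  have hζ' : (ζ : ℂ) ≠ 0 := by exact_mod_cast hζ.ne'
  have d1 : HasDerivAt (fun t : ℝ => (Real.exp (-(ζ * t)) : ℂ)) (-ζ * Real.exp (-(ζ * t))) t := by
    simpa [neg_mul] using hasDerivAt_ofReal_exp_mul (-ζ) t
  have d2 := hasDerivAt_ofReal_exp_mul ζ t
  have d3 := (Continuous.integral_hasStrictDerivAt
    (by fun_prop : Continuous fun s : ℝ => (Real.exp (ζ * s) : ℂ) * γ s) 0 t).hasDerivAt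
  have d4 := (Continuous.integral_hasStrictDerivAt
    (by fun_prop : Continuous fun s : ℝ => (Real.exp (-(ζ * s)) : ℂ) * γ s) 0 t).hasDerivAt
  have h := (((d1.mul d3).sub (d2.mul (d4.const_sub
    (∫ s in Ioi (0 : ℝ), (Real.exp (-(ζ * s)) : ℂ) * γ s)))).div_const (2 : ℂ)).add
    ((d1.const_mul (ζ * m : ℂ)).mul_const (∫ s in Ioi (0 : ℝ), (Real.exp (-(ζ * s)) : ℂ) * γ s))
  have e : (Real.exp (-(ζ * t)) : ℂ) * Real.exp (ζ * t) = 1 := by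
    rw [← Complex.ofReal_mul, ← Real.exp_add]; simp
  refine HasDerivAt.congr_deriv (f := odeSolDerivAux γ ζ m) h ?_
  unfold odeSolAux
  field_simp
  linear_combination (2 : ℂ) * γ t * e

lemma hasDerivAt_odeSol (hζ : 0 < ζ) (hcont : Continuous γ) (hγ : ∀ s, 0 < s → ‖γ s‖ ≤ c)
    (ht : 0 < t) : HasDerivAt (odeSol γ ζ m) (odeSolDeriv γ ζ m t) t := by
  rw [odeSolDeriv_eq_aux hζ ht.le hcont hγ]
  refine (hasDerivAt_odeSolAux hζ hcont m t).congr_of_eventuallyEq ?_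
  filter_upwards [lt_mem_nhds ht] with s hs
  exact odeSol_eq_aux hζ hs.le hcont hγ

lemma hasDerivAt_odeSolDeriv (hζ : 0 < ζ) (hcont : Continuous γ)
    (hγ : ∀ s, 0 < s → ‖γ s‖ ≤ c) (ht : 0 < t) :
    HasDerivAt (odeSolDeriv γ ζ m) (ζ ^ 2 * odeSol γ ζ m t + γ t) t := by
  rw [odeSol_eq_aux hζ ht.le hcont hγ]
  refine (hasDerivAt_odeSolDerivAux hζ hcont m t).congr_of_eventuallyEq ?_
  filter_upwards [lt_mem_nhds ht] with s hs
  exact odeSolDeriv_eq_aux hζ hs.le hcont hγ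

lemma continuousOn_odeSol (hζ : 0 < ζ) (hcont : Continuous γ) (hγ : ∀ s, 0 < s → ‖γ s‖ ≤ c) :
    ContinuousOn (odeSol γ ζ m) (Ici 0) :=
  (continuous_iff_continuousAt.2 fun t =>
    (hasDerivAt_odeSolAux hζ hcont m t).continuousAt).continuousOn.congr
    fun _ ht => odeSol_eq_aux hζ ht hcont hγ

lemma continuousOn_odeSolDeriv (hζ : 0 < ζ) (hcont : Continuous γ)
    (hγ : ∀ s, 0 < s → ‖γ s‖ ≤ c) : ContinuousOn (odeSolDeriv γ ζ m) (Ici 0) :=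
  (continuous_iff_continuousAt.2 fun t =>
    (hasDerivAt_odeSolDerivAux hζ hcont m t).continuousAt).continuousOn.congr
    fun _ ht => odeSolDeriv_eq_aux hζ ht hcont hγ

lemma integrableOn_of_decay {f : ℝ → ℂ} {C : ℝ} (hf : ContinuousOn f (Ici 0))
    (h : ∀ t, 0 ≤ t → ‖f t‖ ≤ C / (1 + t ^ 2)) : IntegrableOn f (Ioi 0) := by
  refine Integrable.mono' ((integrable_inv_one_add_sq.const_mul C).integrableOn)
    ((hf.mono Ioi_subset_Ici_self).aestronglyMeasurable measurableSet_Ioi) ?_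
  refine (ae_restrict_iff' measurableSet_Ioi).2 (ae_of_all _ fun s hs => ?_)
  exact h s (le_of_lt hs)

/-- The one-sided Fourier transform of `odeSol`. -/
lemma fourier_odeSol (hζ : 0 < ζ) (hcont : Continuous γ)
    (hγ : ∀ s, 0 ≤ s → ‖γ s‖ ≤ c / (1 + s ^ 2)) (η ξ : ℝ) (hξ : ζ ≠ ξ)
    (hm : m = (ζ + ξ) / (2 * ζ * (ζ - ξ))) :
    ∫ t in Ioi (0 : ℝ), odeSol γ ζ m t * Complex.exp (-Complex.I * (t * η)) =
      -((∫ t in Ioi (0 : ℝ), γ t * Complex.exp (-Complex.I * (t * η))) / (ζ ^ 2 + η ^ 2)) +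
      (Complex.I * η - ξ) / (ζ - ξ) *
        ((∫ t in Ioi (0 : ℝ), γ t * Complex.exp (-(ζ * t))) / (ζ ^ 2 + η ^ 2)) := by
  have hc : 0 ≤ c := by
    have := (norm_nonneg _).trans (hγ 0 le_rfl)
    norm_num at this; linarith
  have hγ' : ∀ s, 0 < s → ‖γ s‖ ≤ c := fun s hs => (hγ s hs.le).trans
    (div_le_self hc (by nlinarith [sq_nonneg s]))
  have hζ' : (ζ : ℂ) ≠ 0 := by exact_mod_cast hζ.ne'
  have hξ' : (ζ : ℂ) - ξ ≠ 0 := by rw [sub_ne_zero]; exact_mod_cast hξ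
  obtain ⟨C1, hC1⟩ := exists_norm_odeSol_le_decay hζ m (fun s hs => hγ s (le_of_lt hs))
  obtain ⟨C2, hC2⟩ := exists_norm_odeSolDeriv_le_decay hζ m (fun s hs => hγ s (le_of_lt hs))
  have cU := continuousOn_odeSol (m := m) hζ hcont hγ'
  have cU' := continuousOn_odeSolDeriv (m := m) hζ hcont hγ'
  set E : ℝ → ℂ := fun t => Complex.exp (-Complex.I * (t * η)) with hE
  have cE : Continuous E := by fun_prop
  have nE : ∀ t, ‖E t‖ = 1 := fun t => by
    rw [hE, Complex.norm_exp]; simp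
  have dE : ∀ t, HasDerivAt E (-Complex.I * η * E t) t := fun t => by
    have h0 : HasDerivAt (fun t : ℝ => -Complex.I * ((t : ℂ) * η)) (-Complex.I * (1 * η)) t :=
      ((Complex.ofRealCLM.hasDerivAt (x := t)).mul_const (η : ℂ)).const_mul _
    have := h0.cexp
    rw [hE]
    convert this using 1
    ring
  have bnd : ∀ (f : ℝ → ℂ) (C : ℝ), ContinuousOn f (Ici 0) →
      (∀ t, 0 ≤ t → ‖f t‖ ≤ C / (1 + t ^ 2)) → IntegrableOn (fun t => f t * E t) (Ioi 0) := by
    intro f C hf h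
    refine integrableOn_of_decay (C := C) (hf.mul cE.continuousOn) fun t ht => ?_
    rw [norm_mul, nE, mul_one]; exact h t ht
  have iU := bnd _ _ cU hC1
  have iU' := bnd _ _ cU' hC2
  have iγ := bnd _ _ hcont.continuousOn hγ
  -- The primitive that integrates by parts twice at once: by the differential equation, the
  -- derivative of (U' + iηU)e^{-iηt} is (ζ² + η²)Ue^{-iηt} + γe^{-iηt}.
  set F : ℝ → ℂ := fun t =>
    odeSolDeriv γ ζ m t * E t + (Complex.I * η) * (odeSol γ ζ m t * E t) with hF
  have dF : ∀ t ∈ Ioi (0 : ℝ), HasDerivAt F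
      ((ζ ^ 2 + η ^ 2 : ℂ) * (odeSol γ ζ m t * E t) + γ t * E t) t := fun t ht => by
    have h1 := (hasDerivAt_odeSolDeriv (m := m) hζ hcont hγ' ht).mul (dE t)
    have h2 := ((hasDerivAt_odeSol (m := m) hζ hcont hγ' ht).mul (dE t)).const_mul (Complex.I * η)
    refine HasDerivAt.congr_deriv (f := F) (h1.add h2) ?_
    linear_combination ((-(η : ℂ) ^ 2) * odeSol γ ζ m t * E t) * Complex.I_sq
  have iF : IntegrableOn F (Ioi 0) := iU'.add (iU.const_mul _)
  have iF' : IntegrableOn (fun t => (ζ ^ 2 + η ^ 2 : ℂ) * (odeSol γ ζ m t * E t) + γ t * E t)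
    (Ioi 0) := (iU.const_mul _).add iγ
  have cF : ContinuousOn F (Ici 0) :=
    (cU'.mul cE.continuousOn).add (continuousOn_const.mul (cU.mul cE.continuousOn))
  have key := integral_Ioi_of_hasDerivAt_of_tendsto (cF 0 self_mem_Ici) dF iF'
    (tendsto_zero_of_hasDerivAt_of_integrableOn_Ioi dF iF' iF)
  rw [integral_add (iU.const_mul _) iγ, integral_const_mul] at key
  have E0 : E 0 = 1 := by simp [hE]
  have N0 : (∫ t in Ioi (0 : ℝ), γ t * Complex.exp (-(ζ * t))) =
      ∫ s in Ioi (0 : ℝ), (Real.exp (-(ζ * s)) : ℂ) * γ s := by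
    congr 1; ext s; push_cast; ring
  have hF0 : F 0 = odeSolDerivAux γ ζ m 0 + Complex.I * η * odeSolAux γ ζ m 0 := by
    rw [hF]
    simp only [E0, mul_one, odeSol_eq_aux (m := m) hζ le_rfl hcont hγ',
      odeSolDeriv_eq_aux (m := m) hζ le_rfl hcont hγ']
  have hpos : (ζ ^ 2 + η ^ 2 : ℂ) ≠ 0 := by
    have : 0 < ζ ^ 2 + η ^ 2 := by positivity
    exact_mod_cast this.ne'
  rw [N0]
  rw [hF0, odeSolAux, odeSolDerivAux] at key
  simp only [intervalIntegral.integral_same, mul_zero, neg_zero, Real.exp_zero, sub_zero,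
    Complex.ofReal_one, zero_add, one_mul, mul_one, zero_sub] at key
  set N := ∫ s in Ioi (0 : ℝ), (Real.exp (-(ζ * s)) : ℂ) * γ s with hN
  set X := ∫ t in Ioi (0 : ℝ), odeSol γ ζ m t * E t with hX
  set Y := ∫ t in Ioi (0 : ℝ), γ t * E t with hY
  -- This is where the value of m matters: it gives U(0) = -N/(ζ - ξ) and U'(0) = -ξU(0), the
  -- transformed boundary condition, so that -F(0) = (iη - ξ)N/(ζ - ξ).
  have : (ζ ^ 2 + η ^ 2 : ℂ) * X = -Y + (Complex.I * η - ξ) / (ζ - ξ) * N := by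
    rw [eq_sub_of_add_eq key, hm]
    push_cast
    field_simp
    ring
  rw [← mul_right_inj' hpos, this]
  field_simp

end Deriv

end

/-! ### Coordinates on ℝ³ × ℝ, integration along slices, weights for Schwartz functions -/

noncomputable section

/-- `ℝ³`, with coordinates `(x₁, x₂, y₁)`. -/
abbrev E3 : Type := EuclideanSpace ℝ (Fin 3)

/-- The point of `ℝ⁴` with first coordinates `x` and last coordinate `t`. -/
def joinPt (x : E3) (t : ℝ) : R4 := !₂[x 0, x 1, x 2, t]

@[simp] lemma joinPt_zero (x : E3) (t : ℝ) : joinPt x t 0 = x 0 := rfl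
@[simp] lemma joinPt_one (x : E3) (t : ℝ) : joinPt x t 1 = x 1 := rfl
@[simp] lemma joinPt_two (x : E3) (t : ℝ) : joinPt x t 2 = x 2 := rfl
@[simp] lemma joinPt_three (x : E3) (t : ℝ) : joinPt x t 3 = t := rfl

/-- The first three coordinates. -/
def fstThree (z : R4) : E3 := !₂[z 0, z 1, z 2]

@[simp] lemma fstThree_zero (z : R4) : fstThree z 0 = z 0 := rfl
@[simp] lemma fstThree_one (z : R4) : fstThree z 1 = z 1 := rfl
@[simp] lemma fstThree_two (z : R4) : fstThree z 2 = z 2 := rfl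

@[simp] lemma joinPt_fstThree (z : R4) : joinPt (fstThree z) (z 3) = z := by
  ext i; fin_cases i <;> rfl

@[simp] lemma fstThree_joinPt (x : E3) (t : ℝ) : fstThree (joinPt x t) = x := by
  ext i; fin_cases i <;> rfl

lemma continuous_joinPt : Continuous fun p : E3 × ℝ => joinPt p.1 p.2 := by
  unfold joinPt; fun_prop

lemma continuous_fstThree : Continuous fstThree := by
  unfold fstThree; fun_prop

lemma continuous_euclidean_apply {n : ℕ} (i : Fin n) :
    Continuous fun x : EuclideanSpace ℝ (Fin n) => x i := by fun_prop

/-- `joinPt` as a measurable equivalence. -/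
def joinEquiv : E3 × ℝ ≃ᵐ R4 where
  toFun p := joinPt p.1 p.2
  invFun z := (fstThree z, z 3)
  left_inv p := by simp
  right_inv z := by simp
  measurable_toFun := continuous_joinPt.measurable
  measurable_invFun := (continuous_fstThree.prodMk (continuous_euclidean_apply 3)).measurable

lemma measurePreserving_joinEquiv : MeasurePreserving joinEquiv := by
  have h1 : MeasurePreserving (fun p : E3 × ℝ => ((WithLp.ofLp p.1 : Fin 3 → ℝ), p.2))
      (volume.prod volume) (volume.prod volume) :=
    (PiLp.volume_preserving_ofLp (Fin 3)).prod (MeasurePreserving.id volume)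
  have h2 := Measure.measurePreserving_swap (μ := (volume : Measure (Fin 3 → ℝ)))
    (ν := (volume : Measure ℝ))
  have h3 := (volume_preserving_piFinSuccAbove (fun _ : Fin 4 => ℝ) 3).symm
  have h4 := PiLp.volume_preserving_toLp (Fin 4)
  have h := h4.comp (h3.comp (h2.comp h1))
  refine ⟨joinEquiv.measurable, ?_⟩
  rw [← h.map_eq]
  congr 1
  ext p i
  fin_cases i <;> rfl

lemma integral_R4_eq (F : R4 → ℂ) : ∫ z, F z = ∫ p : E3 × ℝ, F (joinPt p.1 p.2) :=
  (measurePreserving_joinEquiv.integral_comp' F).symm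

lemma integrable_R4_iff (F : R4 → ℂ) :
    Integrable F ↔ Integrable (fun p : E3 × ℝ => F (joinPt p.1 p.2)) :=
  (measurePreserving_joinEquiv.integrable_comp_emb joinEquiv.measurableEmbedding).symm

/-- The point of `ℝ³` with `j`-th coordinate `r` and remaining coordinates `y`. -/
def insertCoord (j : Fin 3) (r : ℝ) (y : Fin 2 → ℝ) : E3 :=
  WithLp.toLp 2 (j.insertNth r y : Fin 3 → ℝ)

@[simp] lemma insertCoord_same (j : Fin 3) (r : ℝ) (y : Fin 2 → ℝ) :
    insertCoord j r y j = r := by simp [insertCoord]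

lemma measurePreserving_insertCoord (j : Fin 3) :
    MeasurePreserving (fun p : ℝ × (Fin 2 → ℝ) => insertCoord j p.1 p.2) :=
  (PiLp.volume_preserving_toLp (Fin 3)).comp
    (volume_preserving_piFinSuccAbove (fun _ : Fin 3 => ℝ) j).symm

lemma measurableEmbedding_insertCoord (j : Fin 3) :
    MeasurableEmbedding (fun p : ℝ × (Fin 2 → ℝ) => insertCoord j p.1 p.2) :=
  (MeasurableEquiv.toLp 2 (Fin 3 → ℝ)).measurableEmbedding.comp
    (MeasurableEquiv.piFinSuccAbove (fun _ : Fin 3 => ℝ) j).symm.measurableEmbedding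

/-- Unit coordinate vectors. -/
abbrev unitVec {n : ℕ} (i : Fin n) : EuclideanSpace ℝ (Fin n) := EuclideanSpace.single i 1

lemma insertCoord_add (j : Fin 3) (r s : ℝ) (y : Fin 2 → ℝ) :
    insertCoord j (r + s) y = insertCoord j r y + s • unitVec j := by
  ext i
  simp only [insertCoord, PiLp.add_apply, PiLp.smul_apply, smul_eq_mul]
  rcases eq_or_ne i j with rfl | h
  · simp
  · obtain ⟨k, rfl⟩ := Fin.exists_succAbove_eq h
    simp [h]

lemma integrable_slice {F : E3 → ℂ} (j : Fin 3) (hF : Integrable F) :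
    Integrable (fun p : (Fin 2 → ℝ) × ℝ => F (insertCoord j p.2 p.1)) := by
  have := ((measurePreserving_insertCoord j).integrable_comp_emb
    (measurableEmbedding_insertCoord j)).2 hF
  exact this.swap

lemma integral_slice {F : E3 → ℂ} (j : Fin 3) (hF : Integrable F) :
    ∫ x, F x = ∫ y : Fin 2 → ℝ, ∫ r : ℝ, F (insertCoord j r y) := by
  rw [← (measurePreserving_insertCoord j).integral_comp (measurableEmbedding_insertCoord j)]
  exact integral_prod_symm (fun p : ℝ × (Fin 2 → ℝ) => F (insertCoord j p.1 p.2))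
    (integrable_slice j hF).swap

lemma hasDerivAt_insertCoord {F F' : E3 → ℂ} {j : Fin 3} {r : ℝ} {y : Fin 2 → ℝ}
    (h : HasDerivAt (fun s : ℝ => F (insertCoord j r y + s • unitVec j))
      (F' (insertCoord j r y)) 0) :
    HasDerivAt (fun r : ℝ => F (insertCoord j r y)) (F' (insertCoord j r y)) r := by
  rw [← sub_self r] at h
  refine (h.comp_sub_const r r).congr_of_eventuallyEq (Eventually.of_forall fun s => ?_)
  simp only [← insertCoord_add, add_sub_cancel]

/-- Fubini over the lines parallel to the j-th axis, and the fundamental theorem of calculus on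
almost every line. -/
lemma integral_directional_deriv_eq_zero {F F' : E3 → ℂ} (j : Fin 3) (hF : Integrable F)
    (hF' : Integrable F')
    (h : ∀ x, HasDerivAt (fun s : ℝ => F (x + s • unitVec j)) (F' x) 0) :
    ∫ x, F' x = 0 := by
  rw [integral_slice j hF']
  refine integral_eq_zero_of_ae ?_
  filter_upwards [(integrable_slice j hF).prod_right_ae, (integrable_slice j hF').prod_right_ae]
    with y h1 h2
  exact integral_eq_zero_of_hasDerivAt_of_integrable
    (fun r => hasDerivAt_insertCoord (h _)) h2 h1

/-- The same argument on half-lines leaves the value on the face, which is what `B` dominates. -/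
lemma norm_setIntegral_directional_deriv_le {F F' : E3 → ℂ} (j : Fin 3) (hF : Integrable F)
    (hF' : Integrable F')
    (h : ∀ x, HasDerivAt (fun s : ℝ => F (x + s • unitVec j)) (F' x) 0)
    {B : (Fin 2 → ℝ) → ℝ} (hB : Integrable B) (hFB : ∀ y, ‖F (insertCoord j 0 y)‖ ≤ B y) :
    ‖∫ x in {x | 0 < x j}, F' x‖ ≤ ∫ y, B y := by
  have hm : MeasurableSet {x : E3 | 0 < x j} :=
    measurableSet_lt measurable_const (continuous_euclidean_apply j).measurable
  rw [← integral_indicator hm, integral_slice j (hF'.indicator hm)]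
  refine norm_integral_le_of_norm_le hB ?_
  filter_upwards [(integrable_slice j hF).prod_right_ae, (integrable_slice j hF').prod_right_ae]
    with y h1 h2
  have e : (fun r : ℝ => indicator {x : E3 | 0 < x j} F' (insertCoord j r y)) =
      indicator (Ioi 0) (fun r => F' (insertCoord j r y)) := by
    ext r; simp [indicator]
  have hd : ∀ r, HasDerivAt (fun r : ℝ => F (insertCoord j r y)) (F' (insertCoord j r y)) r :=
    fun r => hasDerivAt_insertCoord (h _)
  rw [e, integral_indicator measurableSet_Ioi,
    integral_Ioi_of_hasDerivAt_of_tendsto (hd 0).continuousAt.continuousWithinAt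
      (fun r _ => hd r) h2.integrableOn
      (tendsto_zero_of_hasDerivAt_of_integrableOn_Ioi (a := 0) (fun r _ => hd r) h2.integrableOn
        h1.integrableOn), zero_sub, norm_neg]
  exact hFB y

/-- The weight `(1 + r²)⁻¹`. -/
def wt (r : ℝ) : ℝ := (1 + r ^ 2)⁻¹

lemma wt_pos (r : ℝ) : 0 < wt r := by unfold wt; positivity
lemma wt_le_one (r : ℝ) : wt r ≤ 1 := inv_le_one_of_one_le₀ (by nlinarith [sq_nonneg r])
lemma continuous_wt : Continuous wt := by
  unfold wt
  exact Continuous.inv₀ (by fun_prop) fun r => by positivity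
lemma integrable_wt : Integrable wt := integrable_inv_one_add_sq
lemma abs_mul_wt_le_one (r : ℝ) : |r| * wt r ≤ 1 := by
  unfold wt
  rw [← div_eq_mul_inv, div_le_one (by positivity)]
  nlinarith [sq_abs r, sq_nonneg (|r| - 1)]
@[simp] lemma wt_abs (r : ℝ) : wt |r| = wt r := by simp [wt]

/-- The product weight on `ℝ³`. -/
def wt3 (x : E3) : ℝ := wt (x 0) * wt (x 1) * wt (x 2)

lemma wt3_pos (x : E3) : 0 < wt3 x :=
  mul_pos (mul_pos (wt_pos _) (wt_pos _)) (wt_pos _)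

lemma integrable_prod_coord {f g h : ℝ → ℝ} (hf : Integrable f) (hg : Integrable g)
    (hh : Integrable h) : Integrable (fun x : E3 => f (x 0) * g (x 1) * h (x 2)) := by
  have := Integrable.fintype_prod (f := ![f, g, h]) (μ := fun _ : Fin 3 => volume)
    (by intro i; fin_cases i <;> assumption)
  have h2 := ((PiLp.volume_preserving_ofLp (Fin 3)).integrable_comp_emb
    (MeasurableEquiv.toLp 2 (Fin 3 → ℝ)).symm.measurableEmbedding).2 this
  refine h2.congr (ae_of_all _ fun x => ?_)
  simp [Fin.prod_univ_three]

lemma integrable_wt3 : Integrable wt3 := integrable_prod_coord integrable_wt integrable_wt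
  integrable_wt

section Schwartz

open LineDeriv

/-- Coordinate derivatives of Schwartz functions. -/
def pd (i : Fin 4) (f : 𝓢(R4, ℂ)) : 𝓢(R4, ℂ) := ∂_{(unitVec i : R4)} f

lemma pd_apply (i : Fin 4) (f : 𝓢(R4, ℂ)) (z : R4) : pd i f z = fderiv ℝ f z (unitVec i) := rfl

/-- The generator of dilations, `f ↦ z · ∇f`. -/
def dil (f : 𝓢(R4, ℂ)) : 𝓢(R4, ℂ) :=
  ∑ i : Fin 4, SchwartzMap.smulLeftCLM ℂ (fun z : R4 => z i) (pd i f)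

lemma dil_apply (f : 𝓢(R4, ℂ)) (z : R4) : dil f z = fderiv ℝ f z z := by
  have h : ∀ i : Fin 4, (fun z : R4 => z i).HasTemperateGrowth := fun i =>
    (EuclideanSpace.proj (𝕜 := ℝ) i : R4 →L[ℝ] ℝ).hasTemperateGrowth
  have hz : z = ∑ i : Fin 4, z i • (unitVec i : R4) := by
    ext j; fin_cases j <;> simp [Fin.sum_univ_four]
  conv_rhs => rw [hz]
  rw [map_sum]
  simp only [dil, sum_apply, SchwartzMap.smulLeftCLM_apply_apply (h _), pd_apply,
    map_smul]
  rw [← hz]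

lemma hasDerivAt_dilation (f : 𝓢(R4, ℂ)) (z : R4) (μ : ℝ) :
    HasDerivAt (fun μ : ℝ => f (Real.exp μ • z)) (dil f (Real.exp μ • z)) μ := by
  rw [dil_apply]
  exact (f.hasFDerivAt (Real.exp μ • z)).comp_hasDerivAt μ ((Real.hasDerivAt_exp μ).smul_const z)

lemma hasDerivAt_translate (f : 𝓢(R4, ℂ)) (i : Fin 4) (z : R4) :
    HasDerivAt (fun s : ℝ => f (z + s • unitVec i)) (pd i f z) 0 := by
  have h1 : HasDerivAt (fun s : ℝ => z + s • (unitVec i : R4)) (unitVec i) 0 := by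
    simpa using ((hasDerivAt_id (0 : ℝ)).smul_const (unitVec i : R4)).const_add z
  have := (f.hasFDerivAt (z + (0 : ℝ) • unitVec i)).comp_hasDerivAt 0 h1
  rw [zero_smul, add_zero, ← pd_apply] at this
  exact this

/-- The weights are squared so that one copy can absorb a polynomial factor such as |y₁| while the
other keeps the integrability. -/
lemma norm_le_wt (f : 𝓢(R4, ℂ)) :
    ∃ C, 0 ≤ C ∧ ∀ z, ‖f z‖ ≤ C * (wt (z 0) * wt (z 1) * wt (z 2) * wt (z 3)) ^ 2 := by
  -- The exponent is 16 = 4 · 2 · 2: four coordinates, each 1 + zᵢ² bounded by (1 + ‖z‖)², and the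
  -- product squared.
  have := SchwartzMap.one_add_le_sup_seminorm_apply (𝕜 := ℝ) (m := (16, 0)) (k := 16) (n := 0)
    le_rfl le_rfl f
  set C := 2 ^ 16 * (Finset.Iic (16, 0)).sup (fun m => SchwartzMap.seminorm ℝ m.1 m.2) f
  have hC : 0 ≤ C := le_trans (by positivity) (this 0)
  refine ⟨C, hC, fun z => ?_⟩
  have h := this z
  rw [norm_iteratedFDeriv_zero] at h
  have hi : ∀ i, 1 + z i ^ 2 ≤ (1 + ‖z‖) ^ 2 := fun i => by
    have := PiLp.norm_apply_le z i
    rw [Real.norm_eq_abs] at this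
    nlinarith [sq_abs (z i), abs_nonneg (z i), norm_nonneg z]
  have hp : ((1 + z 0 ^ 2) * (1 + z 1 ^ 2) * (1 + z 2 ^ 2) * (1 + z 3 ^ 2)) ^ 2 ≤
      (1 + ‖z‖) ^ 16 := by
    calc _ ≤ ((1 + ‖z‖) ^ 2 * (1 + ‖z‖) ^ 2 * (1 + ‖z‖) ^ 2 * (1 + ‖z‖) ^ 2) ^ 2 := by
          gcongr <;> exact hi _
      _ = _ := by ring
  have e : (wt (z 0) * wt (z 1) * wt (z 2) * wt (z 3)) ^ 2 =
      (((1 + z 0 ^ 2) * (1 + z 1 ^ 2) * (1 + z 2 ^ 2) * (1 + z 3 ^ 2)) ^ 2)⁻¹ := by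
    rw [← inv_pow]; simp only [wt, mul_inv]
  rw [e, ← div_eq_mul_inv, le_div_iff₀ (by positivity), mul_comm]
  exact (mul_le_mul_of_nonneg_right hp (norm_nonneg _)).trans h

lemma norm_joinPt_le_wt (f : 𝓢(R4, ℂ)) :
    ∃ C, 0 ≤ C ∧ ∀ x s, ‖f (joinPt x s)‖ ≤ C * (wt3 x ^ 2 * wt s ^ 2) := by
  obtain ⟨C, hC, h⟩ := norm_le_wt f
  refine ⟨C, hC, fun x s => (h _).trans (le_of_eq ?_)⟩
  simp only [wt3, joinPt_zero, joinPt_one, joinPt_two, joinPt_three]; ring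

end Schwartz

end

/-! ### Partial Fourier transform of the odd extension -/

noncomputable section

/-- The character `x ↦ exp (2πi ⟨x, k⟩)`. -/
def ch (k x : E3) : ℂ := (Real.fourierChar (inner ℝ x k) : ℂ)

@[simp] lemma norm_ch (k x : E3) : ‖ch k x‖ = 1 := Circle.norm_coe _

lemma continuous_ch : Continuous fun p : E3 × E3 => ch p.1 p.2 := by
  unfold ch
  exact continuous_subtype_val.comp (Real.continuous_fourierChar.comp (by fun_prop))

@[fun_prop] lemma Continuous.ch {X : Type*} [TopologicalSpace X] {f g : X → E3}
    (hf : Continuous f) (hg : Continuous g) : Continuous fun x => ch (f x) (g x) :=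
  continuous_ch.comp (hf.prodMk hg)

lemma inner_E3 (x k : E3) : inner ℝ x k = x 0 * k 0 + x 1 * k 1 + x 2 * k 2 := by
  simp [PiLp.inner_apply, Fin.sum_univ_three]; ring

lemma ch_eq_exp (k x : E3) : ch k x = Complex.exp (2 * Real.pi * Complex.I *
    (x 0 * k 0 + x 1 * k 1 + x 2 * k 2)) := by
  rw [ch, Real.fourierChar_apply, inner_E3]
  congr 1; push_cast; ring

lemma ch_smul_left (a : ℝ) (k x : E3) : ch (a • k) x = ch k (a • x) := by
  simp [ch, inner_smul_left, inner_smul_right]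

lemma hasDerivAt_ch (k x : E3) (j : Fin 3) :
    HasDerivAt (fun s : ℝ => ch k (x + s • unitVec j))
      (2 * Real.pi * Complex.I * k j * ch k x) 0 := by
  have h1 : HasDerivAt (fun s : ℝ => (inner ℝ (x + s • (unitVec j : E3)) k : ℝ)) (k j) 0 := by
    have : ∀ s : ℝ, (inner ℝ (x + s • (unitVec j : E3)) k : ℝ) = inner ℝ x k + s * k j := by
      intro s
      rw [inner_add_left, inner_smul_left, EuclideanSpace.inner_single_left]
      simp
    simp only [this]
    simpa using ((hasDerivAt_id (0 : ℝ)).mul_const (k j)).const_add (inner ℝ x k : ℝ)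
  have := (Real.hasDerivAt_fourierChar (inner ℝ (x + (0 : ℝ) • (unitVec j : E3)) k)).scomp 0 h1
  refine HasDerivAt.congr_deriv (f := fun s : ℝ => ch k (x + s • unitVec j)) this ?_
  rw [zero_smul, add_zero, Complex.real_smul, ch]
  ring

lemma norm_ch_sub_ch_le (k l x : E3) :
    ‖ch k x - ch l x‖ ≤ 2 * Real.pi * |inner ℝ x (k - l)| := by
  have h : ch k x - ch l x =
      ch l x * (Complex.exp (Complex.I * (2 * Real.pi * inner ℝ x (k - l) : ℝ)) - 1) := by
    rw [ch, ch, Real.fourierChar_apply, Real.fourierChar_apply, mul_sub, ← Complex.exp_add, mul_one,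
      inner_sub_right]
    congr 2; push_cast; ring
  rw [h, norm_mul, norm_ch, one_mul]
  refine Real.norm_exp_I_mul_ofReal_sub_one_le.trans ?_
  rw [Real.norm_eq_abs, abs_mul, abs_of_pos (by positivity)]

/-- The reflection in the third coordinate. -/
def refl3 : E3 ≃ₗᵢ[ℝ] E3 := LinearIsometryEquiv.piLpCongrRight 2 fun i : Fin 3 =>
  if i = 2 then LinearIsometryEquiv.neg ℝ else LinearIsometryEquiv.refl ℝ ℝ

@[simp] lemma refl3_zero (x : E3) : refl3 x 0 = x 0 := rfl
@[simp] lemma refl3_one (x : E3) : refl3 x 1 = x 1 := rfl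
@[simp] lemma refl3_two (x : E3) : refl3 x 2 = -x 2 := rfl

lemma ch_refl3 (k x : E3) : ch k (refl3 x) = ch (refl3 k) x := by
  simp [ch_eq_exp]

/-- `x` with its third coordinate replaced by its absolute value. -/
def absThird (x : E3) : E3 := !₂[x 0, x 1, |x 2|]

@[simp] lemma absThird_zero (x : E3) : absThird x 0 = x 0 := rfl
@[simp] lemma absThird_one (x : E3) : absThird x 1 = x 1 := rfl
@[simp] lemma absThird_two (x : E3) : absThird x 2 = |x 2| := rfl

lemma continuous_absThird : Continuous absThird := by
  unfold absThird; fun_prop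

lemma absThird_of_nonneg {x : E3} (h : 0 ≤ x 2) : absThird x = x := by
  ext i; fin_cases i <;> simp [abs_of_nonneg, h]

lemma absThird_refl3 (x : E3) : absThird (refl3 x) = absThird x := by
  ext i; fin_cases i <;> simp

@[simp] lemma wt3_absThird (x : E3) : wt3 (absThird x) = wt3 x := by simp [wt3]

/-- The extension of `f(·, s)` from `y₁ > 0` to `ℝ³` that is odd in `y₁`. -/
def oddRefl (f : R4 → ℂ) (x : E3) (s : ℝ) : ℂ :=
  (Real.sign (x 2) : ℂ) * f (joinPt (absThird x) s)

/-- The Fourier transform of the odd extension in the first three variables. -/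
def partialHat (f : R4 → ℂ) (k : E3) (s : ℝ) : ℂ := ∫ x : E3, ch (-k) x * oddRefl f x s

lemma oddRefl_of_pos {f : R4 → ℂ} {x : E3} {s : ℝ} (h : 0 < x 2) :
    oddRefl f x s = f (joinPt x s) := by
  simp [oddRefl, Real.sign_of_pos h, absThird_of_nonneg h.le]

lemma oddRefl_refl3 (f : R4 → ℂ) (x : E3) (s : ℝ) :
    oddRefl f (refl3 x) s = -oddRefl f x s := by
  simp [oddRefl, absThird_refl3, Real.sign_neg]

lemma partialHat_refl3 (f : R4 → ℂ) (k : E3) (s : ℝ) :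
    partialHat f (refl3 k) s = -partialHat f k s := by
  unfold partialHat
  rw [← (LinearIsometryEquiv.measurePreserving refl3).integral_comp'
    (f := refl3.toMeasurableEquiv), ← integral_neg]
  congr 1; ext x
  change ch (-(refl3 k)) (refl3 x) * oddRefl f (refl3 x) s = _
  rw [oddRefl_refl3, ← map_neg, ← ch_refl3]
  have : refl3 (refl3 x) = x := by ext i; fin_cases i <;> simp
  rw [this]; ring

lemma norm_sign_le (r : ℝ) : ‖(Real.sign r : ℂ)‖ ≤ 1 := by
  rw [Complex.norm_real]
  rcases Real.sign_apply_eq r with h | h | h <;> simp [h]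

lemma measurable_sign : Measurable Real.sign := by
  unfold Real.sign
  exact Measurable.ite measurableSet_Iio measurable_const
    (Measurable.ite measurableSet_Ioi measurable_const measurable_const)

section Schwartz

variable (f : 𝓢(R4, ℂ))

lemma oddRefl_bound : ∃ C, 0 ≤ C ∧ ∀ x s, ‖oddRefl f x s‖ ≤ C * (wt3 x ^ 2 * wt s ^ 2) := by
  obtain ⟨C, hC, h⟩ := norm_joinPt_le_wt f
  refine ⟨C, hC, fun x s => ?_⟩
  rw [oddRefl, norm_mul]
  have := h (absThird x) s
  rw [wt3_absThird] at this
  calc _ ≤ 1 * ‖f (joinPt (absThird x) s)‖ := by gcongr; exact norm_sign_le _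
    _ ≤ _ := by rwa [one_mul]

lemma wt3_le_one (x : E3) : wt3 x ≤ 1 := by
  unfold wt3
  exact mul_le_one₀ (mul_le_one₀ (wt_le_one _) (wt_pos _).le (wt_le_one _)) (wt_pos _).le
    (wt_le_one _)

lemma wt3_sq_le (x : E3) : wt3 x ^ 2 ≤ wt3 x := by
  rw [sq]; exact mul_le_of_le_one_left (wt3_pos x).le (wt3_le_one x)

lemma wt_sq_le (s : ℝ) : wt s ^ 2 ≤ wt s := by
  rw [sq]; exact mul_le_of_le_one_left (wt_pos s).le (wt_le_one s)

lemma oddRefl_bound' : ∃ C, 0 ≤ C ∧ ∀ x s, ‖oddRefl f x s‖ ≤ C * (wt3 x * wt s) := by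
  obtain ⟨C, hC, h⟩ := oddRefl_bound f
  refine ⟨C, hC, fun x s => (h x s).trans ?_⟩
  have := (wt3_pos x).le
  gcongr
  · exact wt3_sq_le x
  · exact wt_sq_le s

lemma measurable_oddRefl : Measurable fun p : E3 × ℝ => oddRefl f p.1 p.2 := by
  unfold oddRefl
  refine Measurable.mul ?_ ?_
  · exact Complex.measurable_ofReal.comp (measurable_sign.comp
      ((continuous_euclidean_apply 2).measurable.comp measurable_fst))
  · exact (f.continuous.comp (continuous_joinPt.comp
      ((continuous_absThird.comp continuous_fst).prodMk continuous_snd))).measurable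

lemma measurable_oddRefl_left (s : ℝ) : Measurable fun x : E3 => oddRefl f x s :=
  (measurable_oddRefl f).comp (measurable_id.prodMk measurable_const)

lemma integrable_oddRefl (s : ℝ) : Integrable fun x => oddRefl f x s := by
  obtain ⟨C, hC, h⟩ := oddRefl_bound' f
  refine Integrable.mono' ((integrable_wt3.mul_const (wt s)).const_mul C)
    (measurable_oddRefl_left f s).aestronglyMeasurable (ae_of_all _ fun x => h x s)

lemma integrable_ch_mul {g : E3 → ℂ} (hg : Integrable g) (k : E3) :
    Integrable fun x => ch k x * g x :=
  hg.bdd_mul (c := 1) (by fun_prop) (ae_of_all _ fun x => (norm_ch k x).le)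

lemma continuous_partialHat : Continuous fun p : E3 × ℝ => partialHat f p.1 p.2 := by
  obtain ⟨C, hC, h⟩ := oddRefl_bound' f
  unfold partialHat
  refine continuous_of_dominated (bound := fun x => C * wt3 x) (fun p => ?_)
    (fun p => ae_of_all _ fun x => ?_) (integrable_wt3.const_mul C) (ae_of_all _ fun x => ?_)
  · exact (integrable_ch_mul (integrable_oddRefl f p.2) _).aestronglyMeasurable
  · rw [norm_mul, norm_ch, one_mul]
    refine (h x p.2).trans ?_
    have := (wt3_pos x).le
    gcongr
    exact mul_le_of_le_one_right this (wt_le_one _)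
  · refine Continuous.mul (by fun_prop) ?_
    unfold oddRefl
    exact continuous_const.mul (f.continuous.comp (continuous_joinPt.comp
      (continuous_const.prodMk continuous_snd)))

lemma continuous_partialHat_right (k : E3) : Continuous (fun s => partialHat f k s) :=
  Continuous.comp (g := fun p : E3 × ℝ => partialHat f p.1 p.2) (f := fun s : ℝ => (k, s))
    (continuous_partialHat f) (by fun_prop)

lemma joinPt_add_smul (x : E3) (s r : ℝ) (j : Fin 3) :
    joinPt (x + r • unitVec j) s = joinPt x s + r • unitVec j.castSucc := by
  have h : ∀ i : Fin 3, (unitVec j : E3) i = if i = j then 1 else 0 := fun i => by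
    simp
  have h' : ∀ i : Fin 4, (unitVec j.castSucc : R4) i = if i = j.castSucc then 1 else 0 :=
    fun i => by simp
  ext i
  simp only [PiLp.add_apply, PiLp.smul_apply, h', smul_eq_mul]
  fin_cases i
  all_goals
    simp only [joinPt, PiLp.add_apply, PiLp.smul_apply, h, smul_eq_mul]
    fin_cases j <;> simp

lemma absThird_add_smul (x : E3) (r : ℝ) {j : Fin 3} (hj : j ≠ 2) :
    absThird (x + r • unitVec j) = absThird x + r • unitVec j := by
  have h : ∀ i : Fin 3, (unitVec j : E3) i = if i = j then 1 else 0 := fun i => by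
    simp
  ext i
  simp only [PiLp.add_apply, PiLp.smul_apply, h, smul_eq_mul]
  fin_cases i <;> simp [absThird, hj.symm]

lemma hasDerivAt_oddRefl (x : E3) (s : ℝ) {j : Fin 3} (hj : j ≠ 2) :
    HasDerivAt (fun r : ℝ => oddRefl f (x + r • unitVec j) s)
      (oddRefl (pd j.castSucc f) x s) 0 := by
  have h2 : ∀ r : ℝ, (x + r • (unitVec j : E3)) 2 = x 2 := fun r => by
    fin_cases j <;> simp at hj ⊢
  simp only [oddRefl, h2, absThird_add_smul x _ hj, joinPt_add_smul]
  exact (hasDerivAt_translate f j.castSucc _).const_mul _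

/-- The integral of the derivative of the character times the extension vanishes. The direction of
y₁ is excluded because the odd extension jumps across y₁ = 0. -/
lemma partialHat_pd (k : E3) (s : ℝ) {j : Fin 3} (hj : j ≠ 2) :
    partialHat (pd j.castSucc f) k s = 2 * Real.pi * Complex.I * k j * partialHat f k s := by
  have i1 := integrable_ch_mul (integrable_oddRefl f s) (-k)
  have i2 := integrable_ch_mul (integrable_oddRefl (pd j.castSucc f) s) (-k)
  have := integral_directional_deriv_eq_zero j i1
    (F' := fun x => (2 * Real.pi * Complex.I * (-k) j) * (ch (-k) x * oddRefl f x s) +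
      ch (-k) x * oddRefl (pd j.castSucc f) x s) ((i1.const_mul _).add i2) (fun x => by
        have := (hasDerivAt_ch (-k) x j).mul (hasDerivAt_oddRefl f x s hj)
        refine this.congr_deriv ?_
        simp only [zero_smul, add_zero]
        ring)
  rw [integral_add (i1.const_mul _) i2, integral_const_mul] at this
  rw [partialHat, partialHat]
  simp only [PiLp.neg_apply, Complex.ofReal_neg] at this
  linear_combination this

lemma partialHat_sub (g : 𝓢(R4, ℂ)) (k : E3) (s : ℝ) :
    partialHat (f - g) k s = partialHat f k s - partialHat g k s := by
  unfold partialHat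
  rw [← integral_sub (integrable_ch_mul (integrable_oddRefl f s) _)
    (integrable_ch_mul (integrable_oddRefl g s) _)]
  congr 1; ext x
  simp only [oddRefl, Pi.sub_apply]
  ring

lemma integral_eq_setIntegral_refl3 {F : E3 → ℂ} (hF : Integrable F) :
    ∫ x, F x = ∫ x in {x : E3 | 0 < x 2}, (F x + F (refl3 x)) := by
  have mp := LinearIsometryEquiv.measurePreserving refl3
  have emb : MeasurableEmbedding refl3 := refl3.toMeasurableEquiv.measurableEmbedding
  have hm : MeasurableSet {x : E3 | 0 < x 2} :=
    measurableSet_lt measurable_const (continuous_euclidean_apply 2).measurable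
  have h0 : (volume : Measure E3) {x | x 2 = 0} = 0 := by
    have h := Measure.addHaar_affineSubspace (volume : Measure E3)
      (LinearMap.ker (EuclideanSpace.proj (𝕜 := ℝ) (2 : Fin 3) : E3 →L[ℝ] ℝ).toLinearMap).toAffineSubspace
      (by
        intro h
        have : (unitVec 2 : E3) ∈ (LinearMap.ker (EuclideanSpace.proj (𝕜 := ℝ) (2 : Fin 3) :
          E3 →L[ℝ] ℝ).toLinearMap).toAffineSubspace := by rw [h]; trivial
        simp at this)
    convert h using 2
    ext x; simp
  have hF2 : Integrable (fun x => F (refl3 x)) := (mp.integrable_comp_emb emb).2 hF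
  rw [integral_add hF.integrableOn hF2.integrableOn]
  have e : ∫ x in {x : E3 | 0 < x 2}, F (refl3 x) = ∫ x in {x : E3 | 0 < x 2}ᶜ, F x := by
    have h1 := mp.setIntegral_preimage_emb emb F {x : E3 | x 2 < 0}
    have h2 : refl3 ⁻¹' {x : E3 | x 2 < 0} = {x | 0 < x 2} := by ext x; simp
    rw [h2] at h1
    rw [h1]
    refine setIntegral_congr_set ?_
    have : ∀ᵐ x : E3, x 2 ≠ 0 := by rw [ae_iff]; simpa using h0
    filter_upwards [this] with x hx
    simp only [eq_iff_iff]
    change x 2 < 0 ↔ ¬ (0 < x 2)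
    rw [not_lt]
    exact ⟨le_of_lt, fun h => lt_of_le_of_ne h hx⟩
  rw [e, integral_add_compl hm hF]

/-- Folding y₁ < 0 onto y₁ > 0 gives a sine transform of the smooth function `f`. The difference of
characters vanishes at k₂ = 0 and has a simple antiderivative in y₁; the two bounds in k₂ below rest
on these two facts. -/
lemma partialHat_eq_half (k : E3) (s : ℝ) : partialHat f k s =
    ∫ x in {x : E3 | 0 < x 2}, (ch (-k) x - ch (-(refl3 k)) x) * f (joinPt x s) := by
  rw [partialHat, integral_eq_setIntegral_refl3 (integrable_ch_mul (integrable_oddRefl f s) _)]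
  refine setIntegral_congr_fun
    (measurableSet_lt measurable_const (continuous_euclidean_apply 2).measurable) fun x hx => ?_
  simp only [ch_refl3, oddRefl_refl3, oddRefl_of_pos (hx : 0 < x 2), map_neg]
  ring

end Schwartz

end

/-! ### Decay of the partial Fourier transform -/

noncomputable section

section Schwartz

variable (f : 𝓢(R4, ℂ))

lemma integrable_comp_joinPt (s : ℝ) : Integrable fun x => f (joinPt x s) := by
  obtain ⟨C, hC, h⟩ := norm_joinPt_le_wt f
  refine Integrable.mono' ((integrable_wt3.mul_const (wt s)).const_mul C)
    (f.continuous.comp (continuous_joinPt.comp (by fun_prop :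
      Continuous fun x : E3 => (x, s)))).aestronglyMeasurable (ae_of_all _ fun x => ?_)
  refine (h x s).trans ?_
  have := (wt3_pos x).le
  gcongr
  · exact wt3_sq_le x
  · exact wt_sq_le s

/-- The two characters differ by at most 4π|y₁||k₂|, and one copy of the weight absorbs |y₁|. -/
lemma norm_partialHat_le_abs : ∃ C, 0 ≤ C ∧ ∀ k s, ‖partialHat f k s‖ ≤ C * |k 2| * wt s := by
  obtain ⟨C, hC, h⟩ := norm_joinPt_le_wt f
  have hI : 0 ≤ ∫ x, wt3 x := integral_nonneg fun x => (wt3_pos x).le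
  refine ⟨4 * Real.pi * C * ∫ x, wt3 x, by positivity, fun k s => ?_⟩
  rw [partialHat_eq_half]
  calc _ ≤ ∫ x in {x : E3 | 0 < x 2}, 4 * Real.pi * C * |k 2| * wt s * wt3 x := by
        refine norm_integral_le_of_norm_le (integrable_wt3.const_mul _).integrableOn
          (ae_of_all _ fun x => ?_)
        rw [norm_mul]
        have h1 := norm_ch_sub_ch_le (-k) (-(refl3 k)) x
        have h2 : inner ℝ x (-k - -(refl3 k)) = -(2 * x 2 * k 2) := by
          rw [inner_E3]; simp; ring
        rw [h2, abs_neg, abs_mul, abs_mul, abs_two] at h1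
        have h3 : |x 2| * wt3 x ^ 2 ≤ wt3 x := by
          have e : |x 2| * wt3 x ^ 2 = (|x 2| * wt (x 2)) * (wt (x 0) * wt (x 1)) * wt3 x := by
            simp only [wt3]; ring
          rw [e]
          refine mul_le_of_le_one_left (wt3_pos x).le (mul_le_one₀ (abs_mul_wt_le_one _)
            (mul_pos (wt_pos _) (wt_pos _)).le
            (mul_le_one₀ (wt_le_one _) (wt_pos _).le (wt_le_one _)))
        have hw := (wt_pos s).le
        calc _ ≤ (2 * Real.pi * (2 * |x 2| * |k 2|)) * (C * (wt3 x ^ 2 * wt s ^ 2)) := by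
              gcongr; exact h x s
          _ = 4 * Real.pi * C * |k 2| * (wt s ^ 2) * (|x 2| * wt3 x ^ 2) := by ring
          _ ≤ 4 * Real.pi * C * |k 2| * wt s * wt3 x := by
              gcongr
              exact wt_sq_le s
    _ ≤ ∫ x, 4 * Real.pi * C * |k 2| * wt s * wt3 x := by
        refine setIntegral_le_integral (integrable_wt3.const_mul _) (ae_of_all _ fun x => ?_)
        have := (wt3_pos x).le
        have := (wt_pos s).le
        simp only [Pi.zero_apply]
        positivity
    _ = _ := by rw [integral_const_mul]; ring

lemma integrable_wt_pair : Integrable fun y : Fin 2 → ℝ => wt (y 0) * wt (y 1) := by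
  have := Integrable.fintype_prod (f := ![wt, wt]) (μ := fun _ : Fin 2 => volume)
    (by intro i; fin_cases i <;> exact integrable_wt)
  refine this.congr (ae_of_all _ fun x => ?_)
  simp [Fin.prod_univ_two]

lemma wt3_insertCoord (r : ℝ) (y : Fin 2 → ℝ) :
    wt3 (insertCoord 2 r y) = wt (y 0) * wt (y 1) * wt r := rfl

/-- One integration by parts in y₁ over the half-space. The boundary term at y₁ = 0 does not vanish
in general, so this argument gains a single power of k₂. -/
lemma norm_mul_partialHat_le : ∃ C, 0 ≤ C ∧ ∀ k s, |k 2| * ‖partialHat f k s‖ ≤ C * wt s := by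
  obtain ⟨C, hC, h⟩ := norm_joinPt_le_wt f
  obtain ⟨C', hC', h'⟩ := norm_joinPt_le_wt (pd 2 f)
  have hI : 0 ≤ ∫ x, wt3 x := integral_nonneg fun x => (wt3_pos x).le
  have hJ : 0 ≤ ∫ y : Fin 2 → ℝ, wt (y 0) * wt (y 1) := integral_nonneg fun y =>
    (mul_pos (wt_pos _) (wt_pos _)).le
  refine ⟨2 * C * (∫ y : Fin 2 → ℝ, wt (y 0) * wt (y 1)) + 2 * C' * ∫ x, wt3 x, by positivity,
    fun k s => ?_⟩
  have hw := (wt_pos s).le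
  -- Up to the factor `a`, the sum of the two characters is an antiderivative in y₁ of their
  -- difference, because k and its reflection have opposite third coordinates.
  set e : E3 → ℂ := fun x => ch (-k) x + ch (-(refl3 k)) x with he
  have ne : ∀ x, ‖e x‖ ≤ 2 := fun x => by
    refine (norm_add_le _ _).trans ?_
    rw [norm_ch, norm_ch]; norm_num
  have ce : Continuous e := by fun_prop
  have i1 : Integrable fun x => e x * f (joinPt x s) :=
    (integrable_comp_joinPt f s).bdd_mul (c := 2) (by fun_prop) (ae_of_all _ ne)
  have i2 : Integrable fun x => e x * pd 2 f (joinPt x s) :=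
    (integrable_comp_joinPt (pd 2 f) s).bdd_mul (c := 2) (by fun_prop) (ae_of_all _ ne)
  have i3 : Integrable fun x => (ch (-k) x - ch (-(refl3 k)) x) * f (joinPt x s) := by
    simp only [sub_mul]
    exact (integrable_ch_mul (integrable_comp_joinPt f s) _).sub
      (integrable_ch_mul (integrable_comp_joinPt f s) _)
  set a : ℂ := 2 * Real.pi * Complex.I * (-k) 2 with ha
  have hd : ∀ x, HasDerivAt (fun r : ℝ => e (x + r • unitVec 2) * f (joinPt (x + r • unitVec 2) s))
      (a * ((ch (-k) x - ch (-(refl3 k)) x) * f (joinPt x s)) + e x * pd 2 f (joinPt x s)) 0 := by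
    intro x
    have h1 := (hasDerivAt_ch (-k) x 2).add (hasDerivAt_ch (-(refl3 k)) x 2)
    have h2 : HasDerivAt (fun r : ℝ => f (joinPt (x + r • unitVec 2) s))
        (pd 2 f (joinPt x s)) 0 := by
      simp only [joinPt_add_smul]
      exact hasDerivAt_translate f _ _
    refine (h1.mul h2).congr_deriv ?_
    simp only [zero_smul, add_zero, he, ha, Pi.add_apply]
    simp
    ring
  have key := norm_setIntegral_directional_deriv_le 2 i1 ((i3.const_mul a).add i2) hd
    (B := fun y => 2 * C * wt s * (wt (y 0) * wt (y 1))) (integrable_wt_pair.const_mul _)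
    (fun y => by
      rw [norm_mul]
      calc _ ≤ 2 * (C * (wt3 (insertCoord 2 0 y) ^ 2 * wt s ^ 2)) := by
            gcongr
            · exact ne _
            · exact h _ _
        _ ≤ 2 * (C * (wt3 (insertCoord 2 0 y) * wt s)) := by
            have := (wt3_pos (insertCoord 2 0 y)).le
            gcongr
            · exact wt3_sq_le _
            · exact wt_sq_le _
        _ = _ := by
            have : wt 0 = 1 := by simp [wt]
            rw [wt3_insertCoord, this]; ring)
  rw [integral_add' (i3.const_mul a).integrableOn i2.integrableOn, integral_const_mul,
    ← partialHat_eq_half, integral_const_mul] at key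
  have b2 : ‖∫ x in {x : E3 | 0 < x 2}, e x * pd 2 f (joinPt x s)‖ ≤
      2 * C' * wt s * ∫ x, wt3 x := by
    calc _ ≤ ∫ x in {x : E3 | 0 < x 2}, 2 * C' * wt s * wt3 x := by
          refine norm_integral_le_of_norm_le (integrable_wt3.const_mul _).integrableOn
            (ae_of_all _ fun x => ?_)
          rw [norm_mul]
          have := (wt3_pos x).le
          calc _ ≤ 2 * (C' * (wt3 x ^ 2 * wt s ^ 2)) := by
                gcongr
                · exact ne _
                · exact h' _ _
            _ ≤ 2 * (C' * (wt3 x * wt s)) := by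
                gcongr
                · exact wt3_sq_le _
                · exact wt_sq_le _
            _ = _ := by ring
      _ ≤ ∫ x, 2 * C' * wt s * wt3 x := by
          refine setIntegral_le_integral (integrable_wt3.const_mul _) (ae_of_all _ fun x => ?_)
          have := (wt3_pos x).le
          simp only [Pi.zero_apply]
          positivity
      _ = _ := by rw [integral_const_mul]
  have na : ‖a * partialHat f k s‖ = 2 * Real.pi * (|k 2| * ‖partialHat f k s‖) := by
    rw [ha]
    simp [abs_of_pos Real.pi_pos]
    ring
  have h3 := (norm_add_le (a * partialHat f k s + ∫ x in {x : E3 | 0 < x 2},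
    e x * pd 2 f (joinPt x s)) (-∫ x in {x : E3 | 0 < x 2}, e x * pd 2 f (joinPt x s)))
  rw [norm_neg, add_neg_cancel_right, na] at h3
  have hpi : 1 ≤ 2 * Real.pi := by linarith [Real.pi_gt_three]
  have h4 : |k 2| * ‖partialHat f k s‖ ≤ 2 * Real.pi * (|k 2| * ‖partialHat f k s‖) :=
    le_mul_of_one_le_left (by positivity) hpi
  calc _ ≤ _ := h4.trans h3
    _ ≤ 2 * C * wt s * (∫ y : Fin 2 → ℝ, wt (y 0) * wt (y 1)) + 2 * C' * wt s * ∫ x, wt3 x :=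
      add_le_add key b2
    _ = _ := by ring

lemma norm_partialHat_le_third :
    ∃ C, 0 ≤ C ∧ ∀ k s, ‖partialHat f k s‖ ≤ C * (|k 2| * wt (k 2)) * wt s := by
  obtain ⟨C, hC, h⟩ := norm_partialHat_le_abs f
  obtain ⟨C', hC', h'⟩ := norm_mul_partialHat_le f
  refine ⟨C + C', by positivity, fun k s => ?_⟩
  have h1 := h k s
  have h2 := mul_le_mul_of_nonneg_left (h' k s) (abs_nonneg (k 2))
  have h3 : (1 + k 2 ^ 2) * ‖partialHat f k s‖ ≤ (C + C') * |k 2| * wt s := by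
    rw [← sq_abs (k 2)]
    nlinarith
  have e : (C + C') * (|k 2| * wt (k 2)) * wt s = ((C + C') * |k 2| * wt s) / (1 + k 2 ^ 2) := by
    rw [wt, wt]; ring
  rw [e, le_div_iff₀ (by positivity), mul_comm]
  exact h3

/-- The operator 1 - ∂ⱼ² multiplies the transform by 1 + (2πkⱼ)² ≥ 1 + kⱼ². For the tangential
directions this can be repeated at will, at the cost of replacing the Schwartz function. -/
lemma norm_partialHat_le_wt_mul (k : E3) (s : ℝ) {j : Fin 3} (hj : j ≠ 2) :
    ‖partialHat f k s‖ ≤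
      wt (k j) * ‖partialHat (f - pd j.castSucc (pd j.castSucc f)) k s‖ := by
  rw [partialHat_sub, partialHat_pd _ _ _ hj, partialHat_pd _ _ _ hj]
  have e : partialHat f k s - 2 * Real.pi * Complex.I * k j *
      (2 * Real.pi * Complex.I * k j * partialHat f k s) =
      ((1 + (2 * Real.pi * k j) ^ 2 : ℝ) : ℂ) * partialHat f k s := by
    push_cast
    linear_combination (-(2 * Real.pi * k j) ^ 2 * partialHat f k s) * Complex.I_sq
  rw [e, norm_mul, Complex.norm_real, Real.norm_of_nonneg (by positivity), ← mul_assoc]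
  refine le_mul_of_one_le_left (norm_nonneg _) ?_
  rw [wt, ← div_eq_inv_mul, le_div_iff₀ (by positivity), one_mul, mul_pow]
  have : 1 ≤ (2 * Real.pi) ^ 2 := by nlinarith [Real.pi_gt_three]
  nlinarith [mul_le_mul_of_nonneg_right this (sq_nonneg (k j))]

/-- The size of `partialHat` in the frequency variable. -/
def freqWt (k : E3) : ℝ := wt (k 0) ^ 2 * wt (k 1) ^ 2 * (|k 2| * wt (k 2))

lemma freqWt_nonneg (k : E3) : 0 ≤ freqWt k := by
  have := (wt_pos (k 0)).le
  have := (wt_pos (k 1)).le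
  have := (wt_pos (k 2)).le
  unfold freqWt; positivity

/-- Two applications of 1 - ∂ⱼ² in each of x₁ and x₂, followed by the bound in k₂. The squares of
the tangential weights leave room for the factor 1 + ‖k‖ needed later. -/
lemma norm_partialHat_le :
    ∃ C, 0 ≤ C ∧ ∀ k s, ‖partialHat f k s‖ ≤ C * freqWt k * wt s := by
  let D : Fin 3 → 𝓢(R4, ℂ) → 𝓢(R4, ℂ) := fun j f => f - pd j.castSucc (pd j.castSucc f)
  obtain ⟨C, hC, h⟩ := norm_partialHat_le_third (D 1 (D 1 (D 0 (D 0 f))))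
  refine ⟨C, hC, fun k s => ?_⟩
  have w0 := (wt_pos (k 0)).le
  have w1 := (wt_pos (k 1)).le
  calc ‖partialHat f k s‖ ≤ wt (k 0) * ‖partialHat (D 0 f) k s‖ :=
        norm_partialHat_le_wt_mul f k s (by decide)
    _ ≤ wt (k 0) * (wt (k 0) * ‖partialHat (D 0 (D 0 f)) k s‖) := by
        gcongr; exact norm_partialHat_le_wt_mul _ k s (by decide)
    _ ≤ wt (k 0) * (wt (k 0) * (wt (k 1) * ‖partialHat (D 1 (D 0 (D 0 f))) k s‖)) := by
        gcongr; exact norm_partialHat_le_wt_mul _ k s (by decide)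
    _ ≤ wt (k 0) * (wt (k 0) * (wt (k 1) * (wt (k 1) *
          ‖partialHat (D 1 (D 1 (D 0 (D 0 f)))) k s‖))) := by
        gcongr; exact norm_partialHat_le_wt_mul _ k s (by decide)
    _ ≤ wt (k 0) * (wt (k 0) * (wt (k 1) * (wt (k 1) * (C * (|k 2| * wt (k 2)) * wt s)))) := by
        gcongr; exact h k s
    _ = _ := by rw [freqWt]; ring

end Schwartz

end

/-! ### The solution on the Fourier side and its integrable majorant -/

noncomputable section

/-- `ζ` at the frequency `2πk`. -/
def zeta (k : E3) : ℝ := 2 * Real.pi * ‖k‖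

/-- The coefficient of the boundary term in the Green kernel. -/
def bdryCoef (k : E3) : ℝ :=
  (zeta k + 2 * Real.pi * k 1) / (2 * zeta k * (zeta k - 2 * Real.pi * k 1))

/-- The Fourier transform of the solution in the first three variables. -/
def uHat (f : R4 → ℂ) (k : E3) (t : ℝ) : ℂ := odeSol (partialHat f k) (zeta k) (bdryCoef k) t

/-- The derivative of `uHat` in `t`. -/
def uHatDeriv (f : R4 → ℂ) (k : E3) (t : ℝ) : ℂ :=
  odeSolDeriv (partialHat f k) (zeta k) (bdryCoef k) t

/-- Frequencies off the null set `{k₀ = 0} ∪ {k₂ = 0}`. -/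
def GoodFreq (k : E3) : Prop := k 0 ≠ 0 ∧ k 2 ≠ 0

lemma ae_coord_ne_zero {n : ℕ} (i : Fin n) : ∀ᵐ x : EuclideanSpace ℝ (Fin n), x i ≠ 0 := by
  have h := Measure.addHaar_submodule (volume : Measure (EuclideanSpace ℝ (Fin n)))
    (LinearMap.ker (EuclideanSpace.proj (𝕜 := ℝ) i : EuclideanSpace ℝ (Fin n) →L[ℝ] ℝ).toLinearMap)
    (by
      intro h
      have : (unitVec i : EuclideanSpace ℝ (Fin n)) ∈ (LinearMap.ker (EuclideanSpace.proj (𝕜 := ℝ) i :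
        EuclideanSpace ℝ (Fin n) →L[ℝ] ℝ).toLinearMap) := by rw [h]; trivial
      simp at this)
  rw [ae_iff]
  convert h using 2
  ext x; simp

lemma ae_goodFreq : ∀ᵐ k : E3, GoodFreq k := (ae_coord_ne_zero 0).and (ae_coord_ne_zero 2)

lemma norm_sq_E3 (k : E3) : ‖k‖ ^ 2 = k 0 ^ 2 + k 1 ^ 2 + k 2 ^ 2 := by
  rw [EuclideanSpace.norm_sq_eq, Fin.sum_univ_three]; simp

lemma GoodFreq.add_pos {k : E3} (hk : GoodFreq k) : 0 < k 0 ^ 2 + k 2 ^ 2 := by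
  have := sq_pos_of_ne_zero hk.1
  positivity

lemma GoodFreq.norm_pos {k : E3} (hk : GoodFreq k) : 0 < ‖k‖ := by
  rw [norm_pos_iff]; rintro rfl; exact hk.1 rfl

lemma GoodFreq.zeta_pos {k : E3} (hk : GoodFreq k) : 0 < zeta k := by
  have := hk.norm_pos
  unfold zeta; positivity

lemma GoodFreq.abs_lt_norm {k : E3} (hk : GoodFreq k) : |k 1| < ‖k‖ := by
  have := hk.add_pos
  refine abs_lt_of_sq_lt_sq ?_ (norm_nonneg _)
  rw [norm_sq_E3]; linarith

lemma GoodFreq.sub_pos {k : E3} (hk : GoodFreq k) : 0 < zeta k - 2 * Real.pi * k 1 := by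
  have h := (le_abs_self _).trans_lt hk.abs_lt_norm
  unfold zeta
  have := mul_lt_mul_of_pos_left h Real.two_pi_pos
  linarith

lemma GoodFreq.add_zeta_pos {k : E3} (hk : GoodFreq k) : 0 < zeta k + 2 * Real.pi * k 1 := by
  have h := (neg_le_abs _).trans_lt hk.abs_lt_norm
  unfold zeta
  have := mul_lt_mul_of_pos_left h Real.two_pi_pos
  linarith

/-- The small denominator is resolved by (ζ - ξ)(ζ + ξ) = 4π²(k₀² + k₂²), where ξ = 2πk₁ and 0 < ζ +
ξ ≤ 2ζ. -/
lemma GoodFreq.coef_le {k : E3} (hk : GoodFreq k) :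
    1 / zeta k + |bdryCoef k| ≤ zeta k / (k 0 ^ 2 + k 2 ^ 2) := by
  have hd := hk.add_pos
  have hz := hk.zeta_pos
  have h1 := hk.sub_pos
  have h2 := hk.add_zeta_pos
  have hpi : (9 : ℝ) ≤ Real.pi ^ 2 := by nlinarith [Real.pi_gt_three]
  have hprod : (zeta k - 2 * Real.pi * k 1) * (zeta k + 2 * Real.pi * k 1) =
      4 * Real.pi ^ 2 * (k 0 ^ 2 + k 2 ^ 2) := by
    unfold zeta
    linear_combination 4 * Real.pi ^ 2 * norm_sq_E3 k
  have hz2 : 4 * Real.pi ^ 2 * (k 0 ^ 2 + k 2 ^ 2) ≤ zeta k ^ 2 := by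
    unfold zeta
    rw [mul_pow, norm_sq_E3]
    nlinarith [mul_nonneg (sq_nonneg Real.pi) (sq_nonneg (k 1))]
  have hle : zeta k + 2 * Real.pi * k 1 ≤ 2 * zeta k := by linarith
  have b1 : 1 / zeta k ≤ zeta k / (k 0 ^ 2 + k 2 ^ 2) / 2 := by
    rw [div_div, div_le_div_iff₀ hz (by positivity)]
    nlinarith
  have b2 : |bdryCoef k| ≤ zeta k / (k 0 ^ 2 + k 2 ^ 2) / 2 := by
    unfold bdryCoef
    rw [abs_of_pos (by positivity), div_div, div_le_div_iff₀ (by positivity) (by positivity)]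
    have h3 : (zeta k + 2 * Real.pi * k 1) * (4 * Real.pi ^ 2 * (k 0 ^ 2 + k 2 ^ 2)) ≤
        (2 * zeta k) * ((zeta k - 2 * Real.pi * k 1) * (2 * zeta k)) := by
      rw [← hprod]
      calc _ ≤ (2 * zeta k) * ((zeta k - 2 * Real.pi * k 1) * (2 * zeta k)) := by gcongr
        _ = _ := by ring
    nlinarith [mul_pos h2 hd]
  linarith

/-- An integrable majorant on the frequency space. -/
def majorant (k : E3) : ℝ := freqWt k * (1 + ‖k‖) / (k 0 ^ 2 + k 2 ^ 2)

lemma majorant_nonneg (k : E3) : 0 ≤ majorant k := by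
  have := freqWt_nonneg k
  unfold majorant; positivity

lemma wt_eq (r : ℝ) : wt r = 1 / (1 + r ^ 2) := by rw [wt, one_div]

/-- The function is of order |r|^{-1/2} at the origin and |r|^{-3/2} at infinity. -/
lemma integrable_sqrt_weight : Integrable fun r : ℝ => (1 + |r|) * wt r / √|r| := by
  have h : IntegrableOn (fun r : ℝ => (1 + r) * wt r / √r) (Ioi 0) := by
    have hm : Measurable fun r : ℝ => (1 + r) * wt r / √r :=
      ((measurable_const.add measurable_id).mul continuous_wt.measurable).div
        Real.continuous_sqrt.measurable
    rw [← Ioc_union_Ioi_eq_Ioi zero_le_one]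
    refine IntegrableOn.union ?_ ?_
    · have := (intervalIntegral.intervalIntegrable_rpow' (a := 0) (b := 1)
        (by norm_num : (-1 : ℝ) < -(1/2)))
      rw [intervalIntegrable_iff_integrableOn_Ioc_of_le zero_le_one] at this
      refine Integrable.mono' (this.const_mul 2) hm.aestronglyMeasurable ?_
      refine (ae_restrict_iff' measurableSet_Ioc).2 (ae_of_all _ fun r hr => ?_)
      have h0 : 0 < r := hr.1
      have := wt_pos r
      rw [Real.norm_of_nonneg (by positivity), Real.rpow_neg h0.le, ← Real.sqrt_eq_rpow,
        div_eq_mul_inv]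
      gcongr
      nlinarith [wt_le_one r, hr.2]
    · have := integrableOn_Ioi_rpow_of_lt (by norm_num : (-(3/2) : ℝ) < -1) one_pos
      refine Integrable.mono' (this.const_mul 2) hm.aestronglyMeasurable ?_
      refine (ae_restrict_iff' measurableSet_Ioi).2 (ae_of_all _ fun r hr => ?_)
      have h1 : 1 < r := hr
      have h0 : 0 < r := by linarith
      have := wt_pos r
      have e : r ^ (-(3/2) : ℝ) = r⁻¹ * (√r)⁻¹ := by
        rw [show (-(3/2) : ℝ) = -1 + -(1/2) by norm_num, Real.rpow_add h0, Real.rpow_neg_one,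
          Real.rpow_neg h0.le, ← Real.sqrt_eq_rpow]
      rw [Real.norm_of_nonneg (by positivity), e, div_eq_mul_inv, ← mul_assoc]
      refine mul_le_mul_of_nonneg_right ?_ (by positivity)
      rw [wt_eq, mul_one_div, div_le_iff₀ (by positivity)]
      field_simp
      nlinarith
  have := integrable_comp_abs_of_integrableOn_Ioi h
  simpa using this

lemma measurable_freqWt : Measurable freqWt := by
  have := continuous_wt
  have h : Continuous freqWt := by unfold freqWt; fun_prop
  exact h.measurable

lemma measurable_majorant : Measurable majorant := by
  unfold majorant
  exact (measurable_freqWt.mul (by fun_prop)).div (by fun_prop)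

/-- The factor |k₂| coming from oddness tames the singularity: by the inequality of arithmetic and
geometric means, |k₂|/(k₀² + k₂²) ≤ 1/√(|k₀||k₂|). With 1 + ‖k‖ ≤ ∏(1 + |kⱼ|) the majorant is then
bounded by a product of integrable functions of one variable. -/
lemma integrable_majorant : Integrable majorant := by
  have i := (integrable_prod_coord integrable_sqrt_weight integrable_wt
    integrable_sqrt_weight).const_mul 2
  refine i.mono' measurable_majorant.aestronglyMeasurable ?_
  filter_upwards [ae_goodFreq] with k hk
  rw [Real.norm_of_nonneg (majorant_nonneg k)]
  have hd := hk.add_pos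
  have w0 := wt_pos (k 0)
  have w1 := wt_pos (k 1)
  have w2 := wt_pos (k 2)
  have a0 : 0 < |k 0| := abs_pos.2 hk.1
  have a2 : 0 < |k 2| := abs_pos.2 hk.2
  have s0 : 0 < √|k 0| := Real.sqrt_pos.2 a0
  have s2 : 0 < √|k 2| := Real.sqrt_pos.2 a2
  have n1 : 1 + ‖k‖ ≤ (1 + |k 0|) * (1 + |k 1|) * (1 + |k 2|) := by
    have h : ‖k‖ ≤ |k 0| + |k 1| + |k 2| := by
      refine le_of_sq_le_sq ?_ (by positivity)
      rw [norm_sq_E3, ← sq_abs (k 0), ← sq_abs (k 1), ← sq_abs (k 2)]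
      nlinarith [abs_nonneg (k 1), mul_nonneg a0.le (abs_nonneg (k 1)),
        mul_nonneg a0.le a2.le, mul_nonneg (abs_nonneg (k 1)) a2.le]
    nlinarith [abs_nonneg (k 1), mul_nonneg a0.le (abs_nonneg (k 1)),
        mul_nonneg a0.le a2.le, mul_nonneg (abs_nonneg (k 1)) a2.le,
        mul_nonneg (mul_nonneg a0.le (abs_nonneg (k 1))) a2.le]
  have d1 : √|k 0| * √|k 2| * |k 2| ≤ k 0 ^ 2 + k 2 ^ 2 := by
    rw [← Real.sqrt_mul a0.le]
    have h1 : √(|k 0| * |k 2|) ≤ (|k 0| + |k 2|) / 2 := by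
      rw [Real.sqrt_le_left (by positivity)]
      nlinarith [sq_nonneg (|k 0| - |k 2|)]
    rw [← sq_abs (k 0), ← sq_abs (k 2)]
    nlinarith [mul_le_mul_of_nonneg_right h1 a2.le, sq_nonneg (|k 0| - |k 2|)]
  have c1 : wt (k 1) * (1 + |k 1|) ≤ 2 := by
    nlinarith [abs_mul_wt_le_one (k 1), wt_le_one (k 1)]
  have hq : |k 2| / (k 0 ^ 2 + k 2 ^ 2) ≤ 1 / (√|k 0| * √|k 2|) := by
    rw [div_le_div_iff₀ hd (by positivity)]
    linarith
  calc majorant k = wt (k 0) ^ 2 * wt (k 1) ^ 2 * wt (k 2) * (1 + ‖k‖) *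
        (|k 2| / (k 0 ^ 2 + k 2 ^ 2)) := by rw [majorant, freqWt]; ring
    _ ≤ wt (k 0) ^ 2 * wt (k 1) ^ 2 * wt (k 2) * ((1 + |k 0|) * (1 + |k 1|) * (1 + |k 2|)) *
        (1 / (√|k 0| * √|k 2|)) := by gcongr
    _ = (wt (k 0) * wt (k 1) * wt (k 2) * (1 + |k 0|) * (1 + |k 2|) *
        (1 / (√|k 0| * √|k 2|))) * (wt (k 0) * (wt (k 1) * (1 + |k 1|))) := by ring
    _ ≤ (wt (k 0) * wt (k 1) * wt (k 2) * (1 + |k 0|) * (1 + |k 2|) *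
        (1 / (√|k 0| * √|k 2|))) * (1 * 2) := by
        gcongr
        exact wt_le_one _
    _ = 2 * ((1 + |k 0|) * wt (k 0) / √|k 0| * wt (k 1) * ((1 + |k 2|) * wt (k 2) / √|k 2|)) := by
        field_simp

section Schwartz

variable (f : 𝓢(R4, ℂ))

lemma partialHat_bound_wt (k : E3) : ∃ c, 0 ≤ c ∧ ∀ s, ‖partialHat f k s‖ ≤ c / (1 + s ^ 2) := by
  obtain ⟨C, hC, h⟩ := norm_partialHat_le f
  refine ⟨C * freqWt k, mul_nonneg hC (freqWt_nonneg k), fun s => (h k s).trans ?_⟩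
  rw [wt, div_eq_mul_inv]

/-- The solution of the equation carries an extra factor 1/ζ compared with its t-derivative, and
this factor pays for one power of ‖k‖. One derivative in any variable is therefore under control on
the Fourier side. -/
lemma uHat_bound : ∃ C, 0 ≤ C ∧ ∀ k, GoodFreq k → ∀ t, 0 ≤ t →
    (1 + ‖k‖) * ‖uHat f k t‖ ≤ C * majorant k ∧ ‖uHatDeriv f k t‖ ≤ C * majorant k := by
  obtain ⟨C, hC, h⟩ := norm_partialHat_le f
  refine ⟨2 * Real.pi * C, by positivity, fun k hk t ht => ?_⟩
  have hz := hk.zeta_pos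
  have hd := hk.add_pos
  have hw := freqWt_nonneg k
  have hb : ∀ s, 0 < s → ‖partialHat f k s‖ ≤ C * freqWt k := fun s _ =>
    (h k s).trans (mul_le_of_le_one_right (mul_nonneg hC hw) (wt_le_one s))
  have b1 := norm_odeSol_le (m := bdryCoef k) hz ht (mul_nonneg hC hw) hb
  have b2 := norm_odeSolDeriv_le (m := bdryCoef k) hz ht (mul_nonneg hC hw) hb
  have hc := hk.coef_le
  constructor
  · calc (1 + ‖k‖) * ‖uHat f k t‖
        ≤ (1 + ‖k‖) * (C * freqWt k * (zeta k / (k 0 ^ 2 + k 2 ^ 2)) / zeta k) := by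
          gcongr
          refine b1.trans ?_
          gcongr
      _ = 1 * (C * majorant k) := by rw [majorant]; field_simp
      _ ≤ (2 * Real.pi) * (C * majorant k) := by
          have := majorant_nonneg k
          gcongr
          linarith [Real.pi_gt_three]
      _ = _ := by ring
  · calc ‖uHatDeriv f k t‖ ≤ C * freqWt k * (zeta k / (k 0 ^ 2 + k 2 ^ 2)) := by
          refine b2.trans ?_
          gcongr
      _ = (2 * Real.pi * C) * (freqWt k * ‖k‖ / (k 0 ^ 2 + k 2 ^ 2)) := by
          rw [zeta]; ring
      _ ≤ _ := by
          rw [majorant]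
          gcongr
          linarith

lemma measurable_zeta : Measurable zeta := by unfold zeta; fun_prop

lemma measurable_bdryCoef : Measurable bdryCoef := by
  have := measurable_zeta
  unfold bdryCoef; fun_prop

lemma measurable_uHat : Measurable fun p : E3 × ℝ => uHat f p.1 p.2 := by
  refine StronglyMeasurable.measurable ?_
  unfold uHat odeSol
  refine StronglyMeasurable.integral_prod_right (f := fun (p : E3 × ℝ) (s : ℝ) =>
    (greenKernel (zeta p.1) (bdryCoef p.1) p.2 s : ℂ) * partialHat f p.1 s) ?_
  refine Measurable.stronglyMeasurable (Measurable.mul ?_ ?_)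
  · exact Complex.measurable_ofReal.comp (measurable_greenKernel.comp
      ((measurable_zeta.comp (measurable_fst.comp measurable_fst)).prodMk
        ((measurable_bdryCoef.comp (measurable_fst.comp measurable_fst)).prodMk
          ((measurable_snd.comp measurable_fst).prodMk measurable_snd))))
  · exact (continuous_partialHat f).measurable.comp
      ((measurable_fst.comp measurable_fst).prodMk measurable_snd)

lemma measurable_uHatDeriv : Measurable fun p : E3 × ℝ => uHatDeriv f p.1 p.2 := by
  refine StronglyMeasurable.measurable ?_
  unfold uHatDeriv odeSolDeriv
  refine StronglyMeasurable.integral_prod_right (f := fun (p : E3 × ℝ) (s : ℝ) =>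
    (greenKernelDeriv (zeta p.1) (bdryCoef p.1) p.2 s : ℂ) * partialHat f p.1 s) ?_
  refine Measurable.stronglyMeasurable (Measurable.mul ?_ ?_)
  · exact Complex.measurable_ofReal.comp (measurable_greenKernelDeriv.comp
      ((measurable_zeta.comp (measurable_fst.comp measurable_fst)).prodMk
        ((measurable_bdryCoef.comp (measurable_fst.comp measurable_fst)).prodMk
          ((measurable_snd.comp measurable_fst).prodMk measurable_snd))))
  · exact (continuous_partialHat f).measurable.comp
      ((measurable_fst.comp measurable_fst).prodMk measurable_snd)

lemma measurable_uHat_left (t : ℝ) : Measurable fun k => uHat f k t :=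
  Measurable.comp (g := fun p : E3 × ℝ => uHat f p.1 p.2) (f := fun k : E3 => (k, t))
    (measurable_uHat f) (by fun_prop)

lemma measurable_uHatDeriv_left (t : ℝ) : Measurable fun k => uHatDeriv f k t :=
  Measurable.comp (g := fun p : E3 × ℝ => uHatDeriv f p.1 p.2) (f := fun k : E3 => (k, t))
    (measurable_uHatDeriv f) (by fun_prop)

variable {f}

lemma partialHat_bdd (k : E3) : ∃ c, ∀ s, 0 < s → ‖partialHat f k s‖ ≤ c := by
  obtain ⟨c, hc, h⟩ := partialHat_bound_wt f k
  exact ⟨c, fun s _ => (h s).trans (div_le_self hc (by nlinarith [sq_nonneg s]))⟩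

lemma hasDerivAt_uHat {k : E3} (hk : GoodFreq k) {t : ℝ} (ht : 0 < t) :
    HasDerivAt (fun t => uHat f k t) (uHatDeriv f k t) t := by
  obtain ⟨c, h⟩ := partialHat_bdd (f := f) k
  exact hasDerivAt_odeSol hk.zeta_pos (continuous_partialHat_right f k) h ht

lemma hasDerivAt_uHatDeriv {k : E3} (hk : GoodFreq k) {t : ℝ} (ht : 0 < t) :
    HasDerivAt (fun t => uHatDeriv f k t) (zeta k ^ 2 * uHat f k t + partialHat f k t) t := by
  obtain ⟨c, h⟩ := partialHat_bdd (f := f) k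
  exact hasDerivAt_odeSolDeriv hk.zeta_pos (continuous_partialHat_right f k) h ht

lemma continuousOn_uHat {k : E3} (hk : GoodFreq k) :
    ContinuousOn (fun t => uHat f k t) (Ici 0) := by
  obtain ⟨c, h⟩ := partialHat_bdd (f := f) k
  exact continuousOn_odeSol hk.zeta_pos (continuous_partialHat_right f k) h

lemma continuousOn_uHatDeriv {k : E3} (hk : GoodFreq k) :
    ContinuousOn (fun t => uHatDeriv f k t) (Ici 0) := by
  obtain ⟨c, h⟩ := partialHat_bdd (f := f) k
  exact continuousOn_odeSolDeriv hk.zeta_pos (continuous_partialHat_right f k) h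

lemma uHat_pd (k : E3) (t : ℝ) {j : Fin 3} (hj : j ≠ 2) :
    uHat (pd j.castSucc f) k t = 2 * Real.pi * Complex.I * k j * uHat f k t := by
  unfold uHat odeSol
  rw [← integral_const_mul]
  congr 1; ext s
  rw [partialHat_pd f k s hj]; ring

end Schwartz

lemma uHat_refl3 (f : R4 → ℂ) (k : E3) (t : ℝ) : uHat f (refl3 k) t = -uHat f k t := by
  have hz : zeta (refl3 k) = zeta k := by simp [zeta]
  have hm : bdryCoef (refl3 k) = bdryCoef k := by simp [bdryCoef, hz]
  unfold uHat odeSol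
  rw [hz, hm, ← integral_neg]
  congr 1; ext s
  rw [partialHat_refl3]; ring

end

/-! ### Dilations on the Fourier side -/

noncomputable section

/-- Precomposition with the dilation by `exp μ`. -/
def dilate (μ : ℝ) (f : R4 → ℂ) (z : R4) : ℂ := f (Real.exp μ • z)

lemma smul_joinPt (a : ℝ) (x : E3) (s : ℝ) : a • joinPt x s = joinPt (a • x) (a * s) := by
  ext i; fin_cases i <;> rfl

lemma absThird_smul {a : ℝ} (ha : 0 < a) (x : E3) : absThird (a • x) = a • absThird x := by
  ext i; fin_cases i <;> simp [abs_mul, abs_of_pos ha]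

lemma oddRefl_dilate (μ : ℝ) (f : R4 → ℂ) (x : E3) (s : ℝ) :
    oddRefl (dilate μ f) x s = oddRefl f (Real.exp μ • x) (Real.exp μ * s) := by
  have h : Real.sign (Real.exp μ * x 2) = Real.sign (x 2) := by
    rcases lt_trichotomy (x 2) 0 with h | h | h
    · rw [Real.sign_of_neg h, Real.sign_of_neg (mul_neg_of_pos_of_neg (Real.exp_pos μ) h)]
    · rw [h, mul_zero]
    · rw [Real.sign_of_pos h, Real.sign_of_pos (mul_pos (Real.exp_pos μ) h)]
  unfold oddRefl dilate
  rw [smul_joinPt, absThird_smul (Real.exp_pos μ)]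
  simp [h]

lemma partialHat_dilate (μ : ℝ) (f : R4 → ℂ) (k : E3) (s : ℝ) :
    partialHat (dilate μ f) k s =
      Real.exp (-(3 * μ)) * partialHat f (Real.exp (-μ) • k) (Real.exp μ * s) := by
  have h : ∀ x : E3, ch (-k) x * oddRefl (dilate μ f) x s =
      (fun y => ch (-(Real.exp (-μ) • k)) y * oddRefl f y (Real.exp μ * s)) (Real.exp μ • x) := by
    intro x
    simp only [oddRefl_dilate]
    rw [← smul_neg, ch_smul_left, smul_smul, ← Real.exp_add]
    simp
  unfold partialHat
  simp only [h]
  rw [Measure.integral_comp_smul volume (fun y => ch (-(Real.exp (-μ) • k)) y *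
    oddRefl f y (Real.exp μ * s))]
  simp only [finrank_euclideanSpace, Fintype.card_fin, Complex.real_smul]
  congr 2
  rw [abs_of_pos (by positivity), ← Real.exp_nat_mul, ← Real.exp_neg]
  norm_num

lemma zeta_smul {a : ℝ} (ha : 0 < a) (k : E3) : zeta (a • k) = a * zeta k := by
  simp only [zeta, norm_smul, Real.norm_of_nonneg ha.le]; ring

/-- Degree -1, the same as 1/ζ: the boundary condition has no length scale, and this makes the
problem dilation covariant. -/
lemma bdryCoef_smul {a : ℝ} (ha : 0 < a) (k : E3) : bdryCoef (a • k) = a⁻¹ * bdryCoef k := by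
  unfold bdryCoef
  rw [zeta_smul ha, PiLp.smul_apply, smul_eq_mul]
  rw [show a * zeta k + 2 * Real.pi * (a * k 1) = a * (zeta k + 2 * Real.pi * k 1) by ring,
    show 2 * (a * zeta k) * (a * zeta k - 2 * Real.pi * (a * k 1)) =
      a * (a * (2 * zeta k * (zeta k - 2 * Real.pi * k 1))) by ring,
    mul_div_mul_left _ _ ha.ne', mul_comm a, ← div_div, div_eq_inv_mul _ a]

lemma greenKernel_scale {a : ℝ} (ha : 0 < a) (k : E3) (t s : ℝ) :
    greenKernel (zeta k) (bdryCoef k) t s =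
      a⁻¹ * greenKernel (zeta (a • k)) (bdryCoef (a • k)) (a⁻¹ * t) (a⁻¹ * s) * a ^ 2 := by
  unfold greenKernel
  rw [zeta_smul ha, bdryCoef_smul ha, ← mul_sub, abs_mul, abs_of_pos (inv_pos.2 ha), ← mul_add]
  have e : ∀ r : ℝ, a * zeta k * (a⁻¹ * r) = zeta k * r := fun r => by field_simp
  rw [e, e]
  -- Zero frequency is not excluded; there the quotient by 2ζ is 0 by convention on both sides and
  -- only the boundary term remains.
  rcases eq_or_ne (zeta k) 0 with hz | hz
  · simp [hz]; field_simp
  · field_simp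

/-- The exponent is 5 = 3 + 1 + 1: the Jacobian of the transform in three variables, the degree -1
of the kernel in ζ, and the change of variable in s. -/
lemma uHat_dilate (μ : ℝ) (f : R4 → ℂ) (k : E3) (t : ℝ) :
    uHat (dilate μ f) k t =
      Real.exp (-(5 * μ)) * uHat f (Real.exp (-μ) • k) (Real.exp μ * t) := by
  have hpos := Real.exp_pos (-μ)
  have hinv : (Real.exp (-μ))⁻¹ = Real.exp μ := by rw [Real.exp_neg, inv_inv]
  have h : ∀ s : ℝ, (greenKernel (zeta k) (bdryCoef k) t s : ℂ) * partialHat (dilate μ f) k s =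
      (Real.exp (-(4 * μ)) : ℂ) * (fun r => (greenKernel (zeta (Real.exp (-μ) • k))
        (bdryCoef (Real.exp (-μ) • k)) (Real.exp μ * t) r : ℂ) *
          partialHat f (Real.exp (-μ) • k) r) (Real.exp μ * s) := by
    intro s
    rw [greenKernel_scale hpos, partialHat_dilate, hinv]
    have e : Real.exp (-(4 * μ)) = Real.exp μ * Real.exp (-μ) ^ 2 * Real.exp (-(3 * μ)) := by
      rw [← Real.exp_nat_mul, ← Real.exp_add, ← Real.exp_add]; congr 1; push_cast; ring
    rw [e]
    push_cast
    ring
  unfold uHat odeSol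
  simp only [h]
  rw [integral_const_mul, integral_comp_mul_left_Ioi (fun r => (greenKernel
    (zeta (Real.exp (-μ) • k)) (bdryCoef (Real.exp (-μ) • k)) (Real.exp μ * t) r : ℂ) *
      partialHat f (Real.exp (-μ) • k) r) 0 (Real.exp_pos μ), mul_zero, Complex.real_smul,
    ← mul_assoc]
  congr 1
  rw [← Complex.ofReal_mul, ← Real.exp_neg, ← Real.exp_add]
  congr 2; ring

section Schwartz

variable (f : 𝓢(R4, ℂ))

lemma hasDerivAt_oddRefl_dilate (x : E3) (s μ : ℝ) :
    HasDerivAt (fun μ => oddRefl (dilate μ f) x s) (oddRefl (dilate μ (dil f)) x s) μ := by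
  unfold oddRefl dilate
  exact (hasDerivAt_dilation f _ μ).const_mul _

/-- For |μ| ≤ 1 one has exp(-μ) ≤ e ≤ 3, whence the 9. Uniformity in μ provides the dominating
functions for differentiation in the dilation parameter. -/
lemma wt_exp_mul_le {μ : ℝ} (hμ : |μ| ≤ 1) (r : ℝ) : wt (Real.exp μ * r) ≤ 9 * wt r := by
  have h1 : 1 ≤ 9 * Real.exp μ ^ 2 := by
    have h2 : Real.exp (-1) ≤ Real.exp μ := Real.exp_le_exp.2 (abs_le.1 hμ).1
    have h3 : Real.exp 1 ≤ 3 := by linarith [Real.exp_one_lt_d9]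
    have h4 : Real.exp (-1) * Real.exp 1 = 1 := by rw [← Real.exp_add]; simp
    have h5 : 1 ≤ 3 * Real.exp μ := by nlinarith [Real.exp_pos 1, Real.exp_pos (-1)]
    nlinarith
  rw [wt_eq, wt_eq, mul_one_div, div_le_div_iff₀ (by positivity) (by positivity)]
  nlinarith [sq_nonneg r]

lemma wt3_exp_smul_le {μ : ℝ} (hμ : |μ| ≤ 1) (x : E3) :
    wt3 (Real.exp μ • x) ≤ 9 ^ 3 * wt3 x := by
  simp only [wt3, PiLp.smul_apply, smul_eq_mul]
  have w := fun i => (wt_pos (x i)).le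
  have w' := fun i => (wt_pos (Real.exp μ * x i)).le
  calc _ ≤ (9 * wt (x 0)) * (9 * wt (x 1)) * (9 * wt (x 2)) := by
        have := w 0; have := w 1; have := w 2
        have := w' 0; have := w' 1; have := w' 2
        gcongr <;> exact wt_exp_mul_le hμ _
    _ = _ := by ring

lemma oddRefl_dilate_bound : ∃ C, 0 ≤ C ∧ ∀ μ : ℝ, |μ| ≤ 1 → ∀ x s,
    ‖oddRefl (dilate μ f) x s‖ ≤ C * (wt3 x * wt s) := by
  obtain ⟨C, hC, h⟩ := oddRefl_bound' f
  refine ⟨C * 9 ^ 4, by positivity, fun μ hμ x s => ?_⟩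
  rw [oddRefl_dilate]
  have := (wt3_pos x).le
  have := (wt_pos s).le
  have := (wt_pos (Real.exp μ * s)).le
  calc _ ≤ C * ((9 ^ 3 * wt3 x) * (9 * wt s)) := by
        refine (h _ _).trans ?_
        gcongr
        · exact wt3_exp_smul_le hμ x
        · exact wt_exp_mul_le hμ s
    _ = _ := by ring

lemma measurable_oddRefl_dilate (μ s : ℝ) :
    Measurable fun x : E3 => oddRefl (dilate μ f) x s := by
  simp only [oddRefl_dilate]
  exact (measurable_oddRefl_left f _).comp (by fun_prop)

lemma integrable_oddRefl_dilate {μ : ℝ} (hμ : |μ| ≤ 1) (s : ℝ) :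
    Integrable fun x => oddRefl (dilate μ f) x s := by
  obtain ⟨C, hC, h⟩ := oddRefl_dilate_bound f
  refine Integrable.mono' ((integrable_wt3.mul_const (wt s)).const_mul C)
    (measurable_oddRefl_dilate f μ s).aestronglyMeasurable (ae_of_all _ fun x => h μ hμ x s)

lemma partialHat_dilate_bound : ∃ C, 0 ≤ C ∧ ∀ μ : ℝ, |μ| ≤ 1 → ∀ k s,
    ‖partialHat (dilate μ f) k s‖ ≤ C * wt s := by
  obtain ⟨C, hC, h⟩ := oddRefl_dilate_bound f
  have hI : 0 ≤ ∫ x, wt3 x := integral_nonneg fun x => (wt3_pos x).le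
  refine ⟨C * ∫ x, wt3 x, by positivity, fun μ hμ k s => ?_⟩
  calc _ ≤ ∫ x, C * wt s * wt3 x := by
        refine norm_integral_le_of_norm_le (integrable_wt3.const_mul _) (ae_of_all _ fun x => ?_)
        rw [norm_mul, norm_ch, one_mul]
        exact (h μ hμ x s).trans (le_of_eq (by ring))
    _ = _ := by rw [integral_const_mul]; ring

lemma hasDerivAt_partialHat_dilate (k : E3) (s : ℝ) {μ : ℝ} (hμ : |μ| < 1) :
    HasDerivAt (fun μ => partialHat (dilate μ f) k s) (partialHat (dilate μ (dil f)) k s) μ := by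
  obtain ⟨C, hC, h⟩ := oddRefl_dilate_bound (dil f)
  have hnb : {μ : ℝ | |μ| < 1} ∈ 𝓝 μ := (isOpen_lt continuous_abs continuous_const).mem_nhds hμ
  refine (hasDerivAt_integral_of_dominated_loc_of_deriv_le (s := {μ : ℝ | |μ| < 1})
    (F := fun μ x => ch (-k) x * oddRefl (dilate μ f) x s)
    (F' := fun μ x => ch (-k) x * oddRefl (dilate μ (dil f)) x s)
    (bound := fun x => C * (wt3 x * wt s)) hnb (Eventually.of_forall fun ν => ?_)
    (integrable_ch_mul (integrable_oddRefl_dilate f hμ.le s) _)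
    ?_ (ae_of_all _ fun x ν hν => ?_)
    ((integrable_wt3.mul_const _).const_mul C) (ae_of_all _ fun x ν hν => ?_)).2
  · exact (Continuous.aestronglyMeasurable (by fun_prop)).mul
      (measurable_oddRefl_dilate f ν s).aestronglyMeasurable
  · exact (Continuous.aestronglyMeasurable (by fun_prop)).mul
      (measurable_oddRefl_dilate (dil f) μ s).aestronglyMeasurable
  · rw [norm_mul, norm_ch, one_mul]
    exact h ν (le_of_lt hν) x s
  · exact (hasDerivAt_oddRefl_dilate f x s ν).const_mul _

lemma continuous_partialHat_dilate (μ : ℝ) (k : E3) :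
    Continuous fun s => partialHat (dilate μ f) k s := by
  simp only [partialHat_dilate]
  exact continuous_const.mul ((continuous_partialHat_right f _).comp (by fun_prop))

lemma measurable_greenKernel_right (ζ m t : ℝ) : Measurable fun s => greenKernel ζ m t s := by
  unfold greenKernel; fun_prop

lemma hasDerivAt_uHat_dilate {k : E3} (hk : GoodFreq k) {t : ℝ} (ht : 0 ≤ t) {μ : ℝ}
    (hμ : |μ| < 1) :
    HasDerivAt (fun μ => uHat (dilate μ f) k t) (uHat (dilate μ (dil f)) k t) μ := by
  obtain ⟨C0, hC0, h0⟩ := partialHat_dilate_bound f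
  obtain ⟨C, hC, h⟩ := partialHat_dilate_bound (dil f)
  have hz := hk.zeta_pos
  have hnb : {μ : ℝ | |μ| < 1} ∈ 𝓝 μ := (isOpen_lt continuous_abs continuous_const).mem_nhds hμ
  set K : ℝ := 1 / (2 * zeta k) + |bdryCoef k| with hK
  have hK0 : 0 ≤ K := by positivity
  have hker : ∀ s ∈ Ioi (0 : ℝ), ‖(greenKernel (zeta k) (bdryCoef k) t s : ℂ)‖ ≤ K := by
    intro s hs
    rw [Complex.norm_real, Real.norm_eq_abs]
    refine (abs_greenKernel_le' hz ht (le_of_lt hs)).trans (mul_le_of_le_one_right hK0 ?_)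
    exact Real.exp_le_one_iff.2 (by have := abs_nonneg (t - s); nlinarith)
  have hmeas : ∀ (g : 𝓢(R4, ℂ)) (ν : ℝ), AEStronglyMeasurable (fun s =>
      (greenKernel (zeta k) (bdryCoef k) t s : ℂ) * partialHat (dilate ν g) k s)
      (volume.restrict (Ioi 0)) := fun g ν =>
    ((Complex.measurable_ofReal.comp (measurable_greenKernel_right _ _ _)).mul
      (continuous_partialHat_dilate g ν k).measurable).aestronglyMeasurable
  refine (hasDerivAt_integral_of_dominated_loc_of_deriv_le (s := {μ : ℝ | |μ| < 1})
    (μ := volume.restrict (Ioi 0))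
    (F := fun μ s => (greenKernel (zeta k) (bdryCoef k) t s : ℂ) * partialHat (dilate μ f) k s)
    (F' := fun μ s =>
      (greenKernel (zeta k) (bdryCoef k) t s : ℂ) * partialHat (dilate μ (dil f)) k s)
    (bound := fun s => K * (C * wt s)) hnb (Eventually.of_forall fun ν => hmeas f ν)
    ?_ (hmeas (dil f) μ) ((ae_restrict_iff' measurableSet_Ioi).2 (ae_of_all _ fun s hs ν hν => ?_))
    ((integrable_wt.const_mul C).const_mul K).integrableOn (ae_of_all _ fun s ν hν => ?_)).2
  · refine Integrable.mono' ((integrable_wt.const_mul C0).const_mul K).integrableOn (hmeas f μ)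
      ((ae_restrict_iff' measurableSet_Ioi).2 (ae_of_all _ fun s hs => ?_))
    rw [norm_mul]
    have := (wt_pos s).le
    gcongr
    · exact hker s hs
    · exact h0 μ hμ.le k s
  · rw [norm_mul]
    have := (wt_pos s).le
    gcongr
    · exact hker s hs
    · exact h ν (le_of_lt hν) k s
  · exact (hasDerivAt_partialHat_dilate f k s hν).const_mul _

end Schwartz

end

/-! ### The solution in physical space: C¹ up to the boundary, Euler identity -/

noncomputable section

/-- The solution, as a function of `x ∈ ℝ³` and `t ≥ 0`. -/
def sol (f : R4 → ℂ) (x : E3) (t : ℝ) : ℂ := ∫ k : E3, ch k x * uHat f k t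

/-- The derivative of `sol` in `y₁`. -/
def solY (f : R4 → ℂ) (x : E3) (t : ℝ) : ℂ :=
  ∫ k : E3, ch k x * (2 * Real.pi * Complex.I * k 2 * uHat f k t)

/-- The derivative of `sol` in `t`. -/
def solT (f : R4 → ℂ) (x : E3) (t : ℝ) : ℂ := ∫ k : E3, ch k x * uHatDeriv f k t

lemma continuousOn_integral_ch {V : E3 → ℝ → ℂ} {B : E3 → ℝ} (hB : Integrable B)
    (hm : ∀ t, Measurable fun k => V k t)
    (hV : ∀ k, GoodFreq k → ∀ t, 0 ≤ t → ‖V k t‖ ≤ B k)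
    (hc : ∀ k, GoodFreq k → ContinuousOn (fun t => V k t) (Ici 0)) :
    ContinuousOn (fun p : E3 × ℝ => ∫ k : E3, ch k p.1 * V k p.2) {p | 0 ≤ p.2} := by
  refine continuousOn_of_dominated (bound := B) (fun p hp => ?_) (fun p hp => ?_) hB ?_
  · exact (Continuous.aestronglyMeasurable (by fun_prop)).mul (hm p.2).aestronglyMeasurable
  · filter_upwards [ae_goodFreq] with k hk
    rw [norm_mul, norm_ch, one_mul]
    exact hV k hk _ hp
  · filter_upwards [ae_goodFreq] with k hk
    refine ContinuousOn.mul (Continuous.continuousOn (by fun_prop)) ?_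
    exact (hc k hk).comp continuous_snd.continuousOn fun p hp => hp

lemma abs_apply_le_norm (k : E3) (i : Fin 3) : |k i| ≤ ‖k‖ := PiLp.norm_apply_le k i

lemma norm_two_pi_I_mul (r : ℝ) : ‖(2 * Real.pi * Complex.I * r : ℂ)‖ = 2 * Real.pi * |r| := by
  simp [abs_of_pos Real.pi_pos]

lemma norm_coord_mul_le (k : E3) (i : Fin 3) {u : ℂ} {b c : ℝ} (h : ‖k‖ * ‖u‖ ≤ c * b) :
    2 * Real.pi * |k i| * ‖u‖ ≤ 2 * Real.pi * c * b := by
  have h1 := mul_le_mul_of_nonneg_right (abs_apply_le_norm k i) (norm_nonneg u)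
  have := Real.pi_pos
  nlinarith [h1.trans h]

section Schwartz

variable (f : 𝓢(R4, ℂ))

lemma uHat_bounds : ∃ C, 0 ≤ C ∧ ∀ k, GoodFreq k → ∀ t, 0 ≤ t →
    ‖uHat f k t‖ ≤ C * majorant k ∧ ‖k‖ * ‖uHat f k t‖ ≤ C * majorant k ∧
      ‖uHatDeriv f k t‖ ≤ C * majorant k := by
  obtain ⟨C, hC, h⟩ := uHat_bound f
  refine ⟨C, hC, fun k hk t ht => ?_⟩
  obtain ⟨h1, h2⟩ := h k hk t ht
  have a := norm_nonneg k
  have b := norm_nonneg (uHat f k t)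
  refine ⟨?_, ?_, h2⟩ <;> nlinarith [mul_nonneg a b]

lemma integrable_ch_mul_uHat (x : E3) {t : ℝ} (ht : 0 ≤ t) :
    Integrable fun k => ch k x * uHat f k t := by
  obtain ⟨C, hC, h⟩ := uHat_bounds f
  refine (integrable_majorant.const_mul C).mono' ((Continuous.aestronglyMeasurable
    (by fun_prop)).mul (measurable_uHat_left f t).aestronglyMeasurable) ?_
  filter_upwards [ae_goodFreq] with k hk
  rw [norm_mul, norm_ch, one_mul]
  exact (h k hk t ht).1

lemma integrable_ch_mul_coord_uHat (x : E3) {t : ℝ} (ht : 0 ≤ t) (j : Fin 3) :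
    Integrable fun k : E3 => ch k x * (2 * Real.pi * Complex.I * k j * uHat f k t) := by
  obtain ⟨C, hC, h⟩ := uHat_bounds f
  refine (integrable_majorant.const_mul (2 * Real.pi * C)).mono' ((Continuous.aestronglyMeasurable
    (by fun_prop)).mul (Measurable.aestronglyMeasurable
      (Measurable.mul (by fun_prop) (measurable_uHat_left f t)))) ?_
  filter_upwards [ae_goodFreq] with k hk
  rw [norm_mul, norm_ch, one_mul, norm_mul, norm_two_pi_I_mul]
  exact norm_coord_mul_le k j ((h k hk t ht).2.1)

lemma integrable_ch_mul_uHatDeriv (x : E3) {t : ℝ} (ht : 0 ≤ t) :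
    Integrable fun k => ch k x * uHatDeriv f k t := by
  obtain ⟨C, hC, h⟩ := uHat_bounds f
  refine (integrable_majorant.const_mul C).mono' ((Continuous.aestronglyMeasurable
    (by fun_prop)).mul (measurable_uHatDeriv_left f t).aestronglyMeasurable) ?_
  filter_upwards [ae_goodFreq] with k hk
  rw [norm_mul, norm_ch, one_mul]
  exact (h k hk t ht).2.2

lemma continuousOn_sol : ContinuousOn (fun p : E3 × ℝ => sol f p.1 p.2) {p | 0 ≤ p.2} := by
  obtain ⟨C, hC, h⟩ := uHat_bounds f
  exact continuousOn_integral_ch (integrable_majorant.const_mul C) (measurable_uHat_left f)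
    (fun k hk t ht => (h k hk t ht).1) (fun k hk => continuousOn_uHat hk)

lemma continuousOn_solT : ContinuousOn (fun p : E3 × ℝ => solT f p.1 p.2) {p | 0 ≤ p.2} := by
  obtain ⟨C, hC, h⟩ := uHat_bounds f
  exact continuousOn_integral_ch (integrable_majorant.const_mul C) (measurable_uHatDeriv_left f)
    (fun k hk t ht => (h k hk t ht).2.2) (fun k hk => continuousOn_uHatDeriv hk)

lemma continuousOn_solY : ContinuousOn (fun p : E3 × ℝ => solY f p.1 p.2) {p | 0 ≤ p.2} := by
  obtain ⟨C, hC, h⟩ := uHat_bounds f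
  refine continuousOn_integral_ch (V := fun k t => 2 * Real.pi * Complex.I * k 2 * uHat f k t)
    (integrable_majorant.const_mul (2 * Real.pi * C))
    (fun t => Measurable.mul (by fun_prop) (measurable_uHat_left f t))
    (fun k hk t ht => ?_) (fun k hk => continuousOn_const.mul (continuousOn_uHat hk))
  rw [norm_mul, norm_two_pi_I_mul]
  exact norm_coord_mul_le k 2 ((h k hk t ht).2.1)

variable {f}

lemma sol_pd (x : E3) (t : ℝ) {j : Fin 3} (hj : j ≠ 2) :
    sol (pd j.castSucc f) x t =
      ∫ k : E3, ch k x * (2 * Real.pi * Complex.I * k j * uHat f k t) := by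
  unfold sol
  simp only [uHat_pd _ _ hj]

lemma hasDerivAt_ch_curve (k : E3) {x : ℝ → E3} {x' : E3} {τ : ℝ} (hx : HasDerivAt x x' τ) :
    HasDerivAt (fun τ => ch k (x τ)) (2 * Real.pi * Complex.I * (inner ℝ x' k : ℝ) * ch k (x τ))
      τ := by
  have h1 : HasDerivAt (fun τ => (inner ℝ (x τ) k : ℝ)) (inner ℝ x' k) τ := by
    simpa using hx.inner ℝ (hasDerivAt_const τ k)
  have := (Real.hasDerivAt_fourierChar (inner ℝ (x τ) k)).scomp τ h1
  refine HasDerivAt.congr_deriv (f := fun τ => ch k (x τ)) this ?_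
  rw [Complex.real_smul, ch]
  ring

/-- Differentiation of `sol` along a curve in `t > 0`. -/
lemma hasDerivAt_sol_curve {x x' : ℝ → E3} {s s' : ℝ → ℝ} {τ : ℝ}
    (hx : ∀ τ, HasDerivAt x (x' τ) τ) (hs : ∀ τ, HasDerivAt s (s' τ) τ)
    (cx : Continuous x') (cs : Continuous s') (hpos : 0 < s τ) :
    HasDerivAt (fun τ => sol f (x τ) (s τ))
      (x' τ 0 * sol (pd 0 f) (x τ) (s τ) + x' τ 1 * sol (pd 1 f) (x τ) (s τ) +
        x' τ 2 * solY f (x τ) (s τ) + s' τ * solT f (x τ) (s τ)) τ := by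
  obtain ⟨C, hC, h⟩ := uHat_bounds f
  have hs0 : Continuous s := continuous_iff_continuousAt.2 fun τ => (hs τ).continuousAt
  set M : ℝ := ‖x' τ‖ + 1
  set N : ℝ := |s' τ| + 1
  -- Near τ the curve stays in t > 0 with bounded velocity, so one multiple of `majorant` dominates
  -- all the derivatives of the integrand.
  set S : Set ℝ := {r | 0 < s r ∧ ‖x' r‖ < M ∧ |s' r| < N}
  have hS : S ∈ 𝓝 τ := by
    refine IsOpen.mem_nhds ?_ ⟨hpos, by simp [M], by simp [N]⟩
    exact (isOpen_lt continuous_const hs0).inter ((isOpen_lt cx.norm continuous_const).inter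
      (isOpen_lt cs.abs continuous_const))
  have key := (hasDerivAt_integral_of_dominated_loc_of_deriv_le (s := S) (μ := volume)
    (F := fun r k => ch k (x r) * uHat f k (s r))
    (F' := fun r k => 2 * Real.pi * Complex.I * (inner ℝ (x' r) k : ℝ) * ch k (x r) *
      uHat f k (s r) + ch k (x r) * (s' r * uHatDeriv f k (s r)))
    (bound := fun k => (2 * Real.pi * M * C + N * C) * majorant k) hS
    (Eventually.of_forall fun r => (Continuous.aestronglyMeasurable (by fun_prop)).mul
      (measurable_uHat_left f _).aestronglyMeasurable)
    (integrable_ch_mul_uHat f _ hpos.le) ?_ ?_ (integrable_majorant.const_mul _) ?_).2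
  · refine key.congr_deriv ?_
    have i0 := (integrable_ch_mul_coord_uHat f (x τ) hpos.le 0).const_mul (x' τ 0 : ℂ)
    have i1 := (integrable_ch_mul_coord_uHat f (x τ) hpos.le 1).const_mul (x' τ 1 : ℂ)
    have i2 := (integrable_ch_mul_coord_uHat f (x τ) hpos.le 2).const_mul (x' τ 2 : ℂ)
    have i3 := (integrable_ch_mul_uHatDeriv f (x τ) hpos.le).const_mul (s' τ : ℂ)
    have e0 := sol_pd (f := f) (x τ) (s τ) (j := 0) (by decide)
    have e1 := sol_pd (f := f) (x τ) (s τ) (j := 1) (by decide)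
    rw [show (0 : Fin 3).castSucc = 0 from rfl] at e0
    rw [show (1 : Fin 3).castSucc = 1 from rfl] at e1
    rw [e0, e1, solY, solT, ← integral_const_mul, ← integral_const_mul, ← integral_const_mul,
      ← integral_const_mul, ← integral_add' i0 i1, ← integral_add' (i0.add i1) i2,
      ← integral_add' ((i0.add i1).add i2) i3]
    congr 1; ext k
    simp only [Pi.add_apply]
    rw [inner_E3]
    push_cast
    ring
  · have := measurable_uHat_left f (s τ)
    have := measurable_uHatDeriv_left f (s τ)
    have c1 : Measurable fun k : E3 => ch k (x τ) := Continuous.measurable (by fun_prop)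
    have c2 : Measurable fun k : E3 => ((inner ℝ (x' τ) k : ℝ) : ℂ) :=
      Continuous.measurable (by fun_prop)
    exact Measurable.aestronglyMeasurable (by fun_prop)
  · filter_upwards [ae_goodFreq] with k hk r hr
    obtain ⟨b1, b2, b3⟩ := h k hk (s r) hr.1.le
    refine (norm_add_le _ _).trans ?_
    rw [norm_mul, norm_mul, norm_two_pi_I_mul, norm_ch, mul_one, norm_mul, norm_mul, norm_ch,
      one_mul, Complex.norm_real, Real.norm_eq_abs, add_mul]
    have hi : |inner ℝ (x' r) k| ≤ M * ‖k‖ := (abs_real_inner_le_norm _ _).trans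
      (mul_le_mul_of_nonneg_right hr.2.1.le (norm_nonneg _))
    have hM : 0 ≤ M := by positivity
    have hmj := majorant_nonneg k
    refine add_le_add ?_ ?_
    · calc _ ≤ 2 * Real.pi * (M * ‖k‖) * ‖uHat f k (s r)‖ := by gcongr
        _ = 2 * Real.pi * M * (‖k‖ * ‖uHat f k (s r)‖) := by ring
        _ ≤ 2 * Real.pi * M * (C * majorant k) := by gcongr
        _ = _ := by ring
    · calc _ ≤ N * (C * majorant k) := by
            gcongr
            exact hr.2.2.le
        _ = _ := by ring
  · filter_upwards [ae_goodFreq] with k hk r hr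
    have h2 := (hasDerivAt_uHat (f := f) hk hr.1).scomp r (hs r)
    have h3 := (hasDerivAt_ch_curve k (hx r)).mul h2
    refine h3.congr_deriv ?_
    simp only [Complex.real_smul, Function.comp_apply]

lemma GoodFreq.smul {k : E3} (hk : GoodFreq k) {a : ℝ} (ha : a ≠ 0) : GoodFreq (a • k) := by
  simp only [GoodFreq, PiLp.smul_apply, smul_eq_mul]
  exact ⟨mul_ne_zero ha hk.1, mul_ne_zero ha hk.2⟩

lemma exp_le_three {μ : ℝ} (hμ : |μ| ≤ 1) : Real.exp μ ≤ 3 := by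
  have h2 : Real.exp μ ≤ Real.exp 1 := Real.exp_le_exp.2 (abs_le.1 hμ).2
  linarith [Real.exp_one_lt_d9]

lemma majorant_exp_smul_le {μ : ℝ} (hμ : |μ| ≤ 1) {k : E3} (hk : GoodFreq k) :
    majorant (Real.exp μ • k) ≤ 9 ^ 5 * 81 * majorant k := by
  have hd := hk.add_pos
  have e3 := exp_le_three hμ
  have e1 : 1 ≤ 9 * Real.exp μ ^ 2 := by
    have h := exp_le_three (μ := -μ) (by rwa [abs_neg])
    have h4 : Real.exp (-μ) * Real.exp μ = 1 := by rw [← Real.exp_add]; simp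
    have h5 : 1 ≤ 3 * Real.exp μ := by nlinarith [Real.exp_pos μ, Real.exp_pos (-μ)]
    nlinarith
  have e0 := Real.exp_pos μ
  have w := fun i => (wt_pos (k i)).le
  have w' := fun i => (wt_pos (Real.exp μ * k i)).le
  have hw := fun i => wt_exp_mul_le hμ (k i)
  have hden : (Real.exp μ * k 0) ^ 2 + (Real.exp μ * k 2) ^ 2 =
    Real.exp μ ^ 2 * (k 0 ^ 2 + k 2 ^ 2) := by ring
  unfold majorant freqWt
  simp only [PiLp.smul_apply, smul_eq_mul, norm_smul, Real.norm_of_nonneg e0.le, hden, abs_mul,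
    abs_of_pos e0]
  have := w 0; have := w 1; have := w 2
  have := w' 0; have := w' 1; have := w' 2
  have hn := norm_nonneg k
  have hF := freqWt_nonneg k
  unfold freqWt at hF
  calc _ ≤ (9 * wt (k 0)) ^ 2 * (9 * wt (k 1)) ^ 2 * (3 * |k 2| * (9 * wt (k 2))) *
        (3 * (1 + ‖k‖)) / (Real.exp μ ^ 2 * (k 0 ^ 2 + k 2 ^ 2)) := by
        gcongr
        · exact hw 0
        · exact hw 1
        · exact hw 2
        · nlinarith
    _ = 9 ^ 6 * (wt (k 0) ^ 2 * wt (k 1) ^ 2 * (|k 2| * wt (k 2)) * (1 + ‖k‖) /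
        (k 0 ^ 2 + k 2 ^ 2)) * (1 / Real.exp μ ^ 2) := by field_simp; ring
    _ ≤ 9 ^ 6 * (wt (k 0) ^ 2 * wt (k 1) ^ 2 * (|k 2| * wt (k 2)) * (1 + ‖k‖) /
        (k 0 ^ 2 + k 2 ^ 2)) * 9 := by
        gcongr
        rw [div_le_iff₀ (by positivity)]
        exact e1
    _ = _ := by ring

/-- The factor exp(-5μ) of the transform and the Jacobian exp(3μ) of the frequency variable leave
exp(-2μ), as befits the inverse of an operator of order two. -/
lemma sol_dilate (μ : ℝ) (g : R4 → ℂ) (x : E3) (t : ℝ) :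
    sol (dilate μ g) x t =
      Real.exp (-(2 * μ)) * sol g (Real.exp μ • x) (Real.exp μ * t) := by
  have h : ∀ k : E3, ch k x * uHat (dilate μ g) k t = Real.exp (-(5 * μ)) *
      (fun l => ch l (Real.exp μ • x) * uHat g l (Real.exp μ * t)) (Real.exp (-μ) • k) := by
    intro k
    simp only [uHat_dilate]
    rw [ch_smul_left, smul_smul, ← Real.exp_add]
    simp
    ring
  unfold sol
  simp only [h]
  rw [integral_const_mul, Measure.integral_comp_smul volume
    (fun l => ch l (Real.exp μ • x) * uHat g l (Real.exp μ * t))]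
  simp only [finrank_euclideanSpace, Fintype.card_fin, Complex.real_smul]
  rw [← mul_assoc, ← Complex.ofReal_mul]
  congr 3
  rw [abs_of_pos (by positivity), ← Real.exp_nat_mul, ← Real.exp_neg, ← Real.exp_add]
  congr 1; push_cast; ring

lemma hasDerivAt_sol_dilate (x : E3) {t : ℝ} (ht : 0 ≤ t) :
    HasDerivAt (fun μ => sol (dilate μ f) x t) (sol (dil f) x t) 0 := by
  obtain ⟨C, hC, h⟩ := uHat_bounds (dil f)
  have hS : {μ : ℝ | |μ| < 1} ∈ 𝓝 (0 : ℝ) :=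
    (isOpen_lt continuous_abs continuous_const).mem_nhds (by simp)
  have hmeas : ∀ (g : 𝓢(R4, ℂ)) (ν : ℝ), AEStronglyMeasurable (fun k =>
      ch k x * uHat (dilate ν g) k t) := fun g ν => by
    refine (Continuous.aestronglyMeasurable (by fun_prop)).mul ?_
    simp only [uHat_dilate]
    exact (measurable_const.mul ((measurable_uHat_left g _).comp
      (by fun_prop : Measurable fun k : E3 => Real.exp (-ν) • k))).aestronglyMeasurable
  have h0 : ∀ g : R4 → ℂ, dilate 0 g = g := fun g => by ext z; simp [dilate]
  have key := (hasDerivAt_integral_of_dominated_loc_of_deriv_le (s := {μ : ℝ | |μ| < 1})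
    (μ := volume) (x₀ := (0 : ℝ))
    (F := fun μ k => ch k x * uHat (dilate μ f) k t)
    (F' := fun μ k => ch k x * uHat (dilate μ (dil f)) k t)
    (bound := fun k => 3 ^ 5 * (C * (9 ^ 5 * 81 * majorant k))) hS
    (Eventually.of_forall (hmeas f)) ?_ (hmeas (dil f) 0) ?_
    (((integrable_majorant.const_mul _).const_mul _).const_mul _) ?_).2
  · simpa only [h0] using! key
  · simp only [h0]; exact integrable_ch_mul_uHat f x ht
  · filter_upwards [ae_goodFreq] with k hk ν hν
    have hν' : |-ν| ≤ 1 := by rw [abs_neg]; exact le_of_lt hν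
    rw [norm_mul, norm_ch, one_mul, uHat_dilate, norm_mul, Complex.norm_real, Real.norm_eq_abs,
      Real.abs_exp]
    have e5 : Real.exp (-(5 * ν)) ≤ 3 ^ 5 := by
      rw [show -(5 * ν) = (5 : ℕ) * (-ν) by push_cast; ring, Real.exp_nat_mul]
      gcongr
      exact exp_le_three hν'
    gcongr
    refine (h _ (hk.smul (Real.exp_pos _).ne') _ (by positivity)).1.trans ?_
    gcongr
    exact majorant_exp_smul_le hν' hk
  · filter_upwards [ae_goodFreq] with k hk ν hν
    exact (hasDerivAt_uHat_dilate f hk ht hν).const_mul _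

/-- The Euler identity expressing the dilation invariance of the problem. -/
lemma sol_euler (x : E3) {t : ℝ} (ht : 0 < t) :
    x 0 * sol (pd 0 f) x t + x 1 * sol (pd 1 f) x t + x 2 * solY f x t + t * solT f x t =
      2 * sol f x t + sol (dil f) x t := by
  -- The same function of μ is differentiated at 0 in two ways: by the chain rule along the dilation
  -- orbit, and through `sol_dilate` by differentiating the data. Uniqueness of the derivative gives
  -- the identity.
  have h1 : HasDerivAt (fun μ : ℝ => sol f (Real.exp μ • x) (Real.exp μ * t)) _ 0 :=
    hasDerivAt_sol_curve (f := f) (x := fun μ => Real.exp μ • x) (x' := fun μ => Real.exp μ • x)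
      (s := fun μ => Real.exp μ * t) (s' := fun μ => Real.exp μ * t) (τ := 0)
      (fun τ => (Real.hasDerivAt_exp τ).smul_const x) (fun τ => (Real.hasDerivAt_exp τ).mul_const t)
      (by fun_prop) (by fun_prop) (by simpa using ht)
  have h2 : HasDerivAt (fun μ : ℝ => sol f (Real.exp μ • x) (Real.exp μ * t))
      (2 * sol f x t + sol (dil f) x t) 0 := by
    have e : (fun μ : ℝ => sol f (Real.exp μ • x) (Real.exp μ * t)) =
        fun μ => (Real.exp (2 * μ) : ℂ) * sol (dilate μ f) x t := by
      ext μ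
      rw [sol_dilate, ← mul_assoc, ← Complex.ofReal_mul, ← Real.exp_add]
      simp
    rw [e]
    have d := (hasDerivAt_ofReal_exp_mul 2 0).mul (hasDerivAt_sol_dilate (f := f) x ht.le)
    have h0 : dilate 0 f = f := by ext z; simp [dilate]
    refine d.congr_deriv ?_
    rw [h0]
    simp
  have := h1.unique h2
  simpa using! this

end Schwartz

end

/-! ### Fubini over frequencies and Fourier inversion for averages -/

noncomputable section

/-- The point of `ℝ³` with given coordinates. -/
def vec3 (a b c : ℝ) : E3 := !₂[a, b, c]

@[simp] lemma vec3_zero (a b c : ℝ) : vec3 a b c 0 = a := rfl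
@[simp] lemma vec3_one (a b c : ℝ) : vec3 a b c 1 = b := rfl
@[simp] lemma vec3_two (a b c : ℝ) : vec3 a b c 2 = c := rfl

@[fun_prop]
lemma Continuous.vec3 {X : Type*} [TopologicalSpace X] {a b c : X → ℝ} (ha : Continuous a)
    (hb : Continuous b) (hc : Continuous c) : Continuous fun p => vec3 (a p) (b p) (c p) := by
  unfold _root_.vec3; fun_prop

lemma hasDerivAt_vec3 {a b c : ℝ → ℝ} {a' b' c' τ : ℝ} (ha : HasDerivAt a a' τ)
    (hb : HasDerivAt b b' τ) (hc : HasDerivAt c c' τ) :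
    HasDerivAt (fun τ => vec3 (a τ) (b τ) (c τ)) (vec3 a' b' c') τ := by
  have h : HasDerivAt (fun τ => (![a τ, b τ, c τ] : Fin 3 → ℝ)) ![a', b', c'] τ := by
    rw [hasDerivAt_pi]
    intro i
    fin_cases i
    · exact ha
    · exact hb
    · exact hc
  exact (PiLp.continuousLinearEquiv 2 ℝ (fun _ : Fin 3 => ℝ)).symm.toContinuousLinearMap
    |>.hasFDerivAt.comp_hasDerivAt τ h

/-- Fubini's theorem for integrands dominated by a function of the frequency. -/
lemma integral_integral_swap_of_norm_le {P : Type*} [MeasurableSpace P] {ν : Measure P}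
    [IsFiniteMeasure ν] {F : E3 → P → ℂ} {B : E3 → ℝ} (hB : Integrable B)
    (hF : Measurable fun z : E3 × P => F z.1 z.2)
    (h : ∀ᵐ p ∂ν, ∀ k, GoodFreq k → ‖F k p‖ ≤ B k) :
    Integrable (fun k => ∫ p, F k p ∂ν) ∧ ∫ k, ∫ p, F k p ∂ν = ∫ p, (∫ k, F k p) ∂ν ∧
      Integrable (fun p => ∫ k, F k p) ν := by
  have hi : Integrable (fun z : E3 × P => F z.1 z.2) (volume.prod ν) := by
    refine (hB.mul_prod (integrable_const (μ := ν) (1 : ℝ))).mono' hF.aestronglyMeasurable ?_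
    have h1 := Measure.quasiMeasurePreserving_fst (μ := (volume : Measure E3)) (ν := ν)
      |>.ae ae_goodFreq
    have h2 := Measure.quasiMeasurePreserving_snd (μ := (volume : Measure E3)) (ν := ν) |>.ae h
    filter_upwards [h1, h2] with z hz1 hz2
    rw [mul_one]
    exact hz2 z.1 hz1
  exact ⟨hi.integral_prod_left, integral_integral_swap hi, hi.integral_prod_right⟩

section Inversion

variable (f : 𝓢(R4, ℂ))

/-- Fourier inversion for averages of the odd extension. -/
lemma integral_ch_mul_partialHat_average {P : Type*} [TopologicalSpace P] [MeasurableSpace P]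
    [BorelSpace P] [SecondCountableTopology P] {ν : Measure P} [IsLocallyFiniteMeasure ν]
    [SFinite ν] {K : Set P}
    (hK : IsCompact K) (hKm : MeasurableSet K) {c : P → ℂ} {X : P → E3} {T : P → ℝ}
    (hc : Continuous c) (hX : Continuous X) (hT : Continuous T) (hpos : ∀ p ∈ K, 0 < X p 2)
    (hI : Integrable fun k => ∫ p in K, c p * (ch k (X p) * partialHat f k (T p)) ∂ν) :
    ∫ k, ∫ p in K, c p * (ch k (X p) * partialHat f k (T p)) ∂ν =
      ∫ p in K, c p * f (joinPt (X p) (T p)) ∂ν := by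
  have : IsFiniteMeasure (ν.restrict K) := ⟨by simpa using hK.measure_lt_top⟩
  obtain ⟨M, hM⟩ := hK.exists_bound_of_continuousOn hc.continuousOn
  obtain ⟨C, hC, hb⟩ := oddRefl_bound' f
  -- The available bound on `partialHat`, of order 1/|k₂|, does not justify pointwise inversion.
  -- Averages of translates of the odd extension have the hypothesised integrable transform;
  -- inversion is applied to this average and read off at y = 0.
  set H : E3 → ℂ := fun y => ∫ p in K, c p * oddRefl f (y + X p) (T p) ∂ν with hH
  have hmeas : Measurable fun z : E3 × P => c z.2 * oddRefl f (z.1 + X z.2) (T z.2) := by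
    refine (hc.measurable.comp measurable_snd).mul ?_
    exact Measurable.comp (g := fun p : E3 × ℝ => oddRefl f p.1 p.2)
      (f := fun z : E3 × P => (z.1 + X z.2, T z.2)) (measurable_oddRefl f)
      ((measurable_fst.add (hX.measurable.comp measurable_snd)).prodMk
        (hT.measurable.comp measurable_snd))
  have hprod : Integrable (fun z : E3 × P => c z.2 * oddRefl f (z.1 + X z.2) (T z.2))
      (volume.prod (ν.restrict K)) := by
    rw [integrable_prod_iff' hmeas.aestronglyMeasurable]
    constructor
    · refine ae_of_all _ fun p => ?_
      exact ((integrable_oddRefl f (T p)).comp_add_right (X p)).const_mul (c p)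
    · refine Integrable.mono' (g := fun _ => M * (C * ∫ x, wt3 x)) (integrable_const _) ?_ ?_
      · exact (hmeas.norm.aestronglyMeasurable.prod_swap).integral_prod_right'
      · filter_upwards [ae_restrict_mem hKm] with p hp
        rw [Real.norm_of_nonneg (integral_nonneg fun _ => norm_nonneg _)]
        simp only [norm_mul]
        rw [integral_const_mul]
        have h1 : ∫ y, ‖oddRefl f (y + X p) (T p)‖ ≤ C * ∫ x, wt3 x := by
          rw [integral_add_right_eq_self (fun y => ‖oddRefl f y (T p)‖), ← integral_const_mul]
          refine integral_mono (integrable_oddRefl f _).norm (integrable_wt3.const_mul C)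
            fun x => (hb x _).trans ?_
          have := (wt3_pos x).le
          have := wt_le_one (T p)
          gcongr
          exact mul_le_of_le_one_right (wt3_pos x).le (wt_le_one _)
        exact mul_le_mul (hM p hp) h1 (integral_nonneg fun _ => norm_nonneg _)
          ((norm_nonneg _).trans (hM p hp))
  have hHi : Integrable H := hprod.integral_prod_left
  have hF : 𝓕 H = fun k => ∫ p in K, c p * (ch k (X p) * partialHat f k (T p)) ∂ν := by
    ext k
    have e1 : 𝓕 H k = ∫ y, ∫ p in K, ch (-k) y * (c p * oddRefl f (y + X p) (T p)) ∂ν := by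
      rw [Real.fourier_eq]
      congr 1; ext y
      rw [integral_const_mul, Circle.smul_def, smul_eq_mul, ch, inner_neg_right]
    rw [e1, integral_integral_swap]
    · refine integral_congr_ae (ae_of_all _ fun p => ?_)
      have e2 : ∀ y, ch (-k) y * (c p * oddRefl f (y + X p) (T p)) =
          c p * ch k (X p) * (fun y => ch (-k) y * oddRefl f y (T p)) (y + X p) := fun y => by
        have : ch (-k) y = ch k (X p) * ch (-k) (y + X p) := by
          simp only [ch_eq_exp, ← Complex.exp_add]
          congr 1
          simp only [PiLp.neg_apply, PiLp.add_apply]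
          push_cast
          ring
        rw [this]; ring
      simp only [e2]
      rw [integral_const_mul, integral_add_right_eq_self
        (fun y => ch (-k) y * oddRefl f y (T p)), partialHat]
      ring
    · refine hprod.bdd_mul (c := 1) (f := fun z : E3 × P => ch (-k) z.1) ?_ ?_
      · exact Measurable.aestronglyMeasurable
          ((by fun_prop : Continuous fun y : E3 => ch (-k) y).measurable.comp measurable_fst)
      · exact ae_of_all _ fun z => (norm_ch _ _).le
  -- On the compact set the coordinate y₁ has a positive minimum, so small translates avoid the jump
  -- at y₁ = 0 and the extension is the smooth function itself. This gives the continuity required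
  -- for inversion at the point.
  have hev : H =ᶠ[𝓝 0] fun y => ∫ p in K, c p * f (joinPt (y + X p) (T p)) ∂ν := by
    rcases K.eq_empty_or_nonempty with rfl | hne
    · simp [hH]
    obtain ⟨p0, hp0, hmin⟩ := hK.exists_isMinOn hne
      ((continuous_euclidean_apply 2).comp hX).continuousOn
    have ho : {y : E3 | -(X p0 2) < y 2} ∈ 𝓝 (0 : E3) :=
      (isOpen_lt continuous_const (continuous_euclidean_apply 2)).mem_nhds (by
        simpa using hpos p0 hp0)
    filter_upwards [ho] with y hy
    refine setIntegral_congr_fun hKm fun p hp => ?_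
    have h1 : X p0 2 ≤ X p 2 := hmin hp
    have h2 : 0 < (y + X p) 2 := by
      simp only [PiLp.add_apply]
      have : -(X p0 2) < y 2 := hy
      linarith
    simp only [oddRefl_of_pos h2]
  have hcont : ContinuousAt H 0 := by
    refine ContinuousAt.congr (f := fun y => ∫ p in K, c p * f (joinPt (y + X p) (T p)) ∂ν) ?_
      hev.symm
    refine Continuous.continuousAt ?_
    refine continuous_parametric_integral_of_continuous (s := K) ?_ hK
    refine (hc.comp continuous_snd).mul (f.continuous.comp ?_)
    exact Continuous.comp (g := fun p : E3 × ℝ => joinPt p.1 p.2)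
      (f := fun z : E3 × P => (z.1 + X z.2, T z.2)) continuous_joinPt
      ((continuous_fst.add (hX.comp continuous_snd)).prodMk (hT.comp continuous_snd))
  have inv := hHi.fourierInv_fourier_eq (by rw [hF]; exact hI) hcont
  rw [Real.fourierInv_eq, hF, hev.eq_of_nhds] at inv
  simpa using inv

end Inversion

end

/-! ### Logarithmic polar coordinates in (y₁, y₂) and the divergence theorem -/

noncomputable section

/-- `y₁ = e^ρ cos θ`. -/
def polY (p : ℝ × ℝ) : ℝ := Real.exp p.1 * Real.cos p.2

/-- `y₂ = e^ρ sin θ`. -/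
def polT (p : ℝ × ℝ) : ℝ := Real.exp p.1 * Real.sin p.2

@[fun_prop] lemma continuous_polY : Continuous polY := by unfold polY; fun_prop
@[fun_prop] lemma continuous_polT : Continuous polT := by unfold polT; fun_prop

lemma polT_nonneg {p : ℝ × ℝ} (h0 : 0 ≤ p.2) (h1 : p.2 ≤ Real.pi) : 0 ≤ polT p :=
  mul_nonneg (Real.exp_pos _).le (Real.sin_nonneg_of_nonneg_of_le_pi h0 h1)

lemma polT_pos {p : ℝ × ℝ} (h0 : 0 < p.2) (h1 : p.2 < Real.pi) : 0 < polT p :=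
  mul_pos (Real.exp_pos _) (Real.sin_pos_of_pos_of_lt_pi h0 h1)

lemma polY_pos {p : ℝ × ℝ} (h0 : 0 < p.2) (h1 : p.2 < Real.pi / 2) : 0 < polY p :=
  mul_pos (Real.exp_pos _) (Real.cos_pos_of_mem_Ioo ⟨by linarith, h1⟩)

lemma polY_sq_add_polT_sq (p : ℝ × ℝ) : polY p ^ 2 + polT p ^ 2 = Real.exp (2 * p.1) := by
  unfold polY polT
  rw [two_mul, Real.exp_add]
  linear_combination Real.exp p.1 ^ 2 * Real.sin_sq_add_cos_sq p.2

lemma hasFDerivAt_polY (p : ℝ × ℝ) : HasFDerivAt polY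
    (polY p • ContinuousLinearMap.fst ℝ ℝ ℝ - polT p • ContinuousLinearMap.snd ℝ ℝ ℝ) p := by
  have h1 := (Real.hasDerivAt_exp p.1).comp_hasFDerivAt p (hasFDerivAt_fst (𝕜 := ℝ) (p := p))
  have h2 := (Real.hasDerivAt_cos p.2).comp_hasFDerivAt p (hasFDerivAt_snd (𝕜 := ℝ) (p := p))
  refine (h1.mul h2).congr_fderiv ?_
  ext <;> simp [polY, polT, mul_comm]

lemma hasFDerivAt_polT (p : ℝ × ℝ) : HasFDerivAt polT
    (polT p • ContinuousLinearMap.fst ℝ ℝ ℝ + polY p • ContinuousLinearMap.snd ℝ ℝ ℝ) p := by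
  have h1 := (Real.hasDerivAt_exp p.1).comp_hasFDerivAt p (hasFDerivAt_fst (𝕜 := ℝ) (p := p))
  have h2 := (Real.hasDerivAt_sin p.2).comp_hasFDerivAt p (hasFDerivAt_snd (𝕜 := ℝ) (p := p))
  refine (h1.mul h2).congr_fderiv ?_
  ext <;> simp [polY, polT, mul_comm]

/-- The divergence theorem in polar coordinates for a product `E (y₁) u(y₂)` with
`E' = α E` and `u'' = β u + γ`. -/
lemma integral_polar_divergence {E u u' γ : ℝ → ℂ} {α β : ℂ} {ρa ρb θa θb : ℝ} (hρ : ρa ≤ ρb)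
    (hθ : θa ≤ θb) (h0 : 0 < θa) (h1 : θb < Real.pi) (hE : ∀ y, HasDerivAt E (α * E y) y)
    (hu : ∀ t, 0 < t → HasDerivAt u (u' t) t)
    (hu' : ∀ t, 0 < t → HasDerivAt u' (β * u t + γ t) t) (hγ : Continuous γ) :
    ∫ p in Icc (ρa, θa) (ρb, θb), ((Real.exp (2 * p.1) : ℝ) : ℂ) *
        (E (polY p) * ((β + α ^ 2) * u (polT p) + γ (polT p))) =
      (((∫ ρ in ρa..ρb, E (polY (ρ, θb)) * (polY (ρ, θb) * u' (polT (ρ, θb)) -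
          polT (ρ, θb) * (α * u (polT (ρ, θb))))) -
        ∫ ρ in ρa..ρb, E (polY (ρ, θa)) * (polY (ρ, θa) * u' (polT (ρ, θa)) -
          polT (ρ, θa) * (α * u (polT (ρ, θa))))) +
        ∫ θ in θa..θb, E (polY (ρb, θ)) * (polY (ρb, θ) * (α * u (polT (ρb, θ))) +
          polT (ρb, θ) * u' (polT (ρb, θ)))) -
        ∫ θ in θa..θb, E (polY (ρa, θ)) * (polY (ρa, θ) * (α * u (polT (ρa, θ))) +
          polT (ρa, θ) * u' (polT (ρa, θ))) := by
  -- `R` and `Q` are the ρ- and θ-derivatives of the product E(y₁)u(y₂). In logarithmic polar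
  -- coordinates the Laplacian in (y₁, y₂) is e^{-2ρ}(∂ρ² + ∂θ²), hence the factor e^{2ρ} in the
  -- divergence.
  set R : ℝ × ℝ → ℂ := fun p => E (polY p) * (polY p * (α * u (polT p)) + polT p * u' (polT p))
  set Q : ℝ × ℝ → ℂ := fun p => E (polY p) * (polY p * u' (polT p) - polT p * (α * u (polT p)))
  have hpos : ∀ p ∈ Icc (ρa, θa) (ρb, θb), 0 < polT p := fun p hp =>
    polT_pos (h0.trans_le hp.1.2) (hp.2.2.trans_lt h1)
  have cE : Continuous E := continuous_iff_continuousAt.2 fun y => (hE y).continuousAt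
  have cu : ContinuousOn (fun p => u (polT p)) (Icc (ρa, θa) (ρb, θb)) := fun p hp =>
    ((hu _ (hpos p hp)).continuousAt.comp continuous_polT.continuousAt).continuousWithinAt
  have cu' : ContinuousOn (fun p => u' (polT p)) (Icc (ρa, θa) (ρb, θb)) := fun p hp =>
    ((hu' _ (hpos p hp)).continuousAt.comp continuous_polT.continuousAt).continuousWithinAt
  have cY : Continuous fun p => (polY p : ℂ) := by fun_prop
  have cT : Continuous fun p => (polT p : ℂ) := by fun_prop
  have cEY : Continuous fun p => E (polY p) := cE.comp continuous_polY
  have dE : ∀ p, HasFDerivAt (fun p => E (polY p)) _ p := fun p =>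
    (hE (polY p)).hasFDerivAt.comp p (hasFDerivAt_polY p)
  have du : ∀ p, 0 < polT p → HasFDerivAt (fun p => u (polT p)) _ p := fun p hp =>
    (hu _ hp).hasFDerivAt.comp p (hasFDerivAt_polT p)
  have du' : ∀ p, 0 < polT p → HasFDerivAt (fun p => u' (polT p)) _ p := fun p hp =>
    (hu' _ hp).hasFDerivAt.comp p (hasFDerivAt_polT p)
  have dY : ∀ p, HasFDerivAt (fun p => (polY p : ℂ)) _ p := fun p =>
    Complex.ofRealCLM.hasFDerivAt.comp p (hasFDerivAt_polY p)
  have dT : ∀ p, HasFDerivAt (fun p => (polT p : ℂ)) _ p := fun p =>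
    Complex.ofRealCLM.hasFDerivAt.comp p (hasFDerivAt_polT p)
  have dR : ∀ p, 0 < polT p → HasFDerivAt R _ p := fun p hp =>
    (dE p).mul (((dY p).mul ((du p hp).const_mul α)).add ((dT p).mul (du' p hp)))
  have dQ : ∀ p, 0 < polT p → HasFDerivAt Q _ p := fun p hp =>
    (dE p).mul (((dY p).mul (du' p hp)).sub ((dT p).mul ((du p hp).const_mul α)))
  have key : ∀ p, 0 < polT p → fderiv ℝ R p (1, 0) + fderiv ℝ Q p (0, 1) =
      ((Real.exp (2 * p.1) : ℝ) : ℂ) *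
        (E (polY p) * ((β + α ^ 2) * u (polT p) + γ (polT p))) := fun p hp => by
    rw [(dR p hp).fderiv, (dQ p hp).fderiv, ← polY_sq_add_polT_sq]
    simp
    ring
  have cR : ContinuousOn R (Icc (ρa, θa) (ρb, θb)) := cEY.continuousOn.mul
    ((cY.continuousOn.mul (continuousOn_const.mul cu)).add (cT.continuousOn.mul cu'))
  have cQ : ContinuousOn Q (Icc (ρa, θa) (ρb, θb)) := cEY.continuousOn.mul
    ((cY.continuousOn.mul cu').sub (cT.continuousOn.mul (continuousOn_const.mul cu)))
  have hpos' : ∀ p ∈ Ioo ρa ρb ×ˢ Ioo θa θb, 0 < polT p := fun p hp =>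
    hpos p ⟨⟨hp.1.1.le, hp.2.1.le⟩, ⟨hp.1.2.le, hp.2.2.le⟩⟩
  have hcong : EqOn (fun p => fderiv ℝ R p (1, 0) + fderiv ℝ Q p (0, 1))
      (fun p => ((Real.exp (2 * p.1) : ℝ) : ℂ) *
        (E (polY p) * ((β + α ^ 2) * u (polT p) + γ (polT p)))) (Icc (ρa, θa) (ρb, θb)) :=
    fun p hp => key p (hpos p hp)
  have hI : IntegrableOn (fun p => fderiv ℝ R p (1, 0) + fderiv ℝ Q p (0, 1))
      (Icc (ρa, θa) (ρb, θb)) := by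
    refine ContinuousOn.integrableOn_compact isCompact_Icc (ContinuousOn.congr ?_ hcong)
    refine ContinuousOn.mul (Continuous.continuousOn (by fun_prop)) ?_
    exact cEY.continuousOn.mul ((continuousOn_const.mul cu).add
      (hγ.comp continuous_polT).continuousOn)
  rw [← setIntegral_congr_fun measurableSet_Icc hcong]
  exact integral_divergence_prod_Icc_of_hasFDerivAt_of_le R Q (fderiv ℝ R) (fderiv ℝ Q)
    (ρa, θa) (ρb, θb) ⟨hρ, hθ⟩ cR cQ
    (fun p hp => (dR p (hpos' p hp)).differentiableAt.hasFDerivAt)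
    (fun p hp => (dQ p (hpos' p hp)).differentiableAt.hasFDerivAt) hI

end

/-! ### Flux of the solution through polar boxes -/

noncomputable section

section Schwartz

variable (f : 𝓢(R4, ℂ))

/-- The solution in polar coordinates. -/
def polSol (f : R4 → ℂ) (a b : ℝ) (p : ℝ × ℝ) : ℂ := sol f (vec3 a b (polY p)) (polT p)

/-- The angular derivative of the solution. -/
def polTheta (f : R4 → ℂ) (a b : ℝ) (p : ℝ × ℝ) : ℂ :=
  polY p * solT f (vec3 a b (polY p)) (polT p) - polT p * solY f (vec3 a b (polY p)) (polT p)

/-- The radial derivative of the solution. -/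
def polRad (f : R4 → ℂ) (a b : ℝ) (p : ℝ × ℝ) : ℂ :=
  polY p * solY f (vec3 a b (polY p)) (polT p) + polT p * solT f (vec3 a b (polY p)) (polT p)

lemma measurable_ch_comp {P : Type*} [MeasurableSpace P] {X : P → E3} (hX : Measurable X) :
    Measurable fun z : E3 × P => ch z.1 (X z.2) :=
  Measurable.comp (g := fun p : E3 × E3 => ch p.1 p.2) (f := fun z : E3 × P => (z.1, X z.2))
    continuous_ch.measurable (measurable_fst.prodMk (hX.comp measurable_snd))

lemma measurable_uHat_comp {P : Type*} [MeasurableSpace P] {T : P → ℝ} (hT : Measurable T) :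
    Measurable fun z : E3 × P => uHat f z.1 (T z.2) :=
  Measurable.comp (g := fun p : E3 × ℝ => uHat f p.1 p.2) (f := fun z : E3 × P => (z.1, T z.2))
    (measurable_uHat f) (measurable_fst.prodMk (hT.comp measurable_snd))

lemma measurable_uHatDeriv_comp {P : Type*} [MeasurableSpace P] {T : P → ℝ} (hT : Measurable T) :
    Measurable fun z : E3 × P => uHatDeriv f z.1 (T z.2) :=
  Measurable.comp (g := fun p : E3 × ℝ => uHatDeriv f p.1 p.2)
    (f := fun z : E3 × P => (z.1, T z.2))
    (measurable_uHatDeriv f) (measurable_fst.prodMk (hT.comp measurable_snd))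

/-- Angular and radial derivatives are both combinations of ∂/∂t and ∂/∂y₁ with bounded real
coefficients, so one interchange of integrals covers the fluxes through all four sides of a box. -/
lemma integral_integral_uHat_comb {P : Type*} [MeasurableSpace P] {ν : Measure P}
    [IsFiniteMeasure ν] {X : P → E3} {T c₁ c₂ : P → ℝ} {M : ℝ} (hX : Measurable X)
    (hT : Measurable T) (hc₁ : Measurable c₁) (hc₂ : Measurable c₂)
    (h : ∀ᵐ p ∂ν, 0 ≤ T p ∧ |c₁ p| ≤ M ∧ |c₂ p| ≤ M) :
    Integrable (fun k : E3 => ∫ p, ch k (X p) * (c₁ p * uHatDeriv f k (T p) +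
        c₂ p * (2 * Real.pi * Complex.I * k 2 * uHat f k (T p))) ∂ν) ∧
      ∫ k : E3, ∫ p, ch k (X p) * (c₁ p * uHatDeriv f k (T p) +
        c₂ p * (2 * Real.pi * Complex.I * k 2 * uHat f k (T p))) ∂ν =
        ∫ p, (c₁ p * solT f (X p) (T p) + c₂ p * solY f (X p) (T p)) ∂ν := by
  obtain ⟨C, hC, hb⟩ := uHat_bounds f
  have key := integral_integral_swap_of_norm_le (ν := ν)
    (F := fun k p => ch k (X p) * (c₁ p * uHatDeriv f k (T p) +
        c₂ p * (2 * Real.pi * Complex.I * k 2 * uHat f k (T p))))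
    (B := fun k => (M * C + M * (2 * Real.pi * C)) * majorant k)
    (integrable_majorant.const_mul _) ?_ ?_
  · refine ⟨key.1, key.2.1.trans (integral_congr_ae ?_)⟩
    filter_upwards [h] with p hp
    have i1 := (integrable_ch_mul_uHatDeriv f (X p) hp.1).const_mul (c₁ p : ℂ)
    have i2 := (integrable_ch_mul_coord_uHat f (X p) hp.1 2).const_mul (c₂ p : ℂ)
    rw [solT, solY, ← integral_const_mul, ← integral_const_mul, ← integral_add i1 i2]
    congr 1; ext k; ring
  · have h1 := measurable_ch_comp hX
    have h2 := measurable_uHat_comp f hT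
    have h3 := measurable_uHatDeriv_comp f hT
    have h4 : Measurable fun z : E3 × P => (c₁ z.2 : ℂ) :=
      Complex.measurable_ofReal.comp (hc₁.comp measurable_snd)
    have h5 : Measurable fun z : E3 × P => (c₂ z.2 : ℂ) :=
      Complex.measurable_ofReal.comp (hc₂.comp measurable_snd)
    have h6 : Measurable fun z : E3 × P => (2 * Real.pi * Complex.I * (z.1 2 : ℝ) : ℂ) :=
      Measurable.const_mul (Complex.measurable_ofReal.comp
        ((continuous_euclidean_apply 2).measurable.comp measurable_fst)) _
    exact h1.mul ((h4.mul h3).add (h5.mul (h6.mul h2)))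
  · filter_upwards [h] with p hp k hk
    obtain ⟨b1, b2, b3⟩ := hb k hk (T p) hp.1
    have b4 := norm_coord_mul_le k 2 b2
    have hM : 0 ≤ M := (abs_nonneg _).trans hp.2.1
    rw [norm_mul, norm_ch, one_mul, add_mul]
    refine (norm_add_le _ _).trans (add_le_add ?_ ?_)
    · rw [norm_mul, Complex.norm_real, Real.norm_eq_abs, mul_assoc]
      exact mul_le_mul hp.2.1 b3 (norm_nonneg _) hM
    · rw [norm_mul, Complex.norm_real, Real.norm_eq_abs, norm_mul, norm_two_pi_I_mul]
      exact (mul_le_mul hp.2.2 b4 (by positivity) hM).trans_eq (by ring)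

lemma exists_abs_pol_le (ρa ρb : ℝ) : ∃ M, ∀ p : ℝ × ℝ, p.1 ∈ Icc ρa ρb →
    |polY p| ≤ M ∧ |polT p| ≤ M := by
  refine ⟨Real.exp ρb, fun p hp => ⟨?_, ?_⟩⟩
  · rw [polY, abs_mul, Real.abs_exp]
    exact (mul_le_of_le_one_right (Real.exp_pos _).le (Real.abs_cos_le_one _)).trans
      (Real.exp_le_exp.2 hp.2)
  · rw [polT, abs_mul, Real.abs_exp]
    exact (mul_le_of_le_one_right (Real.exp_pos _).le (Real.abs_sin_le_one _)).trans
      (Real.exp_le_exp.2 hp.2)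

/-- The contribution of the frequency `k` to `polTheta`. -/
def freqTheta (f : R4 → ℂ) (a b : ℝ) (k : E3) (p : ℝ × ℝ) : ℂ :=
  ch k (vec3 a b (polY p)) * (polY p * uHatDeriv f k (polT p) -
    polT p * (2 * Real.pi * Complex.I * k 2 * uHat f k (polT p)))

/-- The contribution of the frequency `k` to `polRad`. -/
def freqRad (f : R4 → ℂ) (a b : ℝ) (k : E3) (p : ℝ × ℝ) : ℂ :=
  ch k (vec3 a b (polY p)) * (polY p * (2 * Real.pi * Complex.I * k 2 * uHat f k (polT p)) +
    polT p * uHatDeriv f k (polT p))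

lemma integral_integral_polTheta (a b : ℝ) {ρa ρb θ : ℝ} (hρ : ρa ≤ ρb) (h0 : 0 ≤ θ)
    (h1 : θ ≤ Real.pi) :
    Integrable (fun k : E3 => ∫ ρ in ρa..ρb, freqTheta f a b k (ρ, θ)) ∧
      ∫ k : E3, ∫ ρ in ρa..ρb, freqTheta f a b k (ρ, θ) =
        ∫ ρ in ρa..ρb, polTheta f a b (ρ, θ) := by
  obtain ⟨M, hM⟩ := exists_abs_pol_le ρa ρb
  have := integral_integral_uHat_comb f (ν := volume.restrict (Ioc ρa ρb)) (M := M)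
    (X := fun ρ => vec3 a b (polY (ρ, θ))) (T := fun ρ => polT (ρ, θ))
    (c₁ := fun ρ => polY (ρ, θ)) (c₂ := fun ρ => -polT (ρ, θ))
    (Continuous.measurable (by fun_prop)) (Continuous.measurable (by fun_prop))
    (Continuous.measurable (by fun_prop)) (Continuous.measurable (by fun_prop)) (by
      filter_upwards [ae_restrict_mem measurableSet_Ioc] with ρ hr
      have := hM (ρ, θ) ⟨hr.1.le, hr.2⟩
      exact ⟨polT_nonneg h0 h1, this.1, by rw [abs_neg]; exact this.2⟩)
  simp only [intervalIntegral.integral_of_le hρ, polTheta, freqTheta, sub_eq_add_neg, ← neg_mul]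
  simpa only [Complex.ofReal_neg] using this

lemma integral_integral_polRad (a b ρ : ℝ) {θa θb : ℝ} (hθ : θa ≤ θb) (h0 : 0 ≤ θa)
    (h1 : θb ≤ Real.pi) :
    Integrable (fun k : E3 => ∫ θ in θa..θb, freqRad f a b k (ρ, θ)) ∧
      ∫ k : E3, ∫ θ in θa..θb, freqRad f a b k (ρ, θ) =
        ∫ θ in θa..θb, polRad f a b (ρ, θ) := by
  obtain ⟨M, hM⟩ := exists_abs_pol_le ρ ρ
  have := integral_integral_uHat_comb f (ν := volume.restrict (Ioc θa θb)) (M := M)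
    (X := fun θ => vec3 a b (polY (ρ, θ))) (T := fun θ => polT (ρ, θ))
    (c₁ := fun θ => polT (ρ, θ)) (c₂ := fun θ => polY (ρ, θ))
    (Continuous.measurable (by fun_prop)) (Continuous.measurable (by fun_prop))
    (Continuous.measurable (by fun_prop)) (Continuous.measurable (by fun_prop)) (by
      filter_upwards [ae_restrict_mem measurableSet_Ioc] with θ hr
      have := hM (ρ, θ) ⟨le_rfl, le_rfl⟩
      exact ⟨polT_nonneg (h0.trans hr.1.le) (hr.2.trans h1), this.2, this.1⟩)
  simp only [intervalIntegral.integral_of_le hθ, polRad, freqRad, add_comm (_ * (_ * uHat _ _ _)),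
    add_comm (_ * solY _ _ _)]
  exact this

/-- The symbol left after removing the y₁-part from ζ² is that of -(∂₁² + ∂₂²) in the x variables,
which can be moved onto the Schwartz data. -/
lemma zeta_sq_add (k : E3) : ((zeta k : ℂ) ^ 2 + (2 * Real.pi * Complex.I * k 2) ^ 2) =
    -((2 * Real.pi * Complex.I * k 0) ^ 2 + (2 * Real.pi * Complex.I * k 1) ^ 2) := by
  have h : zeta k ^ 2 = 4 * Real.pi ^ 2 * (k 0 ^ 2 + k 1 ^ 2 + k 2 ^ 2) := by
    rw [← norm_sq_E3, zeta]; ring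
  rw [← Complex.ofReal_pow, h]
  push_cast
  linear_combination 4 * (Real.pi : ℂ) ^ 2 * ((k 0 : ℂ) ^ 2 + (k 1 : ℂ) ^ 2 + (k 2 : ℂ) ^ 2) *
    Complex.I_sq

lemma integral_sub_add_sub_sub {a b c d e : E3 → ℂ} (ha : Integrable a) (hb : Integrable b)
    (hc : Integrable c) (hd : Integrable d) (he : Integrable e) :
    ∫ k, (a k - b k + c k - d k - e k) =
      (∫ k, a k) - (∫ k, b k) + (∫ k, c k) - (∫ k, d k) - ∫ k, e k := by
  rw [integral_sub (f := fun k => a k - b k + c k - d k) (((ha.sub hb).add hc).sub hd) he,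
    integral_sub (f := fun k => a k - b k + c k) ((ha.sub hb).add hc) hd,
    integral_add (f := fun k => a k - b k) (ha.sub hb) hc, integral_sub ha hb]

/-- The flux of the gradient of the solution through the boundary of a polar box. -/
lemma integral_polar_flux (a b : ℝ) {ρa ρb θa θb : ℝ} (hρ : ρa ≤ ρb) (hθ : θa ≤ θb)
    (h0 : 0 < θa) (h1 : θb < Real.pi / 2) :
    ∫ p in Icc (ρa, θa) (ρb, θb), ((Real.exp (2 * p.1) : ℝ) : ℂ) *
        (f (joinPt (vec3 a b (polY p)) (polT p)) - polSol (pd 0 (pd 0 f)) a b p -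
          polSol (pd 1 (pd 1 f)) a b p) =
      (((∫ ρ in ρa..ρb, polTheta f a b (ρ, θb)) - ∫ ρ in ρa..ρb, polTheta f a b (ρ, θa)) +
        ∫ θ in θa..θb, polRad f a b (ρb, θ)) - ∫ θ in θa..θb, polRad f a b (ρa, θ) := by
  have hpi := Real.pi_pos
  have hθa : θa ≤ Real.pi := by linarith
  have hθb : θb ≤ Real.pi := by linarith
  obtain ⟨z1, z1'⟩ := integral_integral_polTheta f a b hρ (h0.trans_le hθ).le hθb
  obtain ⟨z0, z0'⟩ := integral_integral_polTheta f a b hρ h0.le hθa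
  obtain ⟨r1, r1'⟩ := integral_integral_polRad f a b ρb hθ h0.le hθb
  obtain ⟨r0, r0'⟩ := integral_integral_polRad f a b ρa hθ h0.le hθb
  set K : Set (ℝ × ℝ) := Icc (ρa, θa) (ρb, θb) with hK
  have hKc : IsCompact K := isCompact_Icc
  have hKm : MeasurableSet K := measurableSet_Icc
  have hKfin : IsFiniteMeasure (volume.restrict K) := ⟨by simpa using hKc.measure_lt_top⟩
  have hT : ∀ p ∈ K, 0 < polT p := fun p hp =>
    polT_pos (h0.trans_le hp.1.2) (hp.2.2.trans_lt (by linarith))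
  have hY : ∀ p ∈ K, 0 < polY p := fun p hp =>
    polY_pos (h0.trans_le hp.1.2) (hp.2.2.trans_lt h1)
  have cexp : Continuous fun p : ℝ × ℝ => ((Real.exp (2 * p.1) : ℝ) : ℂ) := by fun_prop
  -- the term with the tangential second derivatives
  set W : E3 → ℝ → ℂ := fun k t => -(uHat (pd 0 (pd 0 f)) k t + uHat (pd 1 (pd 1 f)) k t) with hW
  obtain ⟨C, hC, hb⟩ := uHat_bounds (pd 0 (pd 0 f))
  obtain ⟨C', hC', hb'⟩ := uHat_bounds (pd 1 (pd 1 f))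
  have main := integral_integral_swap_of_norm_le (ν := volume.restrict K)
    (F := fun k p => ((Real.exp (2 * p.1) : ℝ) : ℂ) *
      (ch k (vec3 a b (polY p)) * W k (polT p)))
    (B := fun k => Real.exp (2 * ρb) * ((C + C') * majorant k))
    ((integrable_majorant.const_mul _).const_mul _) (by
      have h1 := measurable_ch_comp (X := fun p => vec3 a b (polY p))
        (Continuous.measurable (by fun_prop))
      have h2 := measurable_uHat_comp (pd 0 (pd 0 f)) continuous_polT.measurable
      have h3 := measurable_uHat_comp (pd 1 (pd 1 f)) continuous_polT.measurable
      exact (cexp.measurable.comp measurable_snd).mul (h1.mul (h2.add h3).neg)) (by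
      filter_upwards [ae_restrict_mem hKm] with p hp k hk
      rw [norm_mul, norm_mul, norm_ch, one_mul, Complex.norm_real, Real.norm_eq_abs,
        Real.abs_exp, hW, norm_neg, add_mul]
      gcongr
      · exact hp.2.1
      · exact (norm_add_le _ _).trans (add_le_add (hb k hk _ (hT p hp).le).1
          (hb' k hk _ (hT p hp).le).1))
  -- the divergence theorem for each frequency
  have hdiv : ∀ᵐ k : E3, ∫ p in K, ((Real.exp (2 * p.1) : ℝ) : ℂ) *
      (ch k (vec3 a b (polY p)) * partialHat f k (polT p)) =
      (((∫ ρ in ρa..ρb, freqTheta f a b k (ρ, θb)) - ∫ ρ in ρa..ρb, freqTheta f a b k (ρ, θa)) +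
        ∫ θ in θa..θb, freqRad f a b k (ρb, θ)) - (∫ θ in θa..θb, freqRad f a b k (ρa, θ)) -
        ∫ p in K, ((Real.exp (2 * p.1) : ℝ) : ℂ) *
          (ch k (vec3 a b (polY p)) * W k (polT p)) := by
    filter_upwards [ae_goodFreq] with k hk
    have hd := integral_polar_divergence (E := fun y => ch k (vec3 a b y))
      (u := uHat f k) (u' := uHatDeriv f k) (γ := partialHat f k)
      (α := 2 * Real.pi * Complex.I * k 2) (β := (zeta k : ℂ) ^ 2)
      hρ hθ h0 (by linarith) (fun y => by
        have := hasDerivAt_ch_curve k (hasDerivAt_vec3 (hasDerivAt_const y a)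
          (hasDerivAt_const y b) (hasDerivAt_id y))
        refine HasDerivAt.congr_deriv (f := fun y => ch k (vec3 a b y)) this ?_
        rw [inner_E3]
        simp)
      (fun t ht => hasDerivAt_uHat hk ht) (fun t ht => hasDerivAt_uHatDeriv hk ht)
      (continuous_partialHat_right f k)
    have e1 : ∀ t, W k t = ((zeta k : ℂ) ^ 2 + (2 * Real.pi * Complex.I * k 2) ^ 2) *
        uHat f k t := fun t => by
      have p0 := fun g : 𝓢(R4, ℂ) => uHat_pd (f := g) k t (j := 0) (by decide)
      have p1 := fun g : 𝓢(R4, ℂ) => uHat_pd (f := g) k t (j := 1) (by decide)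
      rw [show (0 : Fin 3).castSucc = 0 from rfl] at p0
      rw [show (1 : Fin 3).castSucc = 1 from rfl] at p1
      rw [hW, zeta_sq_add]
      simp only [p0, p1]
      ring
    have cX : Continuous fun p => ch k (vec3 a b (polY p)) := by fun_prop
    have i1 : IntegrableOn (fun p => ((Real.exp (2 * p.1) : ℝ) : ℂ) *
        (ch k (vec3 a b (polY p)) * partialHat f k (polT p))) K :=
      (cexp.mul (cX.mul ((continuous_partialHat_right f k).comp
        continuous_polT))).continuousOn.integrableOn_compact hKc
    have i2 : IntegrableOn (fun p => ((Real.exp (2 * p.1) : ℝ) : ℂ) *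
        (ch k (vec3 a b (polY p)) * W k (polT p))) K := by
      refine ContinuousOn.integrableOn_compact hKc (cexp.continuousOn.mul (cX.continuousOn.mul ?_))
      simp only [e1]
      exact continuousOn_const.mul ((continuousOn_uHat hk).comp continuous_polT.continuousOn
        fun p hp => (hT p hp).le)
    rw [← hK] at hd
    refine eq_sub_of_add_eq ((integral_add i1 i2).symm.trans (Eq.trans ?_ hd))
    refine setIntegral_congr_fun hKm fun p _ => ?_
    simp only [e1]; ring
  have hI := (((z1.sub z0).add r1).sub r0).sub main.1
  -- The integrability needed for inversion is not visible from the data; it comes from the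
  -- divergence identity, whose other five terms are integrable in the frequency.
  have hav := integral_ch_mul_partialHat_average f (ν := volume) hKc hKm cexp
    (X := fun p => vec3 a b (polY p)) (T := polT) (by fun_prop) continuous_polT hY
    (hI.congr (hdiv.mono fun k hk => hk.symm))
  rw [integral_congr_ae hdiv, integral_sub_add_sub_sub z1 z0 r1 r0 main.1,
    z1', z0', r1', r0', main.2.1] at hav
  rw [sub_eq_iff_eq_add] at hav
  have ia : IntegrableOn (fun p => ((Real.exp (2 * p.1) : ℝ) : ℂ) *
      f (joinPt (vec3 a b (polY p)) (polT p))) K :=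
    (Continuous.mul cexp (f.continuous.comp (Continuous.comp
      (g := fun p : E3 × ℝ => joinPt p.1 p.2) (f := fun p => (vec3 a b (polY p), polT p))
      continuous_joinPt (by fun_prop)))).continuousOn.integrableOn_compact hKc
  rw [sub_eq_iff_eq_add, ← integral_add ia main.2.2] at hav
  rw [hav, add_sub_cancel_right]
  refine setIntegral_congr_fun hKm fun p hp => ?_
  have j0 := integrable_ch_mul_uHat (pd 0 (pd 0 f)) (vec3 a b (polY p)) (hT p hp).le
  have j1 := integrable_ch_mul_uHat (pd 1 (pd 1 f)) (vec3 a b (polY p)) (hT p hp).le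
  simp only [polSol, sol, hW, mul_neg, mul_add]
  rw [integral_neg, integral_add (j0.const_mul _) (j1.const_mul _), integral_const_mul,
    integral_const_mul]
  ring

end Schwartz

end

/-! ### First derivatives in polar coordinates and mixed partials -/

noncomputable section

/-- If `∂ₛF = q`, `∂_θ F = Z` and `∂_θ q = r` with `r` continuous, then `∂ₛ Z = r`. -/
lemma hasDerivAt_mixed_partial {F q Z r : ℝ → ℝ → ℂ} {U : Set ℝ} (hU : IsOpen U) {s₀ θ₀ : ℝ}
    (hθ₀ : θ₀ ∈ U) (hq : ∀ s, ∀ θ ∈ U, HasDerivAt (fun s => F s θ) (q s θ) s)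
    (hZ : ∀ s, ∀ θ ∈ U, HasDerivAt (fun θ => F s θ) (Z s θ) θ)
    (hr : ∀ s, ∀ θ ∈ U, HasDerivAt (fun θ => q s θ) (r s θ) θ)
    (hc : ContinuousAt (fun p : ℝ × ℝ => r p.1 p.2) (s₀, θ₀)) :
    HasDerivAt (fun s => Z s θ₀) (r s₀ θ₀) s₀ := by
  rw [hasDerivAt_iff_isLittleO, Asymptotics.isLittleO_iff]
  intro ε hε
  obtain ⟨δ, hδ, hball⟩ := Metric.eventually_nhds_iff_ball.1
    ((Metric.continuousAt_iff'.1 hc ε hε).and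
      ((hU.preimage continuous_snd).mem_nhds (show (s₀, θ₀) ∈ Prod.snd ⁻¹' U from hθ₀)))
  have hb : ∀ s ∈ Metric.ball s₀ δ, ∀ θ ∈ Metric.ball θ₀ δ,
      ‖r s θ - r s₀ θ₀‖ ≤ ε ∧ θ ∈ U := fun s hs θ hθ => by
    have h := hball (s, θ) (by rw [← ball_prod_same]; exact ⟨hs, hθ⟩)
    exact ⟨by simpa [dist_eq_norm] using h.1.le, h.2⟩
  filter_upwards [Metric.ball_mem_nhds s₀ hδ] with s hs
  set c := r s₀ θ₀
  have hs₀ : s₀ ∈ Metric.ball s₀ δ := Metric.mem_ball_self hδ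
  -- The mean value inequality in σ, with its derivative bound obtained from the mean value
  -- inequality in τ, bounds the increments of this function from θ₀ by ε|s - s₀||θ - θ₀|. Its
  -- θ-derivative at θ₀ inherits the constant.
  have hφ : HasDerivAt (fun θ : ℝ => F s θ - F s₀ θ - (s - s₀) * (θ * c))
      (Z s θ₀ - Z s₀ θ₀ - (s - s₀) * (1 * c)) θ₀ :=
    ((hZ s θ₀ hθ₀).sub (hZ s₀ θ₀ hθ₀)).sub
      (((Complex.ofRealCLM.hasDerivAt (x := θ₀)).mul_const c).const_mul _)
  have key := hφ.hasFDerivAt.le_of_lip' (C := ε * ‖s - s₀‖) (by positivity) (by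
    filter_upwards [Metric.ball_mem_nhds θ₀ hδ] with θ hθ
    have hψ : ∀ σ ∈ Metric.ball s₀ δ, HasDerivWithinAt
        (fun σ : ℝ => F σ θ - F σ θ₀ - σ * ((θ - θ₀) * c)) (q σ θ - q σ θ₀ - 1 * ((θ - θ₀) * c))
        (Metric.ball s₀ δ) σ := fun σ hσ =>
      (((hq σ θ (hb σ hσ θ hθ).2).sub (hq σ θ₀ hθ₀)).sub
        ((Complex.ofRealCLM.hasDerivAt (x := σ)).mul_const _)).hasDerivWithinAt
    have hbd : ∀ σ ∈ Metric.ball s₀ δ, ‖q σ θ - q σ θ₀ - 1 * ((θ - θ₀) * c)‖ ≤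
        ε * ‖θ - θ₀‖ := fun σ hσ => by
      have hχ : ∀ τ ∈ Metric.ball θ₀ δ, HasDerivWithinAt (fun τ : ℝ => q σ τ - τ * c)
          (r σ τ - 1 * c) (Metric.ball θ₀ δ) τ := fun τ hτ =>
        ((hr σ τ (hb σ hσ τ hτ).2).sub
          ((Complex.ofRealCLM.hasDerivAt (x := τ)).mul_const c)).hasDerivWithinAt
      have := (convex_ball θ₀ δ).norm_image_sub_le_of_norm_hasDerivWithin_le hχ
        (fun τ hτ => by simpa using (hb σ hσ τ hτ).1) (Metric.mem_ball_self hδ) hθ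
      refine le_trans (le_of_eq ?_) this
      congr 1; ring
    have := (convex_ball s₀ δ).norm_image_sub_le_of_norm_hasDerivWithin_le hψ hbd hs₀ hs
    calc _ = ‖F s θ - F s θ₀ - s * ((θ - θ₀) * c) -
          (F s₀ θ - F s₀ θ₀ - s₀ * ((θ - θ₀) * c))‖ := by congr 1; ring
      _ ≤ _ := this
      _ = _ := by ring)
  have e : ‖Z s θ₀ - Z s₀ θ₀ - (s - s₀) * (1 * c)‖ ≤ ε * ‖s - s₀‖ := by
    refine le_trans (le_of_eq ?_) key
    simp
  simpa using e

section Schwartz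

variable {f : 𝓢(R4, ℂ)}

/-- The operator expressing the radial derivative `∂_ρ` through the dilation generator. -/
def radOf (v : 𝓢(R4, ℂ) → ℝ → ℝ → ℝ × ℝ → ℂ) (f : 𝓢(R4, ℂ)) (a b : ℝ) (p : ℝ × ℝ) : ℂ :=
  2 * v f a b p + v (dil f) a b p - a * v (pd 0 f) a b p - b * v (pd 1 f) a b p

lemma hasDerivAt_polSol_fst (a b : ℝ) {p : ℝ × ℝ} (hp : 0 < polT p) :
    HasDerivAt (fun a => polSol f a b p) (polSol (pd 0 f) a b p) a := by
  have := hasDerivAt_sol_curve (f := f) (x := fun a => vec3 a b (polY p))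
    (x' := fun _ => vec3 1 0 0) (s := fun _ => polT p) (s' := fun _ => 0) (τ := a)
    (fun a => hasDerivAt_vec3 (hasDerivAt_id a) (hasDerivAt_const _ _) (hasDerivAt_const _ _))
    (fun a => hasDerivAt_const _ _) (by fun_prop) (by fun_prop) hp
  refine HasDerivAt.congr_deriv (f := fun a => polSol f a b p) this ?_
  simp [polSol]

lemma hasDerivAt_polSol_snd (a b : ℝ) {p : ℝ × ℝ} (hp : 0 < polT p) :
    HasDerivAt (fun b => polSol f a b p) (polSol (pd 1 f) a b p) b := by
  have := hasDerivAt_sol_curve (f := f) (x := fun b => vec3 a b (polY p))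
    (x' := fun _ => vec3 0 1 0) (s := fun _ => polT p) (s' := fun _ => 0) (τ := b)
    (fun b => hasDerivAt_vec3 (hasDerivAt_const _ _) (hasDerivAt_id b) (hasDerivAt_const _ _))
    (fun b => hasDerivAt_const _ _) (by fun_prop) (by fun_prop) hp
  refine HasDerivAt.congr_deriv (f := fun b => polSol f a b p) this ?_
  simp [polSol]

lemma polRad_eq (a b : ℝ) {p : ℝ × ℝ} (hp : 0 < polT p) :
    polRad f a b p = radOf (fun f => polSol f) f a b p := by
  have := sol_euler (f := f) (vec3 a b (polY p)) hp
  simp only [vec3_zero, vec3_one, vec3_two] at this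
  simp only [polRad, radOf, polSol]
  linear_combination this

lemma hasDerivAt_polSol_rho (a b ρ : ℝ) {θ : ℝ} (hp : 0 < polT (ρ, θ)) :
    HasDerivAt (fun ρ => polSol f a b (ρ, θ)) (radOf (fun f => polSol f) f a b (ρ, θ)) ρ := by
  have h1 : ∀ ρ, HasDerivAt (fun ρ => polY (ρ, θ)) (polY (ρ, θ)) ρ := fun ρ =>
    (Real.hasDerivAt_exp ρ).mul_const (Real.cos θ)
  have h2 : ∀ ρ, HasDerivAt (fun ρ => polT (ρ, θ)) (polT (ρ, θ)) ρ := fun ρ =>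
    (Real.hasDerivAt_exp ρ).mul_const (Real.sin θ)
  have := hasDerivAt_sol_curve (f := f) (x := fun ρ => vec3 a b (polY (ρ, θ)))
    (x' := fun ρ => vec3 0 0 (polY (ρ, θ))) (s := fun ρ => polT (ρ, θ))
    (s' := fun ρ => polT (ρ, θ)) (τ := ρ)
    (fun ρ => hasDerivAt_vec3 (hasDerivAt_const _ _) (hasDerivAt_const _ _) (h1 ρ))
    h2 (by fun_prop) (by fun_prop) hp
  refine HasDerivAt.congr_deriv (f := fun ρ => polSol f a b (ρ, θ)) this ?_
  rw [← polRad_eq a b hp]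
  simp [polRad]

lemma hasDerivAt_polSol_theta (a b ρ : ℝ) {θ : ℝ} (hp : 0 < polT (ρ, θ)) :
    HasDerivAt (fun θ => polSol f a b (ρ, θ)) (polTheta f a b (ρ, θ)) θ := by
  have h1 : ∀ θ, HasDerivAt (fun θ => polY (ρ, θ)) (-polT (ρ, θ)) θ := fun θ => by
    have := (Real.hasDerivAt_cos θ).const_mul (Real.exp ρ)
    rwa [mul_neg] at this
  have h2 : ∀ θ, HasDerivAt (fun θ => polT (ρ, θ)) (polY (ρ, θ)) θ := fun θ =>
    (Real.hasDerivAt_sin θ).const_mul (Real.exp ρ)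
  have := hasDerivAt_sol_curve (f := f) (x := fun θ => vec3 a b (polY (ρ, θ)))
    (x' := fun θ => vec3 0 0 (-polT (ρ, θ))) (s := fun θ => polT (ρ, θ))
    (s' := fun θ => polY (ρ, θ)) (τ := θ)
    (fun θ => hasDerivAt_vec3 (hasDerivAt_const _ _) (hasDerivAt_const _ _) (h1 θ))
    h2 (by fun_prop) (by fun_prop) hp
  refine HasDerivAt.congr_deriv (f := fun θ => polSol f a b (ρ, θ)) this ?_
  simp [polTheta]
  ring

/-- Half-plane coordinates `(x₁, x₂, ρ, θ)` over the closed quadrant. -/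
def polBox : Set (ℝ × ℝ × ℝ × ℝ) := {q | q.2.2.2 ∈ Icc 0 (Real.pi / 2)}

lemma continuousOn_comp_pol {v : E3 → ℝ → ℂ}
    (hv : ContinuousOn (fun p : E3 × ℝ => v p.1 p.2) {p | 0 ≤ p.2}) :
    ContinuousOn (fun q : ℝ × ℝ × ℝ × ℝ => v (vec3 q.1 q.2.1 (polY q.2.2)) (polT q.2.2))
      polBox :=
  ContinuousOn.comp (g := fun p : E3 × ℝ => v p.1 p.2)
    (f := fun q : ℝ × ℝ × ℝ × ℝ => (vec3 q.1 q.2.1 (polY q.2.2), polT q.2.2)) hv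
    (Continuous.continuousOn (by fun_prop)) fun q hq =>
      polT_nonneg hq.1 (hq.2.trans (by linarith [Real.pi_pos]))

variable (f) in
lemma continuousOn_polSol :
    ContinuousOn (fun q : ℝ × ℝ × ℝ × ℝ => polSol f q.1 q.2.1 q.2.2) polBox :=
  continuousOn_comp_pol (continuousOn_sol f)

variable (f) in
lemma continuousOn_polTheta :
    ContinuousOn (fun q : ℝ × ℝ × ℝ × ℝ => polTheta f q.1 q.2.1 q.2.2) polBox := by
  have h1 : Continuous fun q : ℝ × ℝ × ℝ × ℝ => (polY q.2.2 : ℂ) := by fun_prop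
  have h2 : Continuous fun q : ℝ × ℝ × ℝ × ℝ => (polT q.2.2 : ℂ) := by fun_prop
  exact (h1.continuousOn.mul (continuousOn_comp_pol (continuousOn_solT f))).sub
    (h2.continuousOn.mul (continuousOn_comp_pol (continuousOn_solY f)))

lemma continuousOn_radOf {v : 𝓢(R4, ℂ) → ℝ → ℝ → ℝ × ℝ → ℂ}
    (hv : ∀ f, ContinuousOn (fun q : ℝ × ℝ × ℝ × ℝ => v f q.1 q.2.1 q.2.2) polBox)
    (f : 𝓢(R4, ℂ)) :
    ContinuousOn (fun q : ℝ × ℝ × ℝ × ℝ => radOf v f q.1 q.2.1 q.2.2) polBox := by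
  have h1 : Continuous fun q : ℝ × ℝ × ℝ × ℝ => (q.1 : ℂ) := by fun_prop
  have h2 : Continuous fun q : ℝ × ℝ × ℝ × ℝ => (q.2.1 : ℂ) := by fun_prop
  exact (((continuousOn_const.mul (hv f)).add (hv _)).sub (h1.continuousOn.mul (hv _))).sub
    (h2.continuousOn.mul (hv _))

lemma polBox_mem_nhds {q : ℝ × ℝ × ℝ × ℝ} (hq : q.2.2.2 ∈ Ioo 0 (Real.pi / 2)) :
    polBox ∈ 𝓝 q :=
  mem_of_superset ((isOpen_Ioo.preimage (by fun_prop :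
    Continuous fun q : ℝ × ℝ × ℝ × ℝ => q.2.2.2)).mem_nhds hq) fun _ h => Ioo_subset_Icc_self h

lemma polT_pos_of_mem {ρ θ : ℝ} (h : θ ∈ Ioo 0 (Real.pi / 2)) : 0 < polT (ρ, θ) :=
  polT_pos h.1 (h.2.trans (by linarith [Real.pi_pos]))

lemma continuousAt_slice {v : ℝ → ℝ → ℝ × ℝ → ℂ}
    (hv : ContinuousOn (fun q : ℝ × ℝ × ℝ × ℝ => v q.1 q.2.1 q.2.2) polBox)
    {γ : ℝ × ℝ → ℝ × ℝ × ℝ × ℝ} (hγ : Continuous γ) {p : ℝ × ℝ}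
    (hp : (γ p).2.2.2 ∈ Ioo 0 (Real.pi / 2)) :
    ContinuousAt (fun p => v (γ p).1 (γ p).2.1 (γ p).2.2) p :=
  ContinuousAt.comp (g := fun q : ℝ × ℝ × ℝ × ℝ => v q.1 q.2.1 q.2.2)
    (hv.continuousAt (polBox_mem_nhds hp)) hγ.continuousAt

/-- Differentiating the frequency integral a second time would need a better majorant. Exchanging
the derivatives needs only the continuity of the angular derivative for the differentiated data. -/
lemma hasDerivAt_polTheta_fst (a b ρ : ℝ) {θ : ℝ} (hθ : θ ∈ Ioo 0 (Real.pi / 2)) :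
    HasDerivAt (fun a => polTheta f a b (ρ, θ)) (polTheta (pd 0 f) a b (ρ, θ)) a :=
  hasDerivAt_mixed_partial (F := fun a θ => polSol f a b (ρ, θ))
    (q := fun a θ => polSol (pd 0 f) a b (ρ, θ)) (r := fun a θ => polTheta (pd 0 f) a b (ρ, θ))
    isOpen_Ioo hθ (fun a θ hθ => hasDerivAt_polSol_fst a b (polT_pos_of_mem hθ))
    (fun a θ hθ => hasDerivAt_polSol_theta a b ρ (polT_pos_of_mem hθ))
    (fun a θ hθ => hasDerivAt_polSol_theta a b ρ (polT_pos_of_mem hθ))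
    (continuousAt_slice (continuousOn_polTheta (pd 0 f)) (γ := fun p => (p.1, b, ρ, p.2))
      (by fun_prop) hθ)

lemma hasDerivAt_polTheta_snd (a b ρ : ℝ) {θ : ℝ} (hθ : θ ∈ Ioo 0 (Real.pi / 2)) :
    HasDerivAt (fun b => polTheta f a b (ρ, θ)) (polTheta (pd 1 f) a b (ρ, θ)) b :=
  hasDerivAt_mixed_partial (F := fun b θ => polSol f a b (ρ, θ))
    (q := fun b θ => polSol (pd 1 f) a b (ρ, θ)) (r := fun b θ => polTheta (pd 1 f) a b (ρ, θ))
    isOpen_Ioo hθ (fun b θ hθ => hasDerivAt_polSol_snd a b (polT_pos_of_mem hθ))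
    (fun b θ hθ => hasDerivAt_polSol_theta a b ρ (polT_pos_of_mem hθ))
    (fun b θ hθ => hasDerivAt_polSol_theta a b ρ (polT_pos_of_mem hθ))
    (continuousAt_slice (continuousOn_polTheta (pd 1 f)) (γ := fun p => (a, p.1, ρ, p.2))
      (by fun_prop) hθ)

lemma HasDerivAt.radOf {v w : 𝓢(R4, ℂ) → ℝ → ℝ → ℝ × ℝ → ℂ} {a b τ : ℝ} {γ : ℝ → ℝ × ℝ}
    (h : ∀ f, HasDerivAt (fun τ => v f a b (γ τ)) (w f a b (γ τ)) τ) (f : 𝓢(R4, ℂ)) :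
    HasDerivAt (fun τ => radOf v f a b (γ τ)) (_root_.radOf w f a b (γ τ)) τ :=
  ((((h f).const_mul 2).add (h _)).sub ((h _).const_mul _)).sub ((h _).const_mul _)

lemma hasDerivAt_polTheta_rho (a b ρ : ℝ) {θ : ℝ} (hθ : θ ∈ Ioo 0 (Real.pi / 2)) :
    HasDerivAt (fun ρ => polTheta f a b (ρ, θ)) (radOf (fun f => polTheta f) f a b (ρ, θ)) ρ :=
  hasDerivAt_mixed_partial (F := fun ρ θ => polSol f a b (ρ, θ))
    (q := fun ρ θ => radOf (fun f => polSol f) f a b (ρ, θ))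
    (r := fun ρ θ => radOf (fun f => polTheta f) f a b (ρ, θ))
    isOpen_Ioo hθ (fun ρ θ hθ => hasDerivAt_polSol_rho a b ρ (polT_pos_of_mem hθ))
    (fun ρ θ hθ => hasDerivAt_polSol_theta a b ρ (polT_pos_of_mem hθ))
    (fun ρ θ hθ => HasDerivAt.radOf (v := fun f => polSol f) (w := fun f => polTheta f)
      (γ := fun θ => (ρ, θ))
      (fun f => hasDerivAt_polSol_theta a b ρ (polT_pos_of_mem hθ)) f)
    (continuousAt_slice (v := radOf (fun f => polTheta f) f)
      (continuousOn_radOf (fun f => continuousOn_polTheta f) f)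
      (γ := fun p => (a, b, p.1, p.2)) (by fun_prop) hθ)

end Schwartz

end

/-! ### The second angular derivative from the equation -/

noncomputable section

lemma eq_zero_of_intervalIntegral_eq_zero {D : ℝ → ℂ} (hD : Continuous D)
    (h : ∀ a b, a ≤ b → ∫ r in a..b, D r = 0) (ρ : ℝ) : D ρ = 0 := by
  have h1 := intervalIntegral.integral_hasDerivAt_right (hD.intervalIntegrable ρ ρ)
    (hD.stronglyMeasurableAtFilter _ _) hD.continuousAt
  have h2 : (fun u => ∫ x in ρ..u, D x) = fun _ => 0 := by
    ext u
    rcases le_total ρ u with hu | hu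
    · exact h _ _ hu
    · rw [intervalIntegral.integral_symm, h _ _ hu, neg_zero]
  rw [h2] at h1
  exact h1.unique (hasDerivAt_const _ _)

/-- If `∬ P = ∫ (Z(θb) - Z(θa))` over all boxes, then `∂_θ Z = P`. -/
lemma hasDerivAt_of_box_integrals {Z P : ℝ → ℝ → ℂ} {U : Set ℝ} (hU : IsOpen U)
    (hUc : U.OrdConnected)
    (hZ : ∀ θ ∈ U, Continuous fun ρ => Z ρ θ)
    (hP : ContinuousOn (fun p : ℝ × ℝ => P p.1 p.2) (univ ×ˢ U))
    (h : ∀ ρa ρb, ρa ≤ ρb → ∀ θa ∈ U, ∀ θb ∈ U, θa ≤ θb →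
      ∫ p in Icc (ρa, θa) (ρb, θb), P p.1 p.2 =
        (∫ ρ in ρa..ρb, Z ρ θb) - ∫ ρ in ρa..ρb, Z ρ θa)
    (ρ : ℝ) {θ : ℝ} (hθ : θ ∈ U) : HasDerivAt (fun θ => Z ρ θ) (P ρ θ) θ := by
  have key : ∀ ρ, ∀ θa ∈ U, ∀ θb ∈ U, θa ≤ θb →
      ∫ θ in θa..θb, P ρ θ = Z ρ θb - Z ρ θa := by
    intro ρ θa ha θb hb hab
    have hsub : Icc θa θb ⊆ U := hUc.out ha hb
    -- Clamping θ to [θa, θb] makes the integrand continuous on the whole plane without changing the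
    -- integral, so continuity of the parametric integral in ρ applies.
    have hcl : Continuous fun p : ℝ × ℝ => P p.1 (projIcc θa θb hab p.2) := by
      refine ContinuousOn.comp_continuous (g := fun p : ℝ × ℝ => P p.1 p.2)
        (f := fun p : ℝ × ℝ => (p.1, (projIcc θa θb hab p.2 : ℝ))) hP ?_ fun p => ?_
      · exact continuous_fst.prodMk
          (continuous_subtype_val.comp (continuous_projIcc.comp continuous_snd))
      · exact ⟨mem_univ _, hsub (projIcc θa θb hab p.2).2⟩
    have heq : ∀ ρ, ∫ θ in θa..θb, P ρ θ = ∫ θ in θa..θb, P ρ (projIcc θa θb hab θ) := by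
      intro ρ
      refine intervalIntegral.integral_congr fun θ hθ => ?_
      rw [uIcc_of_le hab] at hθ
      simp only [projIcc_of_mem hab hθ]
    have hcont : Continuous fun ρ => ∫ θ in θa..θb, P ρ θ := by
      simp only [heq]
      exact intervalIntegral.continuous_parametric_intervalIntegral_of_continuous' hcl _ _
    -- The box identity holds for every ρ-interval, so the continuous integrand in ρ vanishes
    -- identically. The fundamental theorem in θ then concludes.
    have := eq_zero_of_intervalIntegral_eq_zero
      (D := fun ρ => (∫ θ in θa..θb, P ρ θ) - (Z ρ θb - Z ρ θa))
      (hcont.sub ((hZ _ hb).sub (hZ _ ha))) (fun ρa ρb hρ => ?_) ρ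
    · exact sub_eq_zero.1 this
    · rw [intervalIntegral.integral_sub (g := fun ρ => Z ρ θb - Z ρ θa) (hcont.intervalIntegrable _ _)
        (((hZ _ hb).sub (hZ _ ha)).intervalIntegrable _ _),
        intervalIntegral.integral_sub ((hZ _ hb).intervalIntegrable _ _)
        ((hZ _ ha).intervalIntegrable _ _), ← h ρa ρb hρ θa ha θb hb hab, sub_eq_zero,
        ← Icc_prod_Icc, Measure.volume_eq_prod, setIntegral_prod]
      · simp only [intervalIntegral.integral_of_le hρ, intervalIntegral.integral_of_le hab,
          integral_Icc_eq_integral_Ioc]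
      · refine ContinuousOn.integrableOn_compact (isCompact_Icc.prod isCompact_Icc) ?_
        exact hP.mono (prod_mono (subset_univ _) hsub)
  obtain ⟨ε, hε, hball⟩ := Metric.isOpen_iff.1 hU θ hθ
  have hmem : ∀ θ', |θ' - θ| < ε → θ' ∈ U := fun θ' h => hball (by
    rwa [Metric.mem_ball, Real.dist_eq])
  have ha : θ - ε / 2 ∈ U := hmem _ (by
    rw [sub_sub_cancel_left, abs_neg, abs_of_pos (by positivity)]; linarith)
  have hcP : ContinuousOn (fun θ => P ρ θ) U := ContinuousOn.comp
    (g := fun p : ℝ × ℝ => P p.1 p.2) (f := fun θ => (ρ, θ)) hP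
    (Continuous.continuousOn (by fun_prop)) fun θ hθ => ⟨mem_univ _, hθ⟩
  have hd := intervalIntegral.integral_hasDerivAt_right (f := fun θ => P ρ θ)
    (a := θ - ε / 2) (b := θ)
    ((hcP.mono (by
      rw [uIcc_of_le (by linarith)]
      exact hUc.out ha hθ)).intervalIntegrable)
    (hcP.stronglyMeasurableAtFilter hU θ hθ) (hcP.continuousAt (hU.mem_nhds hθ))
  have hd' := hd.add_const (Z ρ (θ - ε / 2))
  refine hd'.congr_of_eventuallyEq ?_
  filter_upwards [hU.mem_nhds hθ, Ioi_mem_nhds (show θ - ε / 2 < θ by linarith)] with θ' h1 h2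
  rw [key ρ _ ha _ h1 (le_of_lt h2), sub_add_cancel]

section Schwartz

variable (f : 𝓢(R4, ℂ))

/-- The second angular derivative of the solution. -/
def polThetaTheta (f : 𝓢(R4, ℂ)) (a b : ℝ) (p : ℝ × ℝ) : ℂ :=
  ((Real.exp (2 * p.1) : ℝ) : ℂ) * (f (joinPt (vec3 a b (polY p)) (polT p)) -
    polSol (pd 0 (pd 0 f)) a b p - polSol (pd 1 (pd 1 f)) a b p) -
    radOf (radOf fun f => polSol f) f a b p

lemma continuous_comp_joinPt_pol : Continuous fun q : ℝ × ℝ × ℝ × ℝ =>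
    f (joinPt (vec3 q.1 q.2.1 (polY q.2.2)) (polT q.2.2)) :=
  f.continuous.comp (Continuous.comp (g := fun p : E3 × ℝ => joinPt p.1 p.2)
    (f := fun q : ℝ × ℝ × ℝ × ℝ => (vec3 q.1 q.2.1 (polY q.2.2), polT q.2.2))
    continuous_joinPt (by fun_prop))

lemma continuousOn_exp_mul_polar_laplacian :
    ContinuousOn (fun q : ℝ × ℝ × ℝ × ℝ => ((Real.exp (2 * q.2.2.1) : ℝ) : ℂ) *
      (f (joinPt (vec3 q.1 q.2.1 (polY q.2.2)) (polT q.2.2)) -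
        polSol (pd 0 (pd 0 f)) q.1 q.2.1 q.2.2 - polSol (pd 1 (pd 1 f)) q.1 q.2.1 q.2.2))
      polBox := by
  have h1 : Continuous fun q : ℝ × ℝ × ℝ × ℝ => ((Real.exp (2 * q.2.2.1) : ℝ) : ℂ) := by fun_prop
  exact h1.continuousOn.mul (((continuous_comp_joinPt_pol f).continuousOn.sub
    (continuousOn_polSol _)).sub (continuousOn_polSol _))

lemma continuousOn_radOf_radOf :
    ContinuousOn (fun q : ℝ × ℝ × ℝ × ℝ => radOf (radOf fun f => polSol f) f q.1 q.2.1 q.2.2)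
      polBox :=
  continuousOn_radOf (continuousOn_radOf fun f => continuousOn_polSol f) f

lemma continuousOn_polThetaTheta :
    ContinuousOn (fun q : ℝ × ℝ × ℝ × ℝ => polThetaTheta f q.1 q.2.1 q.2.2) polBox :=
  (continuousOn_exp_mul_polar_laplacian f).sub (continuousOn_radOf_radOf f)

lemma continuousOn_slice {v : ℝ → ℝ → ℝ × ℝ → ℂ}
    (hv : ContinuousOn (fun q : ℝ × ℝ × ℝ × ℝ => v q.1 q.2.1 q.2.2) polBox) (a b : ℝ) :
    ContinuousOn (fun p : ℝ × ℝ => v a b p) (univ ×ˢ Icc 0 (Real.pi / 2)) :=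
  ContinuousOn.comp (g := fun q : ℝ × ℝ × ℝ × ℝ => v q.1 q.2.1 q.2.2)
    (f := fun p : ℝ × ℝ => (a, b, p)) hv (Continuous.continuousOn (by fun_prop)) fun _ hp => hp.2

/-- In `integral_polar_flux` the radial fluxes are turned back into a box integral of the second
ρ-derivative, which exists because `radOf` can be applied twice. What remains relates the angular
fluxes to a continuous density, and `hasDerivAt_of_box_integrals` localises it. -/
lemma hasDerivAt_polTheta_theta (a b ρ : ℝ) {θ : ℝ} (hθ : θ ∈ Ioo 0 (Real.pi / 2)) :
    HasDerivAt (fun θ => polTheta f a b (ρ, θ)) (polThetaTheta f a b (ρ, θ)) θ := by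
  refine hasDerivAt_of_box_integrals (Z := fun ρ θ => polTheta f a b (ρ, θ))
    (P := fun ρ θ => polThetaTheta f a b (ρ, θ)) isOpen_Ioo ordConnected_Ioo
    (fun θ hθ => ?_) ?_ ?_ ρ hθ
  · exact ContinuousOn.comp_continuous (g := fun p : ℝ × ℝ => polTheta f a b p)
      (f := fun ρ => (ρ, θ)) (continuousOn_slice (continuousOn_polTheta f) a b) (by fun_prop)
      fun _ => ⟨mem_univ _, Ioo_subset_Icc_self hθ⟩
  · exact (continuousOn_slice (continuousOn_polThetaTheta f) a b).mono
      (prod_mono subset_rfl Ioo_subset_Icc_self)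
  · intro ρa ρb hρ θa ha θb hb hab
    have hsub : Icc (ρa, θa) (ρb, θb) ⊆ univ ×ˢ Icc 0 (Real.pi / 2) := fun p hp =>
      ⟨mem_univ _, ha.1.le.trans hp.1.2, hp.2.2.trans hb.2.le⟩
    have i1 := ((continuousOn_slice (v := fun a b p => ((Real.exp (2 * p.1) : ℝ) : ℂ) *
      (f (joinPt (vec3 a b (polY p)) (polT p)) - polSol (pd 0 (pd 0 f)) a b p -
        polSol (pd 1 (pd 1 f)) a b p)) (continuousOn_exp_mul_polar_laplacian f) a b).mono
        hsub).integrableOn_compact (μ := volume) isCompact_Icc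
    have i2 := ((continuousOn_slice (continuousOn_radOf_radOf f) a b).mono
        hsub).integrableOn_compact (μ := volume) isCompact_Icc
    have e2 : ∫ p in Icc (ρa, θa) (ρb, θb), radOf (radOf fun f => polSol f) f a b p =
        (∫ θ in θa..θb, polRad f a b (ρb, θ)) - ∫ θ in θa..θb, polRad f a b (ρa, θ) := by
      have hθ : ∀ θ ∈ Icc θa θb, θ ∈ Ioo 0 (Real.pi / 2) := fun θ h =>
        ⟨ha.1.trans_le h.1, h.2.trans_lt hb.2⟩
      have c1 : ∀ r, ContinuousOn (fun θ => radOf (fun f => polSol f) f a b (r, θ))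
          (uIcc θa θb) := fun r => by
        rw [uIcc_of_le hab]
        exact ContinuousOn.comp (g := fun p => radOf (fun f => polSol f) f a b p)
          (f := fun θ => (r, θ)) (continuousOn_slice
            (v := radOf (fun f => polSol f) f) (continuousOn_radOf
              (fun f => continuousOn_polSol f) f) a b) (Continuous.continuousOn (by fun_prop))
          fun θ h => ⟨mem_univ _, Ioo_subset_Icc_self (hθ θ h)⟩
      have e3 : ∀ r, ∫ θ in θa..θb, polRad f a b (r, θ) =
          ∫ θ in θa..θb, radOf (fun f => polSol f) f a b (r, θ) := fun r => by
        refine intervalIntegral.integral_congr fun θ h => ?_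
        rw [uIcc_of_le hab] at h
        exact polRad_eq a b (polT_pos_of_mem (hθ θ h))
      rw [e3, e3, ← intervalIntegral.integral_sub (c1 _).intervalIntegrable
        (c1 _).intervalIntegrable, ← Icc_prod_Icc, Measure.volume_eq_prod, ← Measure.prod_restrict,
        integral_prod_symm]
      · rw [intervalIntegral.integral_of_le hab, ← integral_Icc_eq_integral_Ioc]
        refine setIntegral_congr_fun measurableSet_Icc fun θ h => ?_
        have hd := intervalIntegral.integral_eq_sub_of_hasDerivAt (a := ρa) (b := ρb)
          (f := fun ρ => radOf (fun f => polSol f) f a b (ρ, θ))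
          (f' := fun ρ => radOf (radOf fun f => polSol f) f a b (ρ, θ))
          (fun ρ _ => HasDerivAt.radOf (v := fun f => polSol f) (w := radOf fun f => polSol f)
            (γ := fun ρ => (ρ, θ))
            (fun f => hasDerivAt_polSol_rho a b ρ (polT_pos_of_mem (hθ θ h))) f)
          (Continuous.intervalIntegrable (ContinuousOn.comp_continuous
            (g := fun p => radOf (radOf fun f => polSol f) f a b p) (f := fun ρ => (ρ, θ))
            (continuousOn_slice (continuousOn_radOf_radOf f) a b) (by fun_prop)
            fun _ => ⟨mem_univ _, Ioo_subset_Icc_self (hθ θ h)⟩) _ _)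
        simp only [← hd, intervalIntegral.integral_of_le hρ, integral_Icc_eq_integral_Ioc]
      · rw [Measure.prod_restrict, ← Measure.volume_eq_prod, Icc_prod_Icc]
        exact i2
    simp only [polThetaTheta]
    rw [integral_sub i1 i2, e2, integral_polar_flux f a b hρ hab ha.1 hb.2]
    ring

end Schwartz

end

/-! ### Smoothness on the closed polar box -/

noncomputable section

/-- The linear form `h ↦ h c` on `ℝ`. -/
abbrev spanCLM (c : ℂ) : ℝ →L[ℝ] ℂ := ContinuousLinearMap.smulRightL ℝ ℝ ℂ (.id ℝ ℝ) c

lemma hasFDerivAt_of_continuousOn_partials {E : Type*} [NormedAddCommGroup E] [NormedSpace ℝ E]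
    {U : Set (ℝ × E)} (hU : IsOpen U) {F F₁ : ℝ × E → ℂ} {F₂ : ℝ × E → E →L[ℝ] ℂ}
    (h₁ : ∀ u ∈ U, HasDerivAt (fun s => F (s, u.2)) (F₁ u) u.1)
    (h₂ : ∀ u ∈ U, HasFDerivAt (fun e => F (u.1, e)) (F₂ u) u.2)
    (c₁ : ContinuousOn F₁ U) (c₂ : ContinuousOn F₂ U) {u : ℝ × E} (hu : u ∈ U) :
    HasFDerivAt F ((spanCLM (F₁ u)).coprod (F₂ u)) u := by
  have := hasStrictFDerivAt_uncurry_coprod (𝕜 := ℝ) (u := u) (f := fun s e => F (s, e))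
    (f₁ := fun s e => spanCLM (F₁ (s, e))) (f₂ := fun s e => F₂ (s, e))
    (by
      filter_upwards [hU.mem_nhds hu] with v hv
      refine (h₁ v hv).hasFDerivAt.congr_fderiv ?_
      ext; simp [Function.HasUncurry.uncurry])
    (by
      filter_upwards [hU.mem_nhds hu] with v hv
      exact h₂ v hv)
    ((ContinuousLinearMap.continuous _).continuousAt.comp (c₁.continuousAt (hU.mem_nhds hu)))
    (c₂.continuousAt (hU.mem_nhds hu))
  exact this.hasFDerivAt

lemma ContinuousOn.spanCLM_coprod {X E : Type*} [TopologicalSpace X] [NormedAddCommGroup E]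
    [NormedSpace ℝ E] {F₁ : X → ℂ} {F₂ : X → E →L[ℝ] ℂ} {U : Set X} (c₁ : ContinuousOn F₁ U)
    (c₂ : ContinuousOn F₂ U) : ContinuousOn (fun u => (spanCLM (F₁ u)).coprod (F₂ u)) U := by
  have h : (fun u => (spanCLM (F₁ u)).coprod (F₂ u)) = fun u =>
      ContinuousLinearMap.smulRightL ℝ (ℝ × E) ℂ (.fst ℝ ℝ E) (F₁ u) +
        ContinuousLinearMap.precomp ℂ (.snd ℝ ℝ E) (F₂ u) := by
    ext u <;> simp
  rw [h]
  exact ((ContinuousLinearMap.continuous _).comp_continuousOn c₁).add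
    ((ContinuousLinearMap.continuous _).comp_continuousOn c₂)

lemma ContDiffOn.spanCLM_coprod {X E : Type*} [NormedAddCommGroup X] [NormedSpace ℝ X]
    [NormedAddCommGroup E]
    [NormedSpace ℝ E] {n : ℕ∞ω} {F₁ : X → ℂ} {F₂ : X → E →L[ℝ] ℂ} {U : Set X}
    (c₁ : ContDiffOn ℝ n F₁ U)
    (c₂ : ContDiffOn ℝ n F₂ U) : ContDiffOn ℝ n (fun u => (spanCLM (F₁ u)).coprod (F₂ u)) U := by
  have h : (fun u => (spanCLM (F₁ u)).coprod (F₂ u)) = fun u =>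
      ContinuousLinearMap.smulRightL ℝ (ℝ × E) ℂ (.fst ℝ ℝ E) (F₁ u) +
        ContinuousLinearMap.precomp ℂ (.snd ℝ ℝ E) (F₂ u) := by
    ext u <;> simp
  rw [h]
  exact (((ContinuousLinearMap.contDiff _).comp_contDiffOn c₁)).add
    ((ContinuousLinearMap.contDiff _).comp_contDiffOn c₂)

/-- The linear form with given coefficients. -/
def gradCLM (c₀ c₁ c₂ c₃ : ℂ) : ℝ × ℝ × ℝ × ℝ →L[ℝ] ℂ :=
  (spanCLM c₀).coprod ((spanCLM c₁).coprod ((spanCLM c₂).coprod (spanCLM c₃)))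

/-- The open part of `polBox`. -/
def polOpen : Set (ℝ × ℝ × ℝ × ℝ) := {q | q.2.2.2 ∈ Ioo 0 (Real.pi / 2)}

lemma isOpen_polOpen : IsOpen polOpen := isOpen_Ioo.preimage (by fun_prop)

lemma closure_polOpen : closure polOpen = polBox := by
  have h : IsOpenMap fun q : ℝ × ℝ × ℝ × ℝ => q.2.2.2 :=
    isOpenMap_snd.comp (isOpenMap_snd.comp isOpenMap_snd)
  have := h.preimage_closure_eq_closure_preimage (by fun_prop) (Ioo 0 (Real.pi / 2))
  rw [closure_Ioo (by positivity)] at this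
  exact this.symm

lemma convex_polOpen : Convex ℝ polOpen :=
  (convex_Ioo 0 (Real.pi / 2)).is_linear_preimage (f := fun q : ℝ × ℝ × ℝ × ℝ => q.2.2.2)
    ⟨fun _ _ => rfl, fun _ _ => rfl⟩

lemma polOpen_subset : polOpen ⊆ polBox := fun _ h => Ioo_subset_Icc_self h

lemma uniqueDiffOn_polBox : UniqueDiffOn ℝ polBox := by
  rw [← closure_polOpen]
  refine uniqueDiffOn_convex convex_polOpen.closure ⟨(0, 0, 0, Real.pi / 4), ?_⟩
  refine (isOpen_polOpen.subset_interior_iff.2 subset_closure) ?_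
  have := Real.pi_pos
  exact ⟨by positivity, by simp only; linarith⟩

lemma hasFDerivAt_of_polOpen {F c₀ c₁ c₂ c₃ : ℝ × ℝ × ℝ × ℝ → ℂ}
    (h₀ : ∀ a b ρ θ, θ ∈ Ioo 0 (Real.pi / 2) →
      HasDerivAt (fun a => F (a, b, ρ, θ)) (c₀ (a, b, ρ, θ)) a)
    (h₁ : ∀ a b ρ θ, θ ∈ Ioo 0 (Real.pi / 2) →
      HasDerivAt (fun b => F (a, b, ρ, θ)) (c₁ (a, b, ρ, θ)) b)
    (h₂ : ∀ a b ρ θ, θ ∈ Ioo 0 (Real.pi / 2) →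
      HasDerivAt (fun ρ => F (a, b, ρ, θ)) (c₂ (a, b, ρ, θ)) ρ)
    (h₃ : ∀ a b ρ θ, θ ∈ Ioo 0 (Real.pi / 2) →
      HasDerivAt (fun θ => F (a, b, ρ, θ)) (c₃ (a, b, ρ, θ)) θ)
    (d₀ : ContinuousOn c₀ polOpen) (d₁ : ContinuousOn c₁ polOpen) (d₂ : ContinuousOn c₂ polOpen)
    (d₃ : ContinuousOn c₃ polOpen) {q : ℝ × ℝ × ℝ × ℝ} (hq : q ∈ polOpen) :
    HasFDerivAt F (gradCLM (c₀ q) (c₁ q) (c₂ q) (c₃ q)) q := by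
  have hspan : ∀ {X : Type} [TopologicalSpace X] {c : X → ℂ} {U : Set X}, ContinuousOn c U →
      ContinuousOn (fun u => spanCLM (c u)) U := fun h =>
    (ContinuousLinearMap.continuous _).comp_continuousOn h
  have s1 : ∀ {c : ℝ × ℝ × ℝ × ℝ → ℂ} (a : ℝ), ContinuousOn c polOpen →
      ContinuousOn (fun u => c (a, u)) {u : ℝ × ℝ × ℝ | u.2.2 ∈ Ioo 0 (Real.pi / 2)} :=
    fun a h => h.comp (Continuous.continuousOn (by fun_prop)) fun _ hu => hu
  have s2 : ∀ {c : ℝ × ℝ × ℝ × ℝ → ℂ} (a b : ℝ), ContinuousOn c polOpen →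
      ContinuousOn (fun u => c (a, b, u)) {u : ℝ × ℝ | u.2 ∈ Ioo 0 (Real.pi / 2)} :=
    fun a b h => h.comp (Continuous.continuousOn (by fun_prop)) fun _ hu => hu
  refine hasFDerivAt_of_continuousOn_partials isOpen_polOpen
    (F₂ := fun q => (spanCLM (c₁ q)).coprod ((spanCLM (c₂ q)).coprod (spanCLM (c₃ q))))
    (fun u hu => h₀ u.1 u.2.1 u.2.2.1 u.2.2.2 hu) (fun u hu => ?_) d₀
    (d₁.spanCLM_coprod (d₂.spanCLM_coprod (hspan d₃))) hq
  refine hasFDerivAt_of_continuousOn_partials (F := fun e => F (u.1, e))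
    (U := {u : ℝ × ℝ × ℝ | u.2.2 ∈ Ioo 0 (Real.pi / 2)})
    (isOpen_Ioo.preimage (by fun_prop)) (F₁ := fun v => c₁ (u.1, v))
    (F₂ := fun v => (spanCLM (c₂ (u.1, v))).coprod (spanCLM (c₃ (u.1, v))))
    (fun v hv => h₁ u.1 v.1 v.2.1 v.2.2 hv) (fun v hv => ?_) (s1 _ d₁)
    ((s1 _ d₂).spanCLM_coprod (hspan (s1 _ d₃))) hu
  refine hasFDerivAt_of_continuousOn_partials (F := fun e => F (u.1, v.1, e))
    (U := {u : ℝ × ℝ | u.2 ∈ Ioo 0 (Real.pi / 2)})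
    (isOpen_Ioo.preimage (by fun_prop)) (F₁ := fun w => c₂ (u.1, v.1, w))
    (F₂ := fun w => spanCLM (c₃ (u.1, v.1, w)))
    (fun w hw => h₂ u.1 v.1 w.1 w.2 hw) (fun w hw => ?_) (s2 _ _ d₂) (hspan (s2 _ _ d₃)) hv
  refine (h₃ u.1 v.1 w.1 w.2 hw).hasFDerivAt.congr_fderiv ?_
  ext; simp

/-- Partials are known only for 0 < θ < π/2, but the gradient extends continuously to the closed
box. On a convex open set such an extension of the derivative is the derivative within the closure.
-/
lemma hasFDerivWithinAt_polBox {F c₀ c₁ c₂ c₃ : ℝ × ℝ × ℝ × ℝ → ℂ}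
    (hF : ContinuousOn F polBox)
    (h₀ : ∀ a b ρ θ, θ ∈ Ioo 0 (Real.pi / 2) →
      HasDerivAt (fun a => F (a, b, ρ, θ)) (c₀ (a, b, ρ, θ)) a)
    (h₁ : ∀ a b ρ θ, θ ∈ Ioo 0 (Real.pi / 2) →
      HasDerivAt (fun b => F (a, b, ρ, θ)) (c₁ (a, b, ρ, θ)) b)
    (h₂ : ∀ a b ρ θ, θ ∈ Ioo 0 (Real.pi / 2) →
      HasDerivAt (fun ρ => F (a, b, ρ, θ)) (c₂ (a, b, ρ, θ)) ρ)
    (h₃ : ∀ a b ρ θ, θ ∈ Ioo 0 (Real.pi / 2) →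
      HasDerivAt (fun θ => F (a, b, ρ, θ)) (c₃ (a, b, ρ, θ)) θ)
    (d₀ : ContinuousOn c₀ polBox) (d₁ : ContinuousOn c₁ polBox) (d₂ : ContinuousOn c₂ polBox)
    (d₃ : ContinuousOn c₃ polBox) {q : ℝ × ℝ × ℝ × ℝ} (hq : q ∈ polBox) :
    HasFDerivWithinAt F (gradCLM (c₀ q) (c₁ q) (c₂ q) (c₃ q)) polBox q := by
  have hd := fun q hq => hasFDerivAt_of_polOpen h₀ h₁ h₂ h₃ (d₀.mono polOpen_subset)
    (d₁.mono polOpen_subset) (d₂.mono polOpen_subset) (d₃.mono polOpen_subset) (q := q) hq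
  have hc : ContinuousOn (fun q => gradCLM (c₀ q) (c₁ q) (c₂ q) (c₃ q)) polBox :=
    d₀.spanCLM_coprod (d₁.spanCLM_coprod (d₂.spanCLM_coprod
      ((ContinuousLinearMap.continuous _).comp_continuousOn d₃)))
  rw [← closure_polOpen]
  refine hasFDerivWithinAt_closure_of_tendsto_fderiv
    (fun q hq => (hd q hq).differentiableAt.differentiableWithinAt) convex_polOpen isOpen_polOpen
    (fun y hy => ?_) ?_
  · rw [closure_polOpen] at hy
    exact (hF y hy).mono polOpen_subset
  · refine (((hc q hq).mono polOpen_subset).tendsto).congr' ?_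
    filter_upwards [self_mem_nhdsWithin] with y hy
    exact (hd y hy).fderiv.symm

lemma contDiffOn_succ_polBox {n : ℕ} {F c₀ c₁ c₂ c₃ : ℝ × ℝ × ℝ × ℝ → ℂ}
    (hF : ContinuousOn F polBox)
    (h₀ : ∀ a b ρ θ, θ ∈ Ioo 0 (Real.pi / 2) →
      HasDerivAt (fun a => F (a, b, ρ, θ)) (c₀ (a, b, ρ, θ)) a)
    (h₁ : ∀ a b ρ θ, θ ∈ Ioo 0 (Real.pi / 2) →
      HasDerivAt (fun b => F (a, b, ρ, θ)) (c₁ (a, b, ρ, θ)) b)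
    (h₂ : ∀ a b ρ θ, θ ∈ Ioo 0 (Real.pi / 2) →
      HasDerivAt (fun ρ => F (a, b, ρ, θ)) (c₂ (a, b, ρ, θ)) ρ)
    (h₃ : ∀ a b ρ θ, θ ∈ Ioo 0 (Real.pi / 2) →
      HasDerivAt (fun θ => F (a, b, ρ, θ)) (c₃ (a, b, ρ, θ)) θ)
    (d₀ : ContDiffOn ℝ n c₀ polBox) (d₁ : ContDiffOn ℝ n c₁ polBox)
    (d₂ : ContDiffOn ℝ n c₂ polBox) (d₃ : ContDiffOn ℝ n c₃ polBox) :
    ContDiffOn ℝ (n + 1 : ℕ) F polBox := by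
  push_cast
  rw [contDiffOn_succ_iff_hasFDerivWithinAt_of_uniqueDiffOn uniqueDiffOn_polBox]
  refine ⟨by simp, fun q => gradCLM (c₀ q) (c₁ q) (c₂ q) (c₃ q), ?_, fun q hq =>
    hasFDerivWithinAt_polBox hF h₀ h₁ h₂ h₃ d₀.continuousOn d₁.continuousOn d₂.continuousOn
      d₃.continuousOn hq⟩
  exact d₀.spanCLM_coprod (d₁.spanCLM_coprod (d₂.spanCLM_coprod
    ((ContinuousLinearMap.contDiff _).comp_contDiffOn d₃)))

section Schwartz

lemma ContDiffOn.radOf {n : ℕ∞ω} {v : 𝓢(R4, ℂ) → ℝ → ℝ → ℝ × ℝ → ℂ}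
    (hv : ∀ f, ContDiffOn ℝ n (fun q : ℝ × ℝ × ℝ × ℝ => v f q.1 q.2.1 q.2.2) polBox)
    (f : 𝓢(R4, ℂ)) :
    ContDiffOn ℝ n (fun q : ℝ × ℝ × ℝ × ℝ => radOf v f q.1 q.2.1 q.2.2) polBox := by
  have h1 : ContDiff ℝ n fun q : ℝ × ℝ × ℝ × ℝ => (q.1 : ℂ) :=
    Complex.ofRealCLM.contDiff.comp contDiff_fst
  have h2 : ContDiff ℝ n fun q : ℝ × ℝ × ℝ × ℝ => (q.2.1 : ℂ) :=
    Complex.ofRealCLM.contDiff.comp (contDiff_fst.comp contDiff_snd)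
  exact (((contDiffOn_const.mul (hv f)).add (hv _)).sub (h1.contDiffOn.mul (hv _))).sub
    (h2.contDiffOn.mul (hv _))

lemma contDiff_comp_joinPt_pol (f : 𝓢(R4, ℂ)) {n : ℕ} : ContDiff ℝ n
    fun q : ℝ × ℝ × ℝ × ℝ => f (joinPt (vec3 q.1 q.2.1 (polY q.2.2)) (polT q.2.2)) := by
  refine (f.smooth n).comp ?_
  rw [contDiff_euclidean]
  intro i
  have h0 : ContDiff ℝ n fun q : ℝ × ℝ × ℝ × ℝ => q.1 := by fun_prop
  have h1 : ContDiff ℝ n fun q : ℝ × ℝ × ℝ × ℝ => q.2.1 := by fun_prop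
  have h2 : ContDiff ℝ n fun q : ℝ × ℝ × ℝ × ℝ => polY q.2.2 := by unfold polY; fun_prop
  have h3 : ContDiff ℝ n fun q : ℝ × ℝ × ℝ × ℝ => polT q.2.2 := by unfold polT; fun_prop
  fin_cases i
  · exact h0
  · exact h1
  · exact h2
  · exact h3

/-- The family of solutions and angular derivatives, over all Schwartz data, is closed under
differentiation: the partials of either are combinations, with smooth coefficients, of members of
the family and of the data. This is why the induction runs over all `f` at once and treats both
functions together. -/
lemma contDiffOn_polSol_polTheta (n : ℕ) : ∀ f : 𝓢(R4, ℂ),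
    ContDiffOn ℝ n (fun q : ℝ × ℝ × ℝ × ℝ => polSol f q.1 q.2.1 q.2.2) polBox ∧
      ContDiffOn ℝ n (fun q : ℝ × ℝ × ℝ × ℝ => polTheta f q.1 q.2.1 q.2.2) polBox := by
  induction n with
  | zero =>
    intro f
    simp only [Nat.cast_zero, contDiffOn_zero]
    exact ⟨continuousOn_polSol f, continuousOn_polTheta f⟩
  | succ n ih =>
    intro f
    constructor
    · exact contDiffOn_succ_polBox (continuousOn_polSol f)
        (fun a b ρ θ h => hasDerivAt_polSol_fst a b (polT_pos_of_mem h))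
        (fun a b ρ θ h => hasDerivAt_polSol_snd a b (polT_pos_of_mem h))
        (fun a b ρ θ h => hasDerivAt_polSol_rho a b ρ (polT_pos_of_mem h))
        (fun a b ρ θ h => hasDerivAt_polSol_theta a b ρ (polT_pos_of_mem h))
        (ih _).1 (ih _).1 (ContDiffOn.radOf (v := fun f => polSol f) (fun f => (ih f).1) f)
        (ih f).2
    · refine contDiffOn_succ_polBox (c₃ := fun q => polThetaTheta f q.1 q.2.1 q.2.2)
        (continuousOn_polTheta f)
        (fun a b ρ θ h => hasDerivAt_polTheta_fst a b ρ h)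
        (fun a b ρ θ h => hasDerivAt_polTheta_snd a b ρ h)
        (fun a b ρ θ h => hasDerivAt_polTheta_rho a b ρ h)
        (fun a b ρ θ h => hasDerivAt_polTheta_theta f a b ρ h)
        (ih _).2 (ih _).2 (ContDiffOn.radOf (v := fun f => polTheta f) (fun f => (ih f).2) f) ?_
      have h1 : ContDiff ℝ n fun q : ℝ × ℝ × ℝ × ℝ => ((Real.exp (2 * q.2.2.1) : ℝ) : ℂ) :=
        Complex.ofRealCLM.contDiff.comp (f := fun q : ℝ × ℝ × ℝ × ℝ => Real.exp (2 * q.2.2.1))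
          (by fun_prop)
      exact (h1.contDiffOn.mul ((((contDiff_comp_joinPt_pol f).contDiffOn).sub (ih _).1).sub
        (ih _).1)).sub (ContDiffOn.radOf (ContDiffOn.radOf (v := fun f => polSol f)
          (fun f => (ih f).1)) f)

end Schwartz

end

/-! ### Return to Cartesian coordinates -/

noncomputable section

/-- The complex number `y₁ + i y₂`. -/
def cplxY (z : R4) : ℂ := ⟨z 2, z 3⟩

/-- Half-plane coordinates `(x₁, x₂, log r, θ)`. -/
def polChart (z : R4) : ℝ × ℝ × ℝ × ℝ :=
  (z 0, z 1, (Complex.log (cplxY z)).re, (Complex.log (cplxY z)).im)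

lemma cplxY_mem_slitPlane {z : R4} (hz : z ∈ closedHalfPlanes \ corner) :
    cplxY z ∈ Complex.slitPlane := by
  rw [Complex.mem_slitPlane_iff]
  obtain ⟨⟨h2, h3⟩, hc⟩ := hz
  by_contra! h
  have e2 : z 2 = 0 := le_antisymm h.1 h2
  exact hc ⟨e2, h.2⟩

lemma polChart_mem {z : R4} (hz : z ∈ closedHalfPlanes \ corner) : polChart z ∈ polBox := by
  obtain ⟨⟨h2, h3⟩, hc⟩ := hz
  simp only [polChart, polBox, mem_ofPred_eq, Complex.log_im]
  refine ⟨Complex.arg_nonneg_iff.2 h3, ?_⟩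
  exact (le_abs_self _).trans (Complex.abs_arg_le_pi_div_two_iff.2 h2)

lemma polSol_polChart (f : R4 → ℂ) {z : R4} (hz : z ∈ closedHalfPlanes \ corner) :
    polSol f (polChart z).1 (polChart z).2.1 (polChart z).2.2 = sol f (fstThree z) (z 3) := by
  have h := Complex.exp_log (Complex.slitPlane_ne_zero (cplxY_mem_slitPlane hz))
  have hY : polY (polChart z).2.2 = z 2 := by
    have := congrArg Complex.re h
    rwa [Complex.exp_re] at this
  have hT : polT (polChart z).2.2 = z 3 := by
    have := congrArg Complex.im h
    rwa [Complex.exp_im] at this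
  rw [polSol, hY, hT]
  rfl

/-- The closed quadrant without the origin lies in the slit plane, where the logarithm is smooth.
The chart is therefore smooth across both faces y₁ = 0 and y₂ = 0. -/
lemma contDiffOn_polChart : ContDiffOn ℝ ∞ polChart (closedHalfPlanes \ corner) := by
  have hY : ContDiff ℝ ∞ cplxY := by
    have : cplxY = fun z => ((z 2 : ℝ) : ℂ) + (z 3 : ℝ) * Complex.I := by
      ext z
      exact Complex.mk_eq_add_mul_I _ _
    rw [this]
    have h : ∀ i : Fin 4, ContDiff ℝ ∞ fun z : R4 => ((z i : ℝ) : ℂ) := fun i =>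
      Complex.ofRealCLM.contDiff.comp (by fun_prop)
    exact (h 2).add ((h 3).mul contDiff_const)
  have hlog : ContDiffOn ℝ ∞ (fun z => Complex.log (cplxY z)) (closedHalfPlanes \ corner) :=
    fun z hz => (((Complex.contDiffAt_log (cplxY_mem_slitPlane hz)).restrict_scalars ℝ).comp z
      hY.contDiffAt).contDiffWithinAt
  exact (ContDiff.contDiffOn (by fun_prop)).prodMk ((ContDiff.contDiffOn (by fun_prop)).prodMk
    ((Complex.reCLM.contDiff.comp_contDiffOn hlog).prodMk
      (Complex.imCLM.contDiff.comp_contDiffOn hlog)))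

/-- The solution is smooth up to the boundary away from the corner. -/
lemma contDiffOn_sol (f : 𝓢(R4, ℂ)) :
    ContDiffOn ℝ ∞ (fun z : R4 => sol f (fstThree z) (z 3)) (closedHalfPlanes \ corner) := by
  have h : ContDiffOn ℝ ∞ (fun q : ℝ × ℝ × ℝ × ℝ => polSol f q.1 q.2.1 q.2.2) polBox :=
    contDiffOn_infty.2 fun n => (contDiffOn_polSol_polTheta n f).1
  exact (h.comp contDiffOn_polChart fun z hz => polChart_mem hz).congr fun z hz =>
    (polSol_polChart f hz).symm

end

/-! ### Odd extensions of the data and of the solution -/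

noncomputable section

lemma reflectY1_joinPt (x : E3) (t : ℝ) : reflectY1 (joinPt x t) = joinPt (refl3 x) t := by
  ext i; fin_cases i <;> simp [reflectY1, joinPt]

/-- The extension of a function given on `Ω` by `v`, when `v` is odd in `y₁`. -/
lemma oddExt_joinPt {g : R4 → ℂ} {v : E3 → ℝ → ℂ}
    (hg : ∀ x t, 0 < x 2 → 0 < t → g (joinPt x t) = v x t)
    (hv : ∀ x t, v (refl3 x) t = -v x t) (x : E3) (t : ℝ) :
    oddExt g (joinPt x t) = if 0 < t then v x t else 0 := by
  have h1 : joinPt x t ∈ halfPlanes ↔ 0 < x 2 ∧ 0 < t := Iff.rfl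
  have h2 : reflectY1 (joinPt x t) ∈ halfPlanes ↔ 0 < -(x 2) ∧ 0 < t := Iff.rfl
  unfold oddExt
  rw [h1, h2]
  by_cases ht : 0 < t
  · rcases lt_trichotomy (x 2) 0 with h | h | h
    · rw [if_neg (fun h' => h'.1.not_gt h), if_pos ⟨by linarith, ht⟩, if_pos ht,
        reflectY1_joinPt, hg _ _ (by simpa using h) ht, hv, neg_neg]
    -- On the fixed hyperplane y₁ = 0 oddness forces the value 0, in agreement with the convention
    -- in `oddExt`.
    · have e : refl3 x = x := by
        ext i; fin_cases i <;> simp [h]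
      have h0 : v x t = 0 := by
        have := hv x t
        rw [e] at this
        exact self_eq_neg.1 this
      simp [h, h0]
    · rw [if_pos ⟨h, ht⟩, if_pos ht, hg _ _ h ht]
  · simp [ht]

lemma sol_refl3 (f : R4 → ℂ) (x : E3) (t : ℝ) : sol f (refl3 x) t = -sol f x t := by
  unfold sol
  rw [← integral_neg, ← (LinearIsometryEquiv.measurePreserving refl3).integral_comp'
    (f := refl3.toMeasurableEquiv)]
  congr 1; ext k
  change ch (refl3 k) (refl3 x) * uHat f (refl3 k) t = _
  rw [ch_refl3, uHat_refl3, show refl3 (refl3 k) = k by ext i; fin_cases i <;> simp]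
  ring

lemma oddExt_joinPt_of_eq {f : 𝓢(R4, ℂ)} {g : R4 → ℂ} (hg : ∀ z ∈ closedHalfPlanes, g z = f z)
    (x : E3) (t : ℝ) : oddExt g (joinPt x t) = if 0 < t then oddRefl f x t else 0 :=
  oddExt_joinPt (fun x t hx ht => by
    rw [oddRefl_of_pos hx, hg _ ⟨hx.le, ht.le⟩]) (fun x t => oddRefl_refl3 f x t) x t

end

/-! ### The prescribed formula as the transform of the Green solution in y₂ -/

noncomputable section

/-- Integration over the half-space `t > 0`. -/
lemma integral_prod_ite_pos {F : E3 × ℝ → ℂ}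
    (hF : Integrable fun p : E3 × ℝ => if 0 < p.2 then F p else 0) :
    ∫ p : E3 × ℝ, (if 0 < p.2 then F p else 0) = ∫ t in Ioi (0 : ℝ), ∫ x : E3, F (x, t) := by
  rw [Measure.volume_eq_prod] at hF ⊢
  rw [integral_prod_symm _ hF, ← integral_indicator measurableSet_Ioi]
  congr 1; ext t
  by_cases ht : 0 < t
  · simp [ht]
  · simp [ht]

lemma wt_integrable_prod : Integrable fun p : E3 × ℝ => wt3 p.1 * wt p.2 :=
  integrable_wt3.mul_prod integrable_wt

lemma zeta_sq (k : E3) :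
    zeta k ^ 2 = (2 * Real.pi) ^ 2 * (k 0 ^ 2 + k 1 ^ 2 + k 2 ^ 2) := by
  rw [zeta, mul_pow, norm_sq_E3]

section Schwartz

variable {f : 𝓢(R4, ℂ)} {g : R4 → ℂ}

lemma extHat_eq (hg : ∀ z ∈ closedHalfPlanes, g z = f z) (k : E3) {τ : ℂ} (hτ : τ.im ≤ 0) :
    extHat g (2 * Real.pi * k 0) (2 * Real.pi * k 1) (2 * Real.pi * k 2) τ =
      ∫ t in Ioi (0 : ℝ), partialHat f k t * Complex.exp (-Complex.I * (t * τ)) := by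
  obtain ⟨C, hC, hb⟩ := oddRefl_bound' f
  have e : ∀ p : E3 × ℝ, oddExt g (joinPt p.1 p.2) * Complex.exp (-Complex.I *
      ((joinPt p.1 p.2 0 : ℝ) * (2 * Real.pi * k 0 : ℝ) +
        (joinPt p.1 p.2 1 : ℝ) * (2 * Real.pi * k 1 : ℝ) +
        (joinPt p.1 p.2 2 : ℝ) * (2 * Real.pi * k 2 : ℝ) + (joinPt p.1 p.2 3 : ℝ) * τ)) =
      if 0 < p.2 then (fun p : E3 × ℝ => ch (-k) p.1 * oddRefl f p.1 p.2 *
        Complex.exp (-Complex.I * (p.2 * τ))) p else 0 := by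
    intro p
    rw [oddExt_joinPt_of_eq hg, ite_mul, zero_mul]
    congr 1
    dsimp only
    rw [mul_comm (ch _ _), mul_assoc (oddRefl f p.1 p.2)]
    congr 1
    rw [ch_eq_exp, ← Complex.exp_add]
    congr 1
    simp only [joinPt_zero, joinPt_one, joinPt_two, joinPt_three, PiLp.neg_apply]
    push_cast
    ring
  rw [extHat, integral_R4_eq]
  simp only [e]
  rw [integral_prod_ite_pos]
  · refine setIntegral_congr_fun measurableSet_Ioi fun t _ => ?_
    simp only
    rw [integral_mul_const, partialHat]
  · refine (wt_integrable_prod.const_mul C).mono' ?_ (ae_of_all _ fun p => ?_)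
    · refine Measurable.aestronglyMeasurable (Measurable.ite (measurableSet_lt measurable_const
        measurable_snd) ?_ measurable_const)
      refine Measurable.mul (Measurable.mul ?_ (measurable_oddRefl f)) ?_
      · exact (by fun_prop : Continuous fun p : E3 × ℝ => ch (-k) p.1).measurable
      · exact Continuous.measurable (by fun_prop)
    · have hw := mul_nonneg hC (mul_nonneg (wt3_pos p.1).le (wt_pos p.2).le)
      split_ifs with h
      · rw [norm_mul, norm_mul, norm_ch, one_mul]
        refine (mul_le_of_le_one_right (norm_nonneg _) ?_).trans (hb _ _)
        rw [Complex.norm_exp, Real.exp_le_one_iff]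
        simp
        exact mul_nonpos_of_nonneg_of_nonpos h.le hτ
      · simpa using hw

/-- The right-hand side of the Fourier formula is the transform of `uHat` in the last variable. -/
lemma solnHat_eq (hg : ∀ z ∈ closedHalfPlanes, g z = f z) {k : E3} (hk : GoodFreq k) (η : ℝ) :
    solnHat g ((2 * Real.pi) • joinPt k η) =
      ∫ t in Ioi (0 : ℝ), uHat f k t * Complex.exp (-Complex.I * (t * (2 * Real.pi * η : ℝ))) ∧
    solnHat g ((2 * Real.pi) • joinPt k η) =
      -((∫ t in Ioi (0 : ℝ), partialHat f k t *
        Complex.exp (-Complex.I * (t * (2 * Real.pi * η : ℝ)))) /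
          ((zeta k : ℂ) ^ 2 + (2 * Real.pi * η : ℝ) ^ 2)) +
      (Complex.I * (2 * Real.pi * η : ℝ) - (2 * Real.pi * k 1 : ℝ)) /
        ((zeta k : ℂ) - (2 * Real.pi * k 1 : ℝ)) *
        ((∫ t in Ioi (0 : ℝ), partialHat f k t * Complex.exp (-(zeta k * t))) /
          ((zeta k : ℂ) ^ 2 + (2 * Real.pi * η : ℝ) ^ 2)) := by
  obtain ⟨c, hc, hb⟩ := partialHat_bound_wt f k
  have h1 := fourier_odeSol (m := bdryCoef k) hk.zeta_pos (continuous_partialHat_right f k)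
    (fun s _ => hb s) (2 * Real.pi * η) (2 * Real.pi * k 1) (sub_ne_zero.1 hk.sub_pos.ne') rfl
  have hz : zetaFreq ((2 * Real.pi) • joinPt k η) = zeta k := by
    have : (2 * Real.pi * k 0) ^ 2 + (2 * Real.pi * k 1) ^ 2 + (2 * Real.pi * k 2) ^ 2 =
        zeta k ^ 2 := by
      rw [zeta_sq]; ring
    simp only [zetaFreq, PiLp.smul_apply, smul_eq_mul, joinPt_zero, joinPt_one, joinPt_two, this]
    exact Real.sqrt_sq hk.zeta_pos.le
  have hden : (((2 * Real.pi * k 0) ^ 2 + (2 * Real.pi * k 1) ^ 2 + (2 * Real.pi * k 2) ^ 2 +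
      (2 * Real.pi * η) ^ 2 : ℝ) : ℂ) = (zeta k : ℂ) ^ 2 + (2 * Real.pi * η : ℝ) ^ 2 := by
    have : (2 * Real.pi * k 0) ^ 2 + (2 * Real.pi * k 1) ^ 2 + (2 * Real.pi * k 2) ^ 2 =
        zeta k ^ 2 := by
      rw [zeta_sq]; ring
    rw [this]; push_cast; ring
  have e1 := extHat_eq hg k (τ := ((2 * Real.pi * η : ℝ) : ℂ)) (by rw [Complex.ofReal_im])
  have e2 := extHat_eq hg k (τ := -Complex.I * zeta k) (by simpa using hk.zeta_pos.le)
  have e3 : ∀ t : ℝ, Complex.exp (-Complex.I * (t * (-Complex.I * zeta k))) =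
      Complex.exp (-(zeta k * t)) := fun t => by
    congr 1
    linear_combination (t * zeta k : ℂ) * Complex.I_sq
  refine (fun h2 => ⟨h2.trans h1.symm, h2⟩) ?_
  rw [solnHat, hz]
  simp only [PiLp.smul_apply, smul_eq_mul, joinPt_zero, joinPt_one, joinPt_two, joinPt_three]
  rw [e1, e2, hden]
  simp only [e3]

variable (f) in
/-- The right-hand side of the Fourier formula is dominated by `majorant`. -/
lemma exists_norm_solnHat_le (hg : ∀ z ∈ closedHalfPlanes, g z = f z) :
    ∃ C, 0 ≤ C ∧ ∀ k, GoodFreq k → ∀ η : ℝ,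
      ‖solnHat g ((2 * Real.pi) • joinPt k η)‖ ≤ C * majorant k := by
  obtain ⟨C, hC, hb⟩ := norm_partialHat_le f
  set J := ∫ t, wt t
  have hJ : 0 ≤ J := integral_nonneg fun t => (wt_pos t).le
  refine ⟨C * J, by positivity, fun k hk η => ?_⟩
  have hF := freqWt_nonneg k
  set A := C * freqWt k * J
  have hA : 0 ≤ A := by positivity
  have hint : ∀ E : ℝ → ℂ, (∀ t ∈ Ioi (0 : ℝ), ‖E t‖ ≤ 1) →
      ‖∫ t in Ioi (0 : ℝ), partialHat f k t * E t‖ ≤ A := fun E hE => by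
    have h1 : ‖∫ t in Ioi (0 : ℝ), partialHat f k t * E t‖ ≤
        ∫ t in Ioi (0 : ℝ), C * freqWt k * wt t := by
      refine norm_integral_le_of_norm_le (integrable_wt.const_mul _).integrableOn ?_
      filter_upwards [ae_restrict_mem measurableSet_Ioi] with t ht
      rw [norm_mul]
      exact (mul_le_of_le_one_right (norm_nonneg _) (hE t ht)).trans (hb k t)
    rw [integral_const_mul] at h1
    refine h1.trans (mul_le_mul_of_nonneg_left ?_ (by positivity))
    exact setIntegral_le_integral integrable_wt (ae_of_all _ fun t => (wt_pos t).le)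
  have hz := hk.zeta_pos
  have hs := hk.sub_pos
  have hs' := hk.add_zeta_pos
  have hd := hk.add_pos
  set τ := 2 * Real.pi * η
  set ξ := 2 * Real.pi * k 1
  set ζ := zeta k
  have hζξ : (ζ - ξ) * (ζ + ξ) = (2 * Real.pi) ^ 2 * (k 0 ^ 2 + k 2 ^ 2) := by
    linear_combination zeta_sq k
  have hpi : 1 ≤ 2 * Real.pi := by linarith [Real.pi_gt_three]
  have n1 := hint (fun t => Complex.exp (-Complex.I * (t * (τ : ℂ)))) (fun t _ => by
    rw [Complex.norm_exp]; simp)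
  have n2 := hint (fun t => Complex.exp (-(ζ * t))) (fun t ht => by
    rw [Complex.norm_exp, Real.exp_le_one_iff]
    simpa using mul_nonneg hz.le (le_of_lt ht))
  rw [(solnHat_eq hg hk η).2]
  have hden : ‖(ζ : ℂ) ^ 2 + (τ : ℂ) ^ 2‖ = ζ ^ 2 + τ ^ 2 := by
    rw [← Complex.ofReal_pow, ← Complex.ofReal_pow, ← Complex.ofReal_add, Complex.norm_real,
      Real.norm_of_nonneg (by positivity)]
  have hnum : ‖Complex.I * (τ : ℂ) - (ξ : ℂ)‖ ≤ √(ζ ^ 2 + τ ^ 2) := by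
    rw [Complex.norm_eq_sqrt_sq_add_sq]
    refine Real.sqrt_le_sqrt ?_
    simp
    nlinarith
  have hsub : ‖(ζ : ℂ) - (ξ : ℂ)‖ = ζ - ξ := by
    rw [← Complex.ofReal_sub, Complex.norm_real, Real.norm_of_nonneg hs.le]
  set D := ζ ^ 2 + τ ^ 2
  have hD : 0 < D := by positivity
  have hDζ : ζ ≤ √D := Real.le_sqrt_of_sq_le (by simp only [D]; nlinarith [sq_nonneg τ])
  set d := k 0 ^ 2 + k 2 ^ 2
  have hdζ : (2 * Real.pi) ^ 2 * d ≤ ζ ^ 2 := by rw [← hζξ]; nlinarith [sq_nonneg ξ]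
  have t1 : A / D ≤ A / ((2 * Real.pi) ^ 2 * d) :=
    div_le_div_of_nonneg_left hA (by positivity) (by simp only [D]; nlinarith [sq_nonneg τ])
  -- The numerator |iτ - ξ| costs √D, so one factor √D remains below; √D ≥ ζ ≥ (ζ + ξ)/2 then
  -- completes (ζ - ξ) to the product (2π)²(k₀² + k₂²)/2.
  have t2 : √D / (ζ - ξ) * (A / D) ≤ 2 * (A / ((2 * Real.pi) ^ 2 * d)) := by
    have hsq : √D * √D = D := Real.mul_self_sqrt hD.le
    have hsp : 0 < √D := Real.sqrt_pos.2 hD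
    have e1 : √D / (ζ - ξ) * (A / D) = A / ((ζ - ξ) * √D) := by
      rw [div_mul_div_comm, div_eq_div_iff (by positivity) (by positivity)]
      linear_combination (ζ - ξ) * A * hsq
    have e2 : 2 * (A / ((2 * Real.pi) ^ 2 * d)) = A / ((ζ - ξ) * ((ζ + ξ) / 2)) := by
      rw [← hζξ]; field_simp
    rw [e1, e2]
    refine div_le_div_of_nonneg_left hA (by positivity) ?_
    gcongr
    nlinarith
  calc _ ≤ A / D + √D / (ζ - ξ) * (A / D) := by
        refine (norm_add_le _ _).trans (add_le_add ?_ ?_)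
        · rw [norm_neg, norm_div, hden]; gcongr
        · rw [norm_mul, norm_div, norm_div, hden, hsub]; gcongr
    _ ≤ 3 * (A / ((2 * Real.pi) ^ 2 * d)) := by linarith
    _ ≤ A / d := by
        rw [mul_comm ((2 * Real.pi) ^ 2), ← div_div, ← mul_div_assoc,
          div_le_iff₀ (by positivity), mul_comm]
        gcongr
        nlinarith [Real.pi_gt_three]
    _ ≤ _ := by
        simp only [A, majorant]
        rw [mul_assoc, mul_comm (freqWt k) J, ← mul_assoc, mul_div_assoc]
        gcongr
        exact le_mul_of_one_le_right hF (by linarith [norm_nonneg k])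

end Schwartz

end

/-! ### Test functions transformed in the last variable -/

noncomputable section

section Schwartz

/-- The transform of a Schwartz function in the last variable. -/
def lastHat (φ : 𝓢(R4, ℂ)) (t : ℝ) (k : E3) : ℂ :=
  ∫ η : ℝ, φ (joinPt k η) * Complex.exp (-Complex.I * (t * (2 * Real.pi * η : ℝ)))

lemma norm_exp_neg_I_mul (t r : ℝ) : ‖Complex.exp (-Complex.I * (t * r))‖ = 1 := by
  rw [Complex.norm_exp]; simp

variable (φ : 𝓢(R4, ℂ))

lemma integrable_comp_joinPt_prod : Integrable fun p : E3 × ℝ => φ (joinPt p.1 p.2) :=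
  (integrable_R4_iff _).1 φ.integrable

lemma integrable_lastHat_integrand (t : ℝ) : Integrable fun p : E3 × ℝ =>
    φ (joinPt p.1 p.2) * Complex.exp (-Complex.I * (t * (2 * Real.pi * p.2 : ℝ))) :=
  (integrable_comp_joinPt_prod φ).mul_bdd (c := 1)
    (Continuous.aestronglyMeasurable (by fun_prop))
    (ae_of_all _ fun p => (norm_exp_neg_I_mul _ _).le)

lemma integrable_lastHat (t : ℝ) : Integrable (lastHat φ t) :=
  (integrable_lastHat_integrand φ t).integral_prod_left

lemma continuous_lastHat (t : ℝ) : Continuous (lastHat φ t) := by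
  obtain ⟨C, hC, h⟩ := norm_joinPt_le_wt φ
  have hc : ∀ k, Continuous fun η => φ (joinPt k η) * Complex.exp (-Complex.I *
      (t * (2 * Real.pi * η : ℝ))) := fun k =>
    (φ.continuous.comp (Continuous.comp (g := fun p : E3 × ℝ => joinPt p.1 p.2)
      (f := fun η => (k, η)) continuous_joinPt (by fun_prop))).mul (by fun_prop)
  refine continuous_of_dominated (bound := fun η => C * wt η) (fun k =>
    (hc k).aestronglyMeasurable) (fun k => ae_of_all _ fun η => ?_)
    (integrable_wt.const_mul C) (ae_of_all _ fun η => ?_)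
  · rw [norm_mul, norm_exp_neg_I_mul, mul_one]
    refine (h k η).trans (mul_le_mul_of_nonneg_left ?_ hC)
    have h1 := wt3_le_one k
    have h2 := (wt3_pos k).le
    calc wt3 k ^ 2 * wt η ^ 2 ≤ 1 * wt η :=
          mul_le_mul (pow_le_one₀ h2 h1) (wt_sq_le η) (by positivity) zero_le_one
      _ = wt η := one_mul _
  · exact (φ.continuous.comp (Continuous.comp (g := fun p : E3 × ℝ => joinPt p.1 p.2)
      (f := fun k => (k, η)) continuous_joinPt (by fun_prop))).mul continuous_const

lemma fourier_joinPt (x : E3) (t : ℝ) : 𝓕 (lastHat φ t) x = (𝓕 φ) (joinPt x t) := by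
  rw [SchwartzMap.fourier_coe, Real.fourier_eq, Real.fourier_eq, integral_R4_eq]
  have e : ∀ p : E3 × ℝ, Real.fourierChar (-inner ℝ (joinPt p.1 p.2) (joinPt x t)) •
      φ (joinPt p.1 p.2) = (Real.fourierChar (-inner ℝ p.1 x) : ℂ) *
      (φ (joinPt p.1 p.2) * Complex.exp (-Complex.I * (t * (2 * Real.pi * p.2 : ℝ)))) := by
    intro p
    have h : inner ℝ (joinPt p.1 p.2) (joinPt x t) = inner ℝ p.1 x + p.2 * t := by
      rw [inner_E3]
      simp [PiLp.inner_apply, Fin.sum_univ_four]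
      ring
    rw [Circle.smul_def, smul_eq_mul, h, neg_add, AddChar.map_add_eq_mul, Circle.coe_mul,
      Real.fourierChar_apply (-(p.2 * t)), mul_assoc, mul_comm (φ _)]
    congr 3
    push_cast
    ring
  simp only [e]
  rw [Measure.volume_eq_prod, integral_prod]
  · simp only [integral_const_mul, lastHat, Circle.smul_def, smul_eq_mul]
  · refine (integrable_lastHat_integrand φ t).bdd_mul (c := 1)
      (f := fun p : E3 × ℝ => (Real.fourierChar (-inner ℝ p.1 x) : ℂ)) ?_ ?_
    · exact (continuous_subtype_val.comp
        (Real.continuous_fourierChar.comp (by fun_prop))).aestronglyMeasurable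
    · exact ae_of_all _ fun p => (Circle.norm_coe _).le

/-- Undoing the first three variables of the full transform leaves the transform in the last one. -/
lemma integral_ch_mul_fourier (k : E3) (t : ℝ) :
    ∫ x : E3, ch k x * (𝓕 φ) (joinPt x t) = lastHat φ t k := by
  have h : 𝓕 (lastHat φ t) = fun x => (𝓕 φ) (joinPt x t) := funext fun x => fourier_joinPt φ x t
  have := congrFun ((continuous_lastHat φ t).fourierInv_fourier_eq (integrable_lastHat φ t)
    (by rw [h]; exact integrable_comp_joinPt (𝓕 φ) t)) k
  rw [h, Real.fourierInv_eq] at this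
  exact this

/-- Decay in t is read off from the full transform, which is Schwartz, by integrating it over the
first three variables. -/
lemma norm_lastHat_le : ∃ C, 0 ≤ C ∧ ∀ t k, ‖lastHat φ t k‖ ≤ C * wt t := by
  obtain ⟨C, hC, h⟩ := norm_joinPt_le_wt (𝓕 φ)
  have hI : 0 ≤ ∫ x, wt3 x := integral_nonneg fun x => (wt3_pos x).le
  refine ⟨C * ∫ x, wt3 x, by positivity, fun t k => ?_⟩
  rw [← integral_ch_mul_fourier]
  have h1 : ‖∫ x : E3, ch k x * (𝓕 φ) (joinPt x t)‖ ≤ ∫ x, C * wt t * wt3 x := by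
    refine norm_integral_le_of_norm_le (integrable_wt3.const_mul _) (ae_of_all _ fun x => ?_)
    rw [norm_mul, norm_ch, one_mul]
    refine (h x t).trans ?_
    rw [mul_assoc, mul_comm (wt t)]
    have := (wt3_pos x).le
    have := (wt_pos t).le
    gcongr
    · exact wt3_sq_le x
    · exact wt_sq_le t
  rw [integral_const_mul] at h1
  linarith

lemma measurable_lastHat : Measurable fun p : E3 × ℝ => lastHat φ p.2 p.1 := by
  have : StronglyMeasurable fun p : E3 × ℝ => ∫ η : ℝ, φ (joinPt p.1 η) *
      Complex.exp (-Complex.I * (p.2 * (2 * Real.pi * η : ℝ))) := by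
    refine StronglyMeasurable.integral_prod_right (f := fun (p : E3 × ℝ) (η : ℝ) =>
      φ (joinPt p.1 η) * Complex.exp (-Complex.I * (p.2 * (2 * Real.pi * η : ℝ)))) ?_
    refine Continuous.stronglyMeasurable ?_
    exact (φ.continuous.comp (Continuous.comp (g := fun p : E3 × ℝ => joinPt p.1 p.2)
      (f := fun q : (E3 × ℝ) × ℝ => (q.1.1, q.2)) continuous_joinPt (by fun_prop))).mul
      (by fun_prop)
  exact this.measurable

end Schwartz

end

/-! ### Parseval identities, validity of the formula and uniqueness -/

noncomputable section

section Schwartz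

variable (f : 𝓢(R4, ℂ))

lemma exists_uHat_decay {k : E3} (hk : GoodFreq k) :
    ∃ C, 0 ≤ C ∧ ∀ t, 0 ≤ t → ‖uHat f k t‖ ≤ C * wt t := by
  obtain ⟨c, hc, hb⟩ := partialHat_bound_wt f k
  obtain ⟨C, h⟩ := exists_norm_odeSol_le_decay hk.zeta_pos (bdryCoef k) (fun s _ => hb s)
  refine ⟨C, ?_, fun t ht => ?_⟩
  · have := (norm_nonneg _).trans (h 0 le_rfl)
    simpa using this
  · rw [wt_eq, ← mul_one_div]
    simpa [div_eq_mul_inv, uHat] using h t ht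

lemma exists_norm_sol_le : ∃ C, 0 ≤ C ∧ ∀ x t, 0 ≤ t → ‖sol f x t‖ ≤ C := by
  obtain ⟨C, hC, h⟩ := uHat_bounds f
  refine ⟨∫ k, C * majorant k, integral_nonneg fun k => mul_nonneg hC (majorant_nonneg k),
    fun x t ht => norm_integral_le_of_norm_le (integrable_majorant.const_mul C) ?_⟩
  filter_upwards [ae_goodFreq] with k hk
  rw [norm_mul, norm_ch, one_mul]
  exact (h k hk t ht).1

/-- The solution as a function on `ℝ⁴`. -/
def solFun (f : R4 → ℂ) (z : R4) : ℂ := sol f (fstThree z) (z 3)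

lemma oddExt_solFun (x : E3) (t : ℝ) :
    oddExt (solFun f) (joinPt x t) = if 0 < t then sol f x t else 0 :=
  oddExt_joinPt (fun x t _ _ => by rw [solFun, fstThree_joinPt, joinPt_three]) (sol_refl3 f) x t

lemma integrable_oddExt_mul (φ : 𝓢(R4, ℂ)) : Integrable fun p : E3 × ℝ =>
    if 0 < p.2 then sol f p.1 p.2 * φ (joinPt p.1 p.2) else 0 := by
  obtain ⟨C, hC, h⟩ := exists_norm_sol_le f
  have hS : MeasurableSet {p : E3 × ℝ | 0 < p.2} := measurableSet_lt measurable_const measurable_snd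
  have hm : AEStronglyMeasurable (fun p : E3 × ℝ => if 0 < p.2 then sol f p.1 p.2 else 0) := by
    have : (fun p : E3 × ℝ => if 0 < p.2 then sol f p.1 p.2 else 0) =
        indicator {p : E3 × ℝ | 0 < p.2} (fun p => sol f p.1 p.2) := rfl
    rw [this, aestronglyMeasurable_indicator_iff hS]
    exact ((continuousOn_sol f).mono (t := {p : E3 × ℝ | 0 < p.2})
      fun p (hp : 0 < p.2) => hp.le).aestronglyMeasurable hS
  have e : (fun p : E3 × ℝ => if 0 < p.2 then sol f p.1 p.2 * φ (joinPt p.1 p.2) else 0) =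
      fun p => (if 0 < p.2 then sol f p.1 p.2 else 0) * φ (joinPt p.1 p.2) := by
    ext p; rw [ite_mul, zero_mul]
  rw [e]
  refine (integrable_comp_joinPt_prod φ).bdd_mul (c := C) hm (ae_of_all _ fun p => ?_)
  split_ifs with hp
  · exact h _ _ hp.le
  · simpa using hC

lemma integrable_oddExt_solFun (φ : 𝓢(R4, ℂ)) :
    Integrable fun z => oddExt (solFun f) z * φ z := by
  rw [integrable_R4_iff]
  simp only [oddExt_solFun, ite_mul, zero_mul]
  exact integrable_oddExt_mul f φ

variable {f} {g : R4 → ℂ}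

lemma ae_goodFreq_fst : ∀ᵐ p : E3 × ℝ, GoodFreq p.1 :=
  Measure.quasiMeasurePreserving_fst (μ := (volume : Measure E3)) (ν := (volume : Measure ℝ))
    |>.ae ae_goodFreq

lemma integrable_solnHat_mul (hg : ∀ z ∈ closedHalfPlanes, g z = f z) (φ : 𝓢(R4, ℂ)) :
    Integrable fun p : E3 × ℝ =>
      solnHat g ((2 * Real.pi) • joinPt p.1 p.2) * φ (joinPt p.1 p.2) := by
  obtain ⟨C, hC, h⟩ := exists_norm_solnHat_le f hg
  obtain ⟨C', hC', h'⟩ := norm_joinPt_le_wt φ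
  refine ((integrable_majorant.const_mul C).mul_prod (integrable_wt.const_mul C')).mono' ?_ ?_
  · refine AEStronglyMeasurable.mul ?_ (integrable_comp_joinPt_prod φ).aestronglyMeasurable
    -- Measurability is obtained through the representation as a transform of `uHat`, valid at
    -- almost every frequency.
    have hm : StronglyMeasurable fun p : E3 × ℝ => ∫ t in Ioi (0 : ℝ), uHat f p.1 t *
        Complex.exp (-Complex.I * (t * (2 * Real.pi * p.2 : ℝ))) := by
      refine StronglyMeasurable.integral_prod_right (f := fun (p : E3 × ℝ) (t : ℝ) =>
        uHat f p.1 t * Complex.exp (-Complex.I * (t * (2 * Real.pi * p.2 : ℝ)))) ?_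
      refine (Measurable.mul ?_ ?_).stronglyMeasurable
      · exact Measurable.comp (g := fun p : E3 × ℝ => uHat f p.1 p.2)
          (f := fun q : (E3 × ℝ) × ℝ => (q.1.1, q.2)) (measurable_uHat f) (by fun_prop)
      · exact Continuous.measurable (by fun_prop)
    refine hm.aestronglyMeasurable.congr ?_
    filter_upwards [ae_goodFreq_fst] with p hp
    exact (solnHat_eq hg hp p.2).1.symm
  · filter_upwards [ae_goodFreq_fst] with p hp
    rw [norm_mul]
    refine mul_le_mul (h _ hp _) ((h' _ _).trans ?_) (norm_nonneg _)
      (mul_nonneg hC (majorant_nonneg _))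
    refine mul_le_mul_of_nonneg_left ?_ hC'
    have h1 := wt3_le_one p.1
    have h2 := (wt3_pos p.1).le
    calc wt3 p.1 ^ 2 * wt p.2 ^ 2 ≤ 1 * wt p.2 :=
          mul_le_mul (pow_le_one₀ h2 h1) (wt_sq_le p.2) (by positivity) zero_le_one
      _ = wt p.2 := one_mul _

/-- Parseval in the first three variables. -/
lemma integral_sol_mul_fourier (φ : 𝓢(R4, ℂ)) {t : ℝ} (ht : 0 < t) :
    ∫ x : E3, sol f x t * (𝓕 φ) (joinPt x t) = ∫ k : E3, uHat f k t * lastHat φ t k := by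
  obtain ⟨C, hC, h⟩ := uHat_bounds f
  have hi : Integrable (fun q : E3 × E3 => ch q.2 q.1 * uHat f q.2 t * (𝓕 φ) (joinPt q.1 t))
      (volume.prod volume) := by
    have i1 : Integrable fun x => (𝓕 φ) (joinPt x t) := integrable_comp_joinPt (𝓕 φ) t
    have i2 : Integrable fun k => uHat f k t := by
      refine (integrable_majorant.const_mul C).mono'
        (measurable_uHat_left f t).aestronglyMeasurable ?_
      filter_upwards [ae_goodFreq] with k hk using (h k hk t ht.le).1
    have i3 := (i1.mul_prod i2).bdd_mul (c := 1) (f := fun q : E3 × E3 => ch q.2 q.1)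
      (Continuous.aestronglyMeasurable (by fun_prop)) (ae_of_all _ fun q => (norm_ch _ _).le)
    exact i3.congr (ae_of_all _ fun q => by ring)
  calc _ = ∫ x : E3, ∫ k : E3, ch k x * uHat f k t * (𝓕 φ) (joinPt x t) := by
        congr 1; ext x
        rw [sol, integral_mul_const]
    _ = ∫ k : E3, ∫ x : E3, ch k x * uHat f k t * (𝓕 φ) (joinPt x t) :=
        integral_integral_swap hi
    _ = _ := by
        congr 1; ext k
        rw [← integral_ch_mul_fourier, ← integral_const_mul]
        congr 1; ext x
        ring

/-- Parseval in the last variable. -/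
lemma integral_uHat_mul_lastHat (hg : ∀ z ∈ closedHalfPlanes, g z = f z) (φ : 𝓢(R4, ℂ)) {k : E3}
    (hk : GoodFreq k) :
    ∫ t in Ioi (0 : ℝ), uHat f k t * lastHat φ t k =
      ∫ η : ℝ, solnHat g ((2 * Real.pi) • joinPt k η) * φ (joinPt k η) := by
  obtain ⟨C, hC, h⟩ := exists_uHat_decay f hk
  obtain ⟨C', hC', h'⟩ := norm_joinPt_le_wt φ
  have hcφ : Continuous fun η => φ (joinPt k η) :=
    φ.continuous.comp (Continuous.comp (g := fun p : E3 × ℝ => joinPt p.1 p.2)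
      (f := fun η => (k, η)) continuous_joinPt (by fun_prop))
  have hi : Integrable (fun q : ℝ × ℝ => uHat f k q.1 * (φ (joinPt k q.2) *
      Complex.exp (-Complex.I * (q.1 * (2 * Real.pi * q.2 : ℝ)))))
      ((volume.restrict (Ioi 0)).prod volume) := by
    have i1 : IntegrableOn (fun t => uHat f k t) (Ioi 0) := by
      refine (integrable_wt.const_mul C).integrableOn.mono' ?_ ?_
      · exact ((continuousOn_uHat hk).mono Ioi_subset_Ici_self).aestronglyMeasurable
          measurableSet_Ioi
      · filter_upwards [ae_restrict_mem measurableSet_Ioi] with t ht using h t (le_of_lt ht)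
    have i2 : Integrable fun η => φ (joinPt k η) := by
      refine (integrable_wt.const_mul (C' * wt3 k ^ 2)).mono' hcφ.aestronglyMeasurable
        (ae_of_all _ fun η => (h' k η).trans ?_)
      rw [mul_assoc]
      gcongr
      exact wt_sq_le η
    have i3 := (i1.mul_prod i2).bdd_mul (c := 1) (f := fun q : ℝ × ℝ =>
      Complex.exp (-Complex.I * (q.1 * (2 * Real.pi * q.2 : ℝ))))
      (Continuous.aestronglyMeasurable (by fun_prop))
      (ae_of_all _ fun q => (norm_exp_neg_I_mul _ _).le)
    exact i3.congr (ae_of_all _ fun q => by ring)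
  calc _ = ∫ t in Ioi (0 : ℝ), ∫ η : ℝ, uHat f k t * (φ (joinPt k η) *
        Complex.exp (-Complex.I * (t * (2 * Real.pi * η : ℝ)))) := by
        simp only [lastHat, integral_const_mul]
    _ = ∫ η : ℝ, ∫ t in Ioi (0 : ℝ), uHat f k t * (φ (joinPt k η) *
        Complex.exp (-Complex.I * (t * (2 * Real.pi * η : ℝ)))) := integral_integral_swap hi
    _ = _ := by
        congr 1; ext η
        rw [(solnHat_eq hg hk η).1, ← integral_mul_const]
        congr 1; ext t
        ring

variable (f) in
-- The bound on `uHat` that is uniform in the frequency has no decay in t, so the test function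
-- supplies the integrability in t and `majorant` that in k.
lemma integrable_uHat_mul_lastHat (φ : 𝓢(R4, ℂ)) :
    Integrable (fun q : ℝ × E3 => uHat f q.2 q.1 * lastHat φ q.1 q.2)
      ((volume.restrict (Ioi 0)).prod volume) := by
  obtain ⟨C, hC, h⟩ := uHat_bounds f
  obtain ⟨C', hC', h'⟩ := norm_lastHat_le φ
  refine ((integrable_wt.const_mul C').integrableOn.mul_prod
    (integrable_majorant.const_mul C)).mono' ?_ ?_
  · refine (Measurable.mul ?_ ?_).aestronglyMeasurable
    · exact Measurable.comp (g := fun p : E3 × ℝ => uHat f p.1 p.2)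
        (f := fun q : ℝ × E3 => (q.2, q.1)) (measurable_uHat f) (by fun_prop)
    · exact Measurable.comp (g := fun p : E3 × ℝ => lastHat φ p.2 p.1)
        (f := fun q : ℝ × E3 => (q.2, q.1)) (measurable_lastHat φ) (by fun_prop)
  · have h1 := Measure.quasiMeasurePreserving_fst
      (μ := (volume : Measure ℝ).restrict (Ioi 0)) (ν := (volume : Measure E3)) |>.ae
      (ae_restrict_mem measurableSet_Ioi)
    have h2 := Measure.quasiMeasurePreserving_snd
      (μ := (volume : Measure ℝ).restrict (Ioi 0)) (ν := (volume : Measure E3)) |>.ae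
      ae_goodFreq
    filter_upwards [h1, h2] with q hq1 hq2
    rw [norm_mul, mul_comm]
    exact mul_le_mul (h' _ _) (h _ hq2 _ (le_of_lt hq1)).1 (norm_nonneg _)
      (mul_nonneg hC' (wt_pos _).le)

/-- Parseval is applied on each slice t > 0 and then at almost every frequency k, with Fubini in
between. A single four-dimensional Plancherel argument would need integrability of the solution in
x, which has not been established. -/
lemma integral_oddExt_mul_fourier (hg : ∀ z ∈ closedHalfPlanes, g z = f z) (φ : 𝓢(R4, ℂ)) :
    ∫ p : E3 × ℝ, (if 0 < p.2 then sol f p.1 p.2 * (𝓕 φ) (joinPt p.1 p.2) else 0) =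
      ∫ p : E3 × ℝ, solnHat g ((2 * Real.pi) • joinPt p.1 p.2) * φ (joinPt p.1 p.2) := by
  have h1 : ∀ ψ : 𝓢(R4, ℂ),
      ∫ p : E3 × ℝ, (if 0 < p.2 then sol f p.1 p.2 * ψ (joinPt p.1 p.2) else 0) =
        ∫ t in Ioi (0 : ℝ), ∫ x : E3, sol f x t * ψ (joinPt x t) := fun ψ =>
    integral_prod_ite_pos (F := fun p => sol f p.1 p.2 * ψ (joinPt p.1 p.2))
      (integrable_oddExt_mul f ψ)
  have h2 : ∫ t in Ioi (0 : ℝ), ∫ x : E3, sol f x t * (𝓕 φ) (joinPt x t) =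
      ∫ t in Ioi (0 : ℝ), ∫ k : E3, uHat f k t * lastHat φ t k :=
    setIntegral_congr_fun measurableSet_Ioi fun t ht => integral_sol_mul_fourier φ ht
  have h3 : ∫ t in Ioi (0 : ℝ), ∫ k : E3, uHat f k t * lastHat φ t k =
      ∫ k : E3, ∫ t in Ioi (0 : ℝ), uHat f k t * lastHat φ t k :=
    integral_integral_swap (f := fun t k => uHat f k t * lastHat φ t k)
      (integrable_uHat_mul_lastHat f φ)
  have h4 : ∫ k : E3, ∫ t in Ioi (0 : ℝ), uHat f k t * lastHat φ t k =
      ∫ k : E3, ∫ η : ℝ, solnHat g ((2 * Real.pi) • joinPt k η) * φ (joinPt k η) :=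
    integral_congr_ae (ae_goodFreq.mono fun k hk => integral_uHat_mul_lastHat hg φ hk)
  have h5 := integral_prod (fun p : E3 × ℝ => solnHat g ((2 * Real.pi) • joinPt p.1 p.2) *
    φ (joinPt p.1 p.2)) (integrable_solnHat_mul hg φ)
  exact (h1 (𝓕 φ)).trans (h2.trans (h3.trans (h4.trans h5.symm)))

lemma isGivenByFormula_solFun (hg : ∀ z ∈ closedHalfPlanes, g z = f z) :
    IsGivenByFormula g (solFun f) where
  integrable_ext := integrable_oddExt_solFun f
  integrable_hat φ := by
    rw [integrable_R4_iff]
    exact integrable_solnHat_mul hg φ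
  fourier_eq φ := by
    rw [integral_R4_eq, integral_R4_eq]
    simp only [oddExt_solFun, ite_mul, zero_mul]
    exact integral_oddExt_mul_fourier hg φ

end Schwartz

lemma ae_eq_zero_of_integral_schwartz_eq_zero {h : R4 → ℂ}
    (hi : ∀ φ : 𝓢(R4, ℂ), Integrable fun z => h z * φ z)
    (h0 : ∀ φ : 𝓢(R4, ℂ), ∫ z, h z * φ z = 0) : ∀ᵐ z, h z = 0 := by
  have key : ∀ b : R4 → ℝ, ContDiff ℝ ∞ b → HasCompactSupport b →
      ∃ φ : 𝓢(R4, ℂ), ∀ z, φ z = b z := fun b hb hs =>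
    ⟨(hs.comp_left (g := fun r : ℝ => (r : ℂ)) Complex.ofReal_zero).toSchwartzMap
      (Complex.ofRealCLM.contDiff.comp hb), fun z => rfl⟩
  refine ae_eq_zero_of_integral_contDiff_smul_eq_zero (fun x => ?_) fun b hb hs => ?_
  -- A bump equal to 1 on the unit ball turns integrability against Schwartz functions into local
  -- integrability.
  · let β : ContDiffBump x := ⟨1, 2, one_pos, one_lt_two⟩
    obtain ⟨φ, hφ⟩ := key β β.contDiff β.hasCompactSupport
    refine ⟨Metric.closedBall x 1, Metric.closedBall_mem_nhds x one_pos, ?_⟩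
    refine (hi φ).integrableOn.congr_fun (fun z hz => ?_) measurableSet_closedBall
    simp only
    rw [hφ, β.one_of_mem_closedBall hz, Complex.ofReal_one, mul_one]
  · obtain ⟨φ, hφ⟩ := key b hb hs
    rw [← h0 φ]
    congr 1; ext z
    rw [hφ, Complex.real_smul, mul_comm]

/-- The right-hand side of the formula depends on `g` alone. Testing with inverse transforms makes
the function paired with the extension an arbitrary Schwartz function. -/
lemma IsGivenByFormula.ae_eq {g u w : R4 → ℂ} (hu : IsGivenByFormula g u)
    (hw : IsGivenByFormula g w) : ∀ᵐ z, oddExt u z = oddExt w z := by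
  have := ae_eq_zero_of_integral_schwartz_eq_zero (h := fun z => oddExt u z - oddExt w z)
    (fun φ => by
      simp only [sub_mul]
      exact (hu.integrable_ext φ).sub (hw.integrable_ext φ))
    (fun φ => by
      simp only [sub_mul]
      rw [integral_sub (hu.integrable_ext φ) (hw.integrable_ext φ)]
      have e : 𝓕 (𝓕⁻ φ) = φ := FourierTransform.fourier_fourierInv_eq φ
      have h1 := hu.fourier_eq (𝓕⁻ φ)
      have h2 := hw.fourier_eq (𝓕⁻ φ)
      rw [e] at h1 h2
      rw [h1, h2, sub_self])
  exact this.mono fun z hz => sub_eq_zero.1 hz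

end

theorem mainTheorem4 (g : R4 → ℂ) (hg : IsSchwartzUpToBoundary g) :
    (∃ u : R4 → ℂ, IsGivenByFormula g u) ∧
    ∀ u : R4 → ℂ, IsGivenByFormula g u →
      ∀ V : Set R4, (∃ O : Set R4, IsOpen O ∧ V = closedHalfPlanes ∩ O) → Disjoint V corner →
        ∃ w : R4 → ℂ, ContDiffOn ℝ ∞ w V ∧
          ∀ᵐ z ∂(MeasureTheory.volume.restrict V), u z = w z := by
  obtain ⟨f, hf⟩ := hg
  have hs := isGivenByFormula_solFun hf
  refine ⟨⟨_, hs⟩, fun u hu V hV hVc => ⟨solFun f, ?_, ?_⟩⟩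
  · obtain ⟨O, hO, rfl⟩ := hV
    exact (contDiffOn_sol f).mono fun z hz => ⟨hz.1, Set.disjoint_left.1 hVc hz⟩
  · obtain ⟨O, hO, rfl⟩ := hV
    have hm : MeasurableSet (closedHalfPlanes ∩ O) := by
      refine MeasurableSet.inter (IsClosed.measurableSet ?_) hO.measurableSet
      exact (isClosed_le continuous_const (continuous_euclidean_apply 2)).inter
        (isClosed_le continuous_const (continuous_euclidean_apply 3))
    rw [MeasureTheory.ae_restrict_iff' hm]
    -- The faces are null sets; off them a point of V lies in the open set, where the extension is
    -- the function itself.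
    filter_upwards [hu.ae_eq hs, ae_coord_ne_zero (n := 4) 2, ae_coord_ne_zero (n := 4) 3]
      with z hz h2 h3 hzV
    have hmem : z ∈ halfPlanes := ⟨lt_of_le_of_ne hzV.1.1 h2.symm, lt_of_le_of_ne hzV.1.2 h3.symm⟩
    simpa only [oddExt, if_pos hmem] using hz
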